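/- Let $d\ge 0$ be an integer. Let $\mathcal S_{1/2}(\mathbf R^d)$ be the Gelfand–Shilov space of all $\psi\in C^\infty(\mathbf R^d)$ such that, for some $h,B>0$, $|x^\beta\partial^\alpha \psi(x)|\le B\,h^{|\alpha+\beta|}(\alpha!\,\beta!)^{1/2}$ for all $x$ and all multi-indices $\alpha,\beta$, with its inductive limit topology, and let $\mathcal S_{1/2}'(\mathbf R^d)$ be its dual. For $f\in\mathcal S_{1/2}'(\mathbf R^d)$ and $\varphi(y)=\pi^{-d/4}e^{-|y|^2/2}$ let $V_\varphi f(x,\xi)=(2\pi)^{-d/2}\langle f,\overline{\varphi(\cdot-x)}\,e^{-i\langle\cdot,\xi\rangle}\rangle$, $(x,\xi)\in\mathbf R^{2d}$. For $0<p<\infty$ set $\|f\|_{M^p}=\|V_\varphi f\|_{L^p(\mathbf R^{2d})}$ and, for a Young function $\Phi$, $\|f\|_{M^\Phi}=\inf\{\lambda>0:\iint \Phi(|V_\varphi f(x,\xi)|/\lambda)\,dx\,d\xi\le 1\}$. Let $M^p(\mathbf R^d)$ and $M^\Phi(\mathbf R^d)$ be the spaces of all $f\in\mathcal S_{1/2}'(\mathbf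 R^d)$ for which the respective (quasi-)norm is finite, topologized by it. Here a Young function is a convex function $\Phi:[0,\infty]\to[0,\infty]$ with $\Phi(0)=0$ and $\lim_{t\to\infty}\Phi(t)=\Phi(\infty)=\infty$. Let $\Phi$ be a Young function such that, for some $t_0>0$, $\Phi(t)=-t^2\log t$ when $0\le t\le t_0$ (with $0\log 0=0$). Then: 1. for every $0<p<2$, $M^p(\mathbf R^d)\subseteq M^\Phi(\mathbf R^d)\subseteq M^2(\mathbf R^d)$ with continuous inclusions, that is, $\|f\|_{M^\Phi}\le C\|f\|_{M^p}$ for $f\in M^p(\mathbf R^d)$ and $\|f\|_{M^2}\le C'\|f\|_{M^\Phi}$ for $f\in M^\Phi(\mathbf R^d)$, with finite constants $C=C(d,\Phi,p)$ and $C'=C'(d,\Phi)$; 2. $M^\Phi(\mathbf R^d)$ is dense in $M^2(\mathbf R^d)$; 3. if $f\in M^{p_0}(\mathbf R^d)$ for some $1\le p_0<2$, then $\lim_{p\to2-}\|f\|_{M^p}=\|f\|_{M^2}$. The same holds when the norms are formed with any other fixed window: $f$ is a function in $L^2(\mathbf R^d)$, and for every $\phi\in M^1(\mathbf R^d)\setminus\{0\}$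 which is given by a function in $L^2(\mathbf R^d)$, the functions $V_\phi f(x,\xi)=(2\pi)^{-d/2}\int f(y)\overline{\phi(y-x)}e^{-i\langle y,\xi\rangle}\,dy$ satisfy $\lim_{p\to2-}\|V_\phi f\|_{L^p(\mathbf R^{2d})}=\|V_\phi f\|_{L^2(\mathbf R^{2d})}$. (Every $\phi\in M^1(\mathbf R^d)$ is such a function, by the preceding assertion with $p_0=1$.) -/

import Mathlib

open MeasureTheory Filter Topology
open scoped ENNReal NNReal ContDiff ComplexConjugate

noncomputable section

namespace OrliczMod

/-- The Euclidean space `ℝᵈ`. -/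
abbrev E (d : ℕ) : Type := EuclideanSpace ℝ (Fin d)

/-! ### Gelfand-Shilov spaces and their distributions -/

/-- The partial derivative `∂ᵢ f`. -/
def pderiv {d : ℕ} (i : Fin d) (f : E d → ℂ) : E d → ℂ :=
  fun x => fderiv ℝ f x (EuclideanSpace.single i 1)

/-- The partial derivative `∂^α f = ∂₁^α₁ ⋯ ∂_d^α_d f` for a multi-index `α`. -/
def mderiv {d : ℕ} (α : Fin d → ℕ) (f : E d → ℂ) : E d → ℂ :=
  (List.finRange d).foldr (fun i g => (pderiv i)^[α i] g) f

/-- `‖f‖_{S_{s,h}} ≤ B`, that is,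
`|x^β ∂^α f(x)| ≤ B h^{|α + β|} (α! β!)^s` for all `x` and all multi-indices `α`, `β`. -/
def SeminormLE {d : ℕ} (s h B : ℝ) (f : E d → ℂ) : Prop :=
  ∀ (α β : Fin d → ℕ) (x : E d),
    ‖((∏ i, x i ^ β i : ℝ) : ℂ) * mderiv α f x‖ ≤
      B * h ^ (∑ i, (α i + β i)) * ((∏ i, ((α i).factorial * (β i).factorial) : ℕ) : ℝ) ^ s

lemma contDiff_pderiv {d : ℕ} (i : Fin d) {f : E d → ℂ} (hf : ContDiff ℝ ∞ f) :
    ContDiff ℝ ∞ (pderiv i f) := by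
  unfold pderiv
  exact (hf.fderiv_right (m := ∞) (by simp)).clm_apply contDiff_const

lemma contDiff_pderiv_iter {d : ℕ} (i : Fin d) (n : ℕ) {f : E d → ℂ} (hf : ContDiff ℝ ∞ f) :
    ContDiff ℝ ∞ ((pderiv i)^[n] f) := by
  induction n generalizing f with
  | zero => simpa using hf
  | succ n ih => rw [Function.iterate_succ_apply]; exact ih (contDiff_pderiv i hf)

lemma pderiv_add {d : ℕ} (i : Fin d) {f g : E d → ℂ} (hf : ContDiff ℝ ∞ f)
    (hg : ContDiff ℝ ∞ g) : pderiv i (f + g) = pderiv i f + pderiv i g := by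
  funext x
  simp only [pderiv, Pi.add_apply]
  rw [fderiv_add (hf.differentiable (by simp) x) (hg.differentiable (by simp) x)]
  rfl

lemma pderiv_smul {d : ℕ} (i : Fin d) (c : ℂ) {f : E d → ℂ} (hf : ContDiff ℝ ∞ f) :
    pderiv i (c • f) = c • pderiv i f := by
  funext x
  simp only [pderiv, Pi.smul_apply]
  rw [fderiv_const_smul (hf.differentiable (by simp) x)]
  rfl

lemma pderiv_iter_add {d : ℕ} (i : Fin d) (n : ℕ) {f g : E d → ℂ} (hf : ContDiff ℝ ∞ f)
    (hg : ContDiff ℝ ∞ g) :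
    (pderiv i)^[n] (f + g) = (pderiv i)^[n] f + (pderiv i)^[n] g := by
  induction n generalizing f g with
  | zero => rfl
  | succ n ih =>
    simp only [Function.iterate_succ_apply]
    rw [pderiv_add i hf hg, ih (contDiff_pderiv i hf) (contDiff_pderiv i hg)]

lemma pderiv_iter_smul {d : ℕ} (i : Fin d) (n : ℕ) (c : ℂ) {f : E d → ℂ}
    (hf : ContDiff ℝ ∞ f) : (pderiv i)^[n] (c • f) = c • (pderiv i)^[n] f := by
  induction n generalizing f with
  | zero => rfl
  | succ n ih =>
    simp only [Function.iterate_succ_apply]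
    rw [pderiv_smul i c hf, ih (contDiff_pderiv i hf)]

lemma contDiff_foldr {d : ℕ} (α : Fin d → ℕ) (l : List (Fin d)) {f : E d → ℂ}
    (hf : ContDiff ℝ ∞ f) :
    ContDiff ℝ ∞ (l.foldr (fun i g => (pderiv i)^[α i] g) f) := by
  induction l with
  | nil => simpa using hf
  | cons i l ih => exact contDiff_pderiv_iter i (α i) ih

lemma mderiv_add {d : ℕ} (α : Fin d → ℕ) {f g : E d → ℂ} (hf : ContDiff ℝ ∞ f)
    (hg : ContDiff ℝ ∞ g) : mderiv α (f + g) = mderiv α f + mderiv α g := by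
  unfold mderiv
  induction List.finRange d with
  | nil => rfl
  | cons i l ih =>
    simp only [List.foldr_cons]
    rw [ih, pderiv_iter_add i _ (contDiff_foldr α l hf) (contDiff_foldr α l hg)]

lemma mderiv_smul {d : ℕ} (α : Fin d → ℕ) (c : ℂ) {f : E d → ℂ} (hf : ContDiff ℝ ∞ f) :
    mderiv α (c • f) = c • mderiv α f := by
  unfold mderiv
  induction List.finRange d with
  | nil => rfl
  | cons i l ih =>
    simp only [List.foldr_cons]
    rw [ih, pderiv_iter_smul i _ c (contDiff_foldr α l hf)]

lemma SeminormLE.mono {d : ℕ} {s h h' B : ℝ} (hh : 0 < h) (hhh : h ≤ h') (hB : 0 ≤ B)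
    {f : E d → ℂ} (hf : SeminormLE s h B f) : SeminormLE s h' B f := by
  intro α β x
  refine (hf α β x).trans ?_
  gcongr

/-- The Gelfand-Shilov space `S_s(ℝᵈ)` of Roumieu type: the smooth functions `f` with
`‖f‖_{S_{s,h}} < ∞` for some `h > 0`. -/
def GelfandShilov (s : ℝ) (d : ℕ) : Submodule ℂ (E d → ℂ) where
  carrier := {f | ContDiff ℝ ∞ f ∧ ∃ h > 0, ∃ B ≥ 0, SeminormLE s h B f}
  zero_mem' := by
    refine ⟨contDiff_const, 1, one_pos, 0, le_rfl, fun α β x => ?_⟩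
    have h : mderiv α (0 : E d → ℂ) = 0 := by
      have := mderiv_smul α (0 : ℂ) (f := (0 : E d → ℂ)) contDiff_const
      simpa using this
    simp [h]
  add_mem' := by
    rintro f g ⟨hf, h₁, hh₁, B₁, hB₁, hf'⟩ ⟨hg, h₂, hh₂, B₂, hB₂, hg'⟩
    refine ⟨hf.add hg, max h₁ h₂, lt_max_of_lt_left hh₁, B₁ + B₂, add_nonneg hB₁ hB₂,
      fun α β x => ?_⟩
    have e₁ := hf'.mono hh₁ (le_max_left h₁ h₂) hB₁ α β x
    have e₂ := hg'.mono hh₂ (le_max_right h₁ h₂) hB₂ α β x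
    rw [mderiv_add α hf hg, Pi.add_apply, mul_add, add_mul, add_mul]
    exact (norm_add_le _ _).trans (add_le_add e₁ e₂)
  smul_mem' := by
    rintro c f ⟨hf, h₁, hh₁, B₁, hB₁, hf'⟩
    refine ⟨contDiff_const.smul hf, h₁, hh₁, ‖c‖ * B₁, by positivity, fun α β x => ?_⟩
    have e₁ := hf' α β x
    rw [mderiv_smul α c hf, Pi.smul_apply, smul_eq_mul, mul_left_comm, norm_mul,
      mul_assoc ‖c‖, mul_assoc ‖c‖]
    gcongr

/-- The Gelfand-Shilov distribution space `S_s'(ℝᵈ)`: the continuous linear functionals on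
the inductive limit `S_s(ℝᵈ)`, that is, the linear functionals whose restriction to
`S_{s,h}(ℝᵈ)` is bounded for every `h > 0`. -/
def GSDistribution (s : ℝ) (d : ℕ) : Submodule ℂ (GelfandShilov s d →ₗ[ℂ] ℂ) where
  carrier := {u | ∀ h > 0, ∃ C ≥ 0, ∀ (ψ : GelfandShilov s d) (B : ℝ), 0 ≤ B →
    SeminormLE s h B (ψ : E d → ℂ) → ‖u ψ‖ ≤ C * B}
  zero_mem' := by
    intro h _
    exact ⟨0, le_rfl, fun ψ B _ _ => by simp⟩
  add_mem' := by
    intro u v hu hv h hh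
    obtain ⟨C₁, hC₁, h₁⟩ := hu h hh
    obtain ⟨C₂, hC₂, h₂⟩ := hv h hh
    refine ⟨C₁ + C₂, add_nonneg hC₁ hC₂, fun ψ B hB hψ => ?_⟩
    rw [LinearMap.add_apply, add_mul]
    exact (norm_add_le _ _).trans (add_le_add (h₁ ψ B hB hψ) (h₂ ψ B hB hψ))
  smul_mem' := by
    intro c u hu h hh
    obtain ⟨C₁, hC₁, h₁⟩ := hu h hh
    refine ⟨‖c‖ * C₁, by positivity, fun ψ B hB hψ => ?_⟩
    rw [LinearMap.smul_apply, norm_smul, mul_assoc]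
    exact mul_le_mul_of_nonneg_left (h₁ ψ B hB hψ) (norm_nonneg c)

/-! ### Time-frequency atoms and the short-time Fourier transform -/

/-- The Gaussian window `φ(y) = π^{-d/4} e^{-|y|²/2}`. -/
def gaussian (d : ℕ) (y : E d) : ℂ :=
  ((Real.pi ^ (-(d : ℝ) / 4) * Real.exp (-‖y‖ ^ 2 / 2) : ℝ) : ℂ)

/-- The function `y ↦ (2π)^{-d/2} conj(φ(y - x)) e^{-i⟨y, ξ⟩}`, against which a function or
distribution is integrated to obtain its short-time Fourier transform at `(x, ξ)`. -/
def atom {d : ℕ} (φ : E d → ℂ) (x ξ : E d) (y : E d) : ℂ :=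
  (((2 * Real.pi) ^ (-(d : ℝ) / 2) : ℝ) : ℂ) * conj (φ (y - x)) *
    Complex.exp (-Complex.I * (inner ℝ y ξ : ℝ))

/-- The derivatives of `t ↦ exp(-(t - x)²/2 - i t ξ)`, through their recurrence. -/
def gaussDeriv (x ξ : ℝ) : ℕ → ℝ → ℂ
  | 0, t => Complex.exp (-((t : ℂ) - x) ^ 2 / 2 - Complex.I * t * ξ)
  | 1, t => ((x : ℂ) - Complex.I * ξ - t) *
      Complex.exp (-((t : ℂ) - x) ^ 2 / 2 - Complex.I * t * ξ)
  | (a + 2), t => ((x : ℂ) - Complex.I * ξ - t) * gaussDeriv x ξ (a + 1) t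
      - (a + 1) * gaussDeriv x ξ a t

lemma hasDerivAt_gaussDeriv (x ξ : ℝ) (a : ℕ) (t : ℝ) :
    HasDerivAt (gaussDeriv x ξ a) (gaussDeriv x ξ (a + 1) t) t := by
  have h0 : HasDerivAt (fun t : ℝ => (t : ℂ)) 1 t := Complex.ofRealCLM.hasDerivAt
  have hc : HasDerivAt (fun t : ℝ => (x : ℂ) - Complex.I * ξ - t) (-1) t := by
    simpa using h0.const_sub ((x : ℂ) - Complex.I * ξ)
  have hg : HasDerivAt (gaussDeriv x ξ 0) (gaussDeriv x ξ 1 t) t := by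
    have := ((((h0.sub_const (x : ℂ)).pow 2).neg.div_const 2).sub
      ((h0.const_mul Complex.I).mul_const (ξ : ℂ))).cexp
    refine this.congr_deriv ?_
    simp only [gaussDeriv, Pi.pow_apply, Pi.neg_apply, Pi.sub_apply]
    push_cast
    ring
  induction a using Nat.strong_induction_on with
  | _ a ih =>
    match a, ih with
    | 0, _ => exact hg
    | 1, _ =>
      have := hc.mul hg
      refine this.congr_deriv ?_
      simp only [gaussDeriv]
      push_cast
      ring
    | (a + 2), ih =>
      have := (hc.mul (ih (a + 1) (by omega))).sub ((ih a (by omega)).const_mul ((a : ℂ) + 1))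
      refine this.congr_deriv ?_
      simp only [gaussDeriv]
      push_cast
      ring

lemma deriv_iter_gauss (x ξ : ℝ) (a : ℕ) : deriv^[a] (gaussDeriv x ξ 0) = gaussDeriv x ξ a := by
  induction a with
  | zero => rfl
  | succ a ih =>
    rw [Function.iterate_succ_apply', ih]
    funext t
    exact (hasDerivAt_gaussDeriv x ξ a t).deriv

lemma contDiff_gauss (x ξ : ℝ) : ContDiff ℝ ∞ (gaussDeriv x ξ 0) := by
  have : gaussDeriv x ξ 0 =
      fun t : ℝ => Complex.exp (-((t : ℂ) - x) ^ 2 / 2 - Complex.I * t * ξ) := by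
    funext t; simp [gaussDeriv]
  rw [this]
  have h0 : ContDiff ℝ ∞ (fun t : ℝ => (t : ℂ)) := Complex.ofRealCLM.contDiff
  fun_prop

lemma gauss_base_bound (x ξ : ℝ) (b : ℕ) (t : ℝ) :
    |t| ^ b * ‖gaussDeriv x ξ 0 t‖ ≤
      Real.exp (x ^ 2 / 2) * 2 ^ b * Real.sqrt (b.factorial) := by
  have h1 : ‖gaussDeriv x ξ 0 t‖ = Real.exp (-(t - x) ^ 2 / 2) := by
    simp only [gaussDeriv, Complex.norm_exp]
    congr 1
    have : (-((t : ℂ) - x) ^ 2 / 2 - Complex.I * t * ξ)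
        = ((-(t - x) ^ 2 / 2 : ℝ) : ℂ) + ((-(t * ξ) : ℝ) : ℂ) * Complex.I := by
      push_cast; ring
    rw [this, Complex.add_re, Complex.ofReal_re, Complex.re_ofReal_mul, Complex.I_re]
    ring
  have h2 : Real.exp (-(t - x) ^ 2 / 2) ≤ Real.exp (x ^ 2 / 2) * Real.exp (-t ^ 2 / 4) := by
    rw [← Real.exp_add]
    apply Real.exp_le_exp.mpr
    nlinarith [sq_nonneg (t - 2 * x)]
  have h3 : |t| ^ b * Real.exp (-t ^ 2 / 4) ≤ 2 ^ b * Real.sqrt (b.factorial) := by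
    apply le_of_sq_le_sq _ (by positivity)
    rw [mul_pow, mul_pow, Real.sq_sqrt (by positivity), ← Real.exp_nat_mul]
    have h4 := Real.pow_div_factorial_le_exp (t ^ 2 / 2) (by positivity) b
    rw [div_le_iff₀ (by positivity)] at h4
    have h5 : (|t| ^ b) ^ 2 = 2 ^ b * (t ^ 2 / 2) ^ b := by
      rw [← mul_pow, ← pow_mul, mul_comm b 2, pow_mul, sq_abs]; congr 1; ring
    have h6 : Real.exp ((2 : ℕ) * (-t ^ 2 / 4)) * Real.exp (t ^ 2 / 2) = 1 := by
      rw [← Real.exp_add]; push_cast; ring_nf; simp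
    calc (|t| ^ b) ^ 2 * Real.exp ((2 : ℕ) * (-t ^ 2 / 4))
        ≤ 2 ^ b * (Real.exp (t ^ 2 / 2) * b.factorial) *
            Real.exp ((2 : ℕ) * (-t ^ 2 / 4)) := by
          rw [h5]; gcongr
      _ = 2 ^ b * b.factorial *
            (Real.exp ((2 : ℕ) * (-t ^ 2 / 4)) * Real.exp (t ^ 2 / 2)) := by ring
      _ = 2 ^ b * b.factorial := by rw [h6, mul_one]
      _ ≤ (2 ^ b) ^ 2 * b.factorial := by
          gcongr
          rw [← pow_mul]
          exact pow_le_pow_right₀ (by norm_num) (by omega)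
  calc |t| ^ b * ‖gaussDeriv x ξ 0 t‖
      ≤ |t| ^ b * (Real.exp (x ^ 2 / 2) * Real.exp (-t ^ 2 / 4)) := by
        rw [h1]; gcongr
    _ = Real.exp (x ^ 2 / 2) * (|t| ^ b * Real.exp (-t ^ 2 / 4)) := by ring
    _ ≤ Real.exp (x ^ 2 / 2) * (2 ^ b * Real.sqrt (b.factorial)) := by gcongr
    _ = _ := by ring

lemma gauss_bound_aux (x ξ : ℝ) (H : ℝ) (hH : H = ‖(x : ℂ) - Complex.I * ξ‖ + 3)
    (a b : ℕ) (t : ℝ) :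
    |t| ^ b * ‖gaussDeriv x ξ a t‖ ≤
      Real.exp (x ^ 2 / 2) * H ^ a * 2 ^ b * Real.sqrt ((a + b).factorial) := by
  set c : ℂ := (x : ℂ) - Complex.I * ξ with hc
  have hH3 : 3 ≤ H := by rw [hH]; linarith [norm_nonneg c]
  have hct : ‖c - t‖ ≤ ‖c‖ + |t| := by
    simpa using norm_sub_le c (t : ℂ)
  have hs : ∀ n : ℕ, Real.sqrt (n.factorial) ≤ Real.sqrt ((n + 1).factorial) := fun n =>
    Real.sqrt_le_sqrt (by exact_mod_cast Nat.factorial_le (Nat.le_succ n))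
  have hs2 : ∀ n : ℕ, ((n : ℝ) + 1) * Real.sqrt (n.factorial)
      ≤ Real.sqrt ((n + 2).factorial) := fun n => by
    apply Real.le_sqrt_of_sq_le
    rw [mul_pow, Real.sq_sqrt (by positivity)]
    have : ((n + 2).factorial : ℝ) = (n + 2) * ((n + 1) * n.factorial) := by
      rw [Nat.factorial_succ, Nat.factorial_succ]; push_cast; ring
    rw [this]
    have hp : (0 : ℝ) ≤ (n + 1) * n.factorial := by positivity
    nlinarith
  have hcH : ‖c‖ = H - 3 := by rw [hH]; ring
  induction a using Nat.strong_induction_on generalizing b with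
  | _ a ih =>
    match a, ih with
    | 0, _ => simpa using gauss_base_bound x ξ b t
    | 1, ih =>
      have e0 := gauss_base_bound x ξ b t
      have e1 := gauss_base_bound x ξ (b + 1) t
      have hk : gaussDeriv x ξ 1 t = (c - t) * gaussDeriv x ξ 0 t := by simp [gaussDeriv, hc]
      rw [hk, norm_mul, add_comm 1 b]
      set K := Real.exp (x ^ 2 / 2) * 2 ^ b with hK
      have hK0 : 0 ≤ K := by positivity
      have e0' : |t| ^ b * ‖gaussDeriv x ξ 0 t‖ ≤ K * Real.sqrt ((b + 1).factorial) :=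
        e0.trans (mul_le_mul_of_nonneg_left (hs b) hK0)
      calc |t| ^ b * (‖c - t‖ * ‖gaussDeriv x ξ 0 t‖)
          ≤ |t| ^ b * ((‖c‖ + |t|) * ‖gaussDeriv x ξ 0 t‖) := by gcongr
        _ = ‖c‖ * (|t| ^ b * ‖gaussDeriv x ξ 0 t‖)
            + |t| ^ (b + 1) * ‖gaussDeriv x ξ 0 t‖ := by ring
        _ ≤ ‖c‖ * (K * Real.sqrt ((b + 1).factorial))
            + Real.exp (x ^ 2 / 2) * 2 ^ (b + 1) * Real.sqrt ((b + 1).factorial) := by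
            gcongr
        _ = (‖c‖ + 2) * (K * Real.sqrt ((b + 1).factorial)) := by rw [hK]; ring
        _ ≤ H * (K * Real.sqrt ((b + 1).factorial)) := by
            gcongr; linarith
        _ = _ := by rw [hK]; ring
    | (a + 2), ih =>
      have e0 := ih a (by omega) b
      have e1 := ih (a + 1) (by omega) b
      have e2 := ih (a + 1) (by omega) (b + 1)
      have hk : gaussDeriv x ξ (a + 2) t = (c - t) * gaussDeriv x ξ (a + 1) t
          - (a + 1) * gaussDeriv x ξ a t := by simp [gaussDeriv, hc]
      have hn : ‖gaussDeriv x ξ (a + 2) t‖ ≤ (‖c‖ + |t|) * ‖gaussDeriv x ξ (a + 1) t‖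
          + ((a : ℝ) + 1) * ‖gaussDeriv x ξ a t‖ := by
        rw [hk]
        refine (norm_sub_le _ _).trans ?_
        rw [norm_mul, norm_mul]
        have : ‖(a : ℂ) + 1‖ = (a : ℝ) + 1 := by
          have := Complex.norm_natCast (a + 1); push_cast at this; exact this
        rw [this]
        gcongr
      set S := Real.sqrt ((a + 2 + b).factorial) with hS
      set K := Real.exp (x ^ 2 / 2) * H ^ a * 2 ^ b with hK
      have hH0 : 0 ≤ H := by linarith
      have hK0 : 0 ≤ K := by positivity
      have hS0 : 0 ≤ S := Real.sqrt_nonneg _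
      have f0 : ((a : ℝ) + 1) * Real.sqrt ((a + b).factorial) ≤ S := by
        have h := hs2 (a + b)
        rw [show a + b + 2 = a + 2 + b by ring] at h
        refine le_trans ?_ h
        push_cast
        gcongr
        linarith [(Nat.cast_nonneg b : (0 : ℝ) ≤ b)]
      have f1 : Real.sqrt ((a + 1 + b).factorial) ≤ S := by
        have h := hs (a + 1 + b)
        rwa [show a + 1 + b + 1 = a + 2 + b by ring] at h
      have f2 : Real.sqrt ((a + 1 + (b + 1)).factorial) = S := by
        rw [hS, show a + 1 + (b + 1) = a + 2 + b by ring]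
      calc |t| ^ b * ‖gaussDeriv x ξ (a + 2) t‖
          ≤ |t| ^ b * ((‖c‖ + |t|) * ‖gaussDeriv x ξ (a + 1) t‖
            + ((a : ℝ) + 1) * ‖gaussDeriv x ξ a t‖) := by gcongr
        _ = ‖c‖ * (|t| ^ b * ‖gaussDeriv x ξ (a + 1) t‖)
            + |t| ^ (b + 1) * ‖gaussDeriv x ξ (a + 1) t‖
            + ((a : ℝ) + 1) * (|t| ^ b * ‖gaussDeriv x ξ a t‖) := by ring
        _ ≤ ‖c‖ * (Real.exp (x ^ 2 / 2) * H ^ (a + 1) * 2 ^ b * S)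
            + Real.exp (x ^ 2 / 2) * H ^ (a + 1) * 2 ^ (b + 1) * S
            + ((a : ℝ) + 1) * (K * Real.sqrt ((a + b).factorial)) := by
            rw [f2] at e2
            have e1' := e1.trans (mul_le_mul_of_nonneg_left f1 (by positivity))
            gcongr
        _ = ((‖c‖ + 2) * H) * (K * S)
            + K * (((a : ℝ) + 1) * Real.sqrt ((a + b).factorial)) := by rw [hK]; ring
        _ ≤ ((‖c‖ + 2) * H) * (K * S) + K * S := by gcongr
        _ = ((‖c‖ + 2) * H + 1) * (K * S) := by ring
        _ ≤ H ^ 2 * (K * S) := by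
            gcongr
            rw [hcH]; nlinarith
        _ = _ := by rw [hK]; ring

lemma gauss_bound (x ξ : ℝ) : ∃ h > 0, ∃ B ≥ 0, ∀ (a b : ℕ) (t : ℝ),
    |t| ^ b * ‖gaussDeriv x ξ a t‖ ≤
      B * h ^ (a + b) * Real.sqrt ((a.factorial * b.factorial : ℕ)) := by
  set H : ℝ := ‖(x : ℂ) - Complex.I * ξ‖ + 3 with hH
  have hH3 : 3 ≤ H := by rw [hH]; linarith [norm_nonneg ((x : ℂ) - Complex.I * ξ)]
  have hH0 : 0 ≤ H := by linarith
  refine ⟨2 * H, by linarith, Real.exp (x ^ 2 / 2), by positivity, fun a b t => ?_⟩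
  refine (gauss_bound_aux x ξ H hH a b t).trans ?_
  have h1 : Real.sqrt ((a + b).factorial) ≤
      2 ^ (a + b) * Real.sqrt ((a.factorial * b.factorial : ℕ)) := by
    apply Real.sqrt_le_iff.mpr
    refine ⟨by positivity, ?_⟩
    rw [mul_pow, Real.sq_sqrt (by positivity)]
    have h2 : (a + b).factorial ≤ 2 ^ (a + b) * (a.factorial * b.factorial) := by
      rw [← Nat.add_choose_mul_factorial_mul_factorial a b, mul_assoc]
      exact Nat.mul_le_mul_right _ (Nat.choose_le_two_pow _ _)
    calc ((a + b).factorial : ℝ) ≤ 2 ^ (a + b) * ((a.factorial * b.factorial : ℕ) : ℝ) := by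
          exact_mod_cast h2
      _ ≤ (2 ^ (a + b)) ^ 2 * ((a.factorial * b.factorial : ℕ) : ℝ) := by
          gcongr
          rw [← pow_mul]
          exact pow_le_pow_right₀ (by norm_num) (by omega)
  have h2 : (2 : ℝ) ^ b ≤ H ^ b := pow_le_pow_left₀ (by norm_num) (by linarith) b
  calc Real.exp (x ^ 2 / 2) * H ^ a * 2 ^ b * Real.sqrt ((a + b).factorial)
      ≤ Real.exp (x ^ 2 / 2) * H ^ a * H ^ b *
        (2 ^ (a + b) * Real.sqrt ((a.factorial * b.factorial : ℕ))) := by gcongr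
    _ = _ := by rw [mul_pow, pow_add H]; ring

/-- The tensor product `y ↦ ∏ᵢ Gᵢ(yᵢ)`. -/
def tensor {d : ℕ} (G : Fin d → ℝ → ℂ) (y : E d) : ℂ := ∏ i, G i (y i)

lemma contDiff_tensor {d : ℕ} {G : Fin d → ℝ → ℂ} (hG : ∀ i, ContDiff ℝ ∞ (G i)) :
    ContDiff ℝ ∞ (tensor G) := by
  unfold tensor
  refine contDiff_prod fun i _ => (hG i).comp ?_
  exact (EuclideanSpace.proj i : E d →L[ℝ] ℝ).contDiff

lemma pderiv_tensor {d : ℕ} (i : Fin d) {G : Fin d → ℝ → ℂ}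
    (hG : ∀ i, ContDiff ℝ ∞ (G i)) :
    pderiv i (tensor G) = tensor (Function.update G i (deriv (G i))) := by
  funext y
  have hl : HasFDerivAt (tensor G) (fderiv ℝ (tensor G) y) y :=
    ((contDiff_tensor hG).differentiable (by simp) y).hasFDerivAt
  have hline : HasDerivAt (fun s : ℝ => y + s • (EuclideanSpace.single i 1 : E d))
      (EuclideanSpace.single i 1) 0 := by
    simpa using ((hasDerivAt_id (0 : ℝ)).smul_const
      (EuclideanSpace.single i (1 : ℝ) : E d)).const_add y
  have hl' : HasFDerivAt (tensor G) (fderiv ℝ (tensor G) y)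
      (y + (0 : ℝ) • (EuclideanSpace.single i 1 : E d)) := by simpa using hl
  have h1 := hl'.comp_hasDerivAt (0 : ℝ) hline
  have h2 : HasDerivAt (fun s : ℝ => G i (y i + s)) (deriv (G i) (y i)) 0 := by
    have h := ((hG i).differentiable (by simp) (y i + 0)).hasDerivAt.comp_const_add (y i) 0
    simpa using h
  have h3 := h2.mul_const (∏ j ∈ Finset.univ.erase i, G j (y j))
  have heq : (tensor G ∘ fun s : ℝ => y + s • (EuclideanSpace.single i 1 : E d))
      = fun s : ℝ => G i (y i + s) * ∏ j ∈ Finset.univ.erase i, G j (y j) := by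
    funext s
    simp only [Function.comp, tensor]
    rw [← Finset.mul_prod_erase _ _ (Finset.mem_univ i)]
    congr 1
    · simp
    · refine Finset.prod_congr rfl fun j hj => ?_
      have : j ≠ i := Finset.ne_of_mem_erase hj
      simp [this]
  rw [heq] at h1
  have h4 := h1.unique h3
  simp only [pderiv]
  rw [h4, tensor, ← Finset.mul_prod_erase _ _ (Finset.mem_univ i)]
  congr 1
  · simp
  · refine Finset.prod_congr rfl fun j hj => ?_
    have : j ≠ i := Finset.ne_of_mem_erase hj
    simp [this]

lemma contDiff_update {d : ℕ} (i : Fin d) {G : Fin d → ℝ → ℂ}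
    (hG : ∀ i, ContDiff ℝ ∞ (G i)) (j : Fin d) :
    ContDiff ℝ ∞ (Function.update G i (deriv (G i)) j) := by
  by_cases h : j = i
  · subst h
    simpa using (contDiff_infty_iff_deriv.mp (hG j)).2
  · simpa [h] using hG j

lemma pderiv_iter_tensor {d : ℕ} (i : Fin d) (n : ℕ) {G : Fin d → ℝ → ℂ}
    (hG : ∀ i, ContDiff ℝ ∞ (G i)) :
    (pderiv i)^[n] (tensor G) = tensor (Function.update G i (deriv^[n] (G i))) := by
  induction n generalizing G with
  | zero => simp
  | succ n ih =>
    rw [Function.iterate_succ_apply, pderiv_tensor i hG, ih (contDiff_update i hG)]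
    simp

lemma contDiff_deriv_iter {g : ℝ → ℂ} (hg : ContDiff ℝ ∞ g) (n : ℕ) :
    ContDiff ℝ ∞ (deriv^[n] g) := by
  induction n with
  | zero => simpa using hg
  | succ n ih =>
    rw [Function.iterate_succ_apply']
    exact (contDiff_infty_iff_deriv.mp ih).2

lemma mderiv_tensor {d : ℕ} (α : Fin d → ℕ) {G : Fin d → ℝ → ℂ}
    (hG : ∀ i, ContDiff ℝ ∞ (G i)) :
    mderiv α (tensor G) = tensor (fun i => deriv^[α i] (G i)) := by
  have key : ∀ l : List (Fin d), l.Nodup →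
      l.foldr (fun i g => (pderiv i)^[α i] g) (tensor G)
        = tensor (fun i => if i ∈ l then deriv^[α i] (G i) else G i) := by
    intro l hl
    induction l with
    | nil => simp
    | cons i l ih =>
      rw [List.nodup_cons] at hl
      rw [List.foldr_cons, ih hl.2, pderiv_iter_tensor i]
      · congr 1
        funext j
        by_cases h : j = i
        · subst h; simp [hl.1]
        · simp [h]
      · intro j
        split_ifs
        · exact contDiff_deriv_iter (hG j) _
        · exact hG j
  rw [mderiv, key _ (List.nodup_finRange d)]
  simp

lemma tensor_gauss_mem {d : ℕ} (x ξ : E d) :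
    tensor (fun i => gaussDeriv (x i) (ξ i) 0) ∈ GelfandShilov (1 / 2) d := by
  choose h hh B hB hb using fun i : Fin d => gauss_bound (x i) (ξ i)
  have hle : ∀ i, h i ≤ 1 + ∑ j, h j := fun i => by
    have := Finset.single_le_sum (fun j _ => (hh j).le) (Finset.mem_univ i)
    linarith
  have hpos : (0 : ℝ) < 1 + ∑ j, h j := by
    have := Finset.sum_nonneg (fun j (_ : j ∈ Finset.univ) => (hh j).le)
    linarith
  refine ⟨contDiff_tensor fun i => contDiff_gauss _ _, 1 + ∑ j, h j, hpos, ∏ i, B i,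
    Finset.prod_nonneg fun i _ => hB i, fun α β y => ?_⟩
  rw [mderiv_tensor α fun i => contDiff_gauss _ _]
  simp only [tensor, deriv_iter_gauss]
  rw [norm_mul, Complex.norm_real, norm_prod, norm_prod, ← Finset.prod_mul_distrib]
  calc ∏ i, ‖y i ^ β i‖ * ‖gaussDeriv (x i) (ξ i) (α i) (y i)‖
      ≤ ∏ i, (B i * (1 + ∑ j, h j) ^ (α i + β i) *
          Real.sqrt (((α i).factorial * (β i).factorial : ℕ))) := by
        refine Finset.prod_le_prod (fun i _ => by positivity) fun i _ => ?_
        rw [norm_pow, Real.norm_eq_abs]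
        refine (hb i (α i) (β i) (y i)).trans ?_
        have := hh i
        have := hB i
        have := hle i
        gcongr
    _ = _ := by
        rw [Finset.prod_mul_distrib, Finset.prod_mul_distrib, Finset.prod_pow_eq_pow_sum,
          Nat.cast_prod, ← Real.finsetProd_rpow _ _ (fun i _ => by positivity)]
        simp only [Real.sqrt_eq_rpow]

lemma atom_gaussian_mem {d : ℕ} (x ξ : E d) :
    atom (gaussian d) x ξ ∈ GelfandShilov (1 / 2) d := by
  have h : atom (gaussian d) x ξ =
      ((((2 * Real.pi) ^ (-(d : ℝ) / 2) : ℝ) : ℂ) * ((Real.pi ^ (-(d : ℝ) / 4) : ℝ) : ℂ)) •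
        tensor (fun i => gaussDeriv (x i) (ξ i) 0) := by
    funext y
    simp only [atom, gaussian, tensor, gaussDeriv, Pi.smul_apply, smul_eq_mul,
      Complex.conj_ofReal]
    rw [← Complex.exp_sum, EuclideanSpace.norm_sq_eq, PiLp.inner_apply, Complex.ofReal_mul,
      Complex.ofReal_exp, mul_assoc, mul_assoc, mul_assoc, ← Complex.exp_add]
    congr 3
    simp only [PiLp.sub_apply, Real.norm_eq_abs, sq_abs, RCLike.inner_apply, conj_trivial]
    push_cast
    rw [Finset.sum_sub_distrib, ← Finset.sum_div, Finset.sum_neg_distrib, sub_eq_add_neg]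
    congr 1
    rw [Finset.mul_sum, ← Finset.sum_neg_distrib]
    exact Finset.sum_congr rfl fun i _ => by ring
  rw [h]
  exact Submodule.smul_mem _ _ (tensor_gauss_mem x ξ)

/-- The short-time Fourier transform `V_φ f` of `f ∈ S_{1/2}'(ℝᵈ)` for the Gaussian
window `φ`. -/
def stft {d : ℕ} (f : GSDistribution (1 / 2) d) (z : E d × E d) : ℂ :=
  (f : GelfandShilov (1 / 2) d →ₗ[ℂ] ℂ) ⟨atom (gaussian d) z.1 z.2, atom_gaussian_mem z.1 z.2⟩

/-- The short-time Fourier transform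
`V_φ g(x,ξ) = (2π)^{-d/2} ∫ g(y) conj(φ(y - x)) e^{-i⟨y,ξ⟩} dy` of `g` with window `φ`,
for `g, φ ∈ L²(ℝᵈ)`. -/
def stftFun {d : ℕ} (φ g : E d → ℂ) (z : E d × E d) : ℂ :=
  ∫ y, g y * atom φ z.1 z.2 y

/-- The distribution `f` is (given by) the function `g ∈ L²(ℝᵈ)`. -/
def IsL2Function {d : ℕ} (f : GSDistribution (1 / 2) d) (g : E d → ℂ) : Prop :=
  MemLp g 2 volume ∧
    ∀ ψ : GelfandShilov (1 / 2) d,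
      (f : GelfandShilov (1 / 2) d →ₗ[ℂ] ℂ) ψ = ∫ y, g y * (ψ : E d → ℂ) y

/-! ### Young functions, Orlicz norms and (Orlicz) modulation spaces -/

/-- Young functions `Φ : [0,∞] → [0,∞]`. -/
structure IsYoung (Φ : ℝ≥0∞ → ℝ≥0∞) : Prop where
  convex : ∀ s₁ s₂ : ℝ≥0, s₁ + s₂ = 1 → ∀ t₁ t₂ : ℝ≥0∞,
    Φ (s₁ * t₁ + s₂ * t₂) ≤ s₁ * Φ t₁ + s₂ * Φ t₂
  map_zero : Φ 0 = 0
  tendsto_top : Tendsto (fun t : ℝ≥0 => Φ t) atTop (𝓝 ⊤)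
  map_top : Φ ⊤ = ⊤

/-- The Orlicz (Luxemburg) norm `inf {λ > 0 : ∫ Φ(|F| / λ) ≤ 1}`, with value `∞` if there is
no such `λ`. -/
def orliczNorm {X : Type*} [MeasureSpace X] (Φ : ℝ≥0∞ → ℝ≥0∞) (F : X → ℂ) : ℝ≥0∞ :=
  sInf {r : ℝ≥0∞ | 0 < r ∧ r < ⊤ ∧ ∫⁻ z, Φ (‖F z‖ₑ / r) ≤ 1}

/-- `‖f‖_{M^p} = ‖V_φ f‖_{L^p(ℝ²ᵈ)}`. -/
def modNorm {d : ℕ} (p : ℝ≥0∞) (f : GSDistribution (1 / 2) d) : ℝ≥0∞ :=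
  eLpNorm (stft f) p volume

/-- `‖f‖_{M^Φ} = ‖V_φ f‖_{L^Φ(ℝ²ᵈ)}`. -/
def orliczModNorm {d : ℕ} (Φ : ℝ≥0∞ → ℝ≥0∞) (f : GSDistribution (1 / 2) d) : ℝ≥0∞ :=
  orliczNorm Φ (stft f)

/-- The modulation space `M^p(ℝᵈ)`. -/
def modSpace (p : ℝ≥0∞) (d : ℕ) : Set (GSDistribution (1 / 2) d) :=
  {f | modNorm p f < ⊤}

/-- The Orlicz modulation space `M^Φ(ℝᵈ)`. -/
def orliczModSpace (Φ : ℝ≥0∞ → ℝ≥0∞) (d : ℕ) : Set (GSDistribution (1 / 2) d) :=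
  {f | orliczModNorm Φ f < ⊤}

end OrliczMod

end

noncomputable section

namespace OrliczMod

/-! ### Growth of the seminorms of Gaussian atoms -/

/-! Everything rests on the reproducing formula: `F = stft f` satisfies `F(w) = ∫ k(w,z) F(z) dz`
with `|k(w,z)| = c exp(-|w - z|²/4)` (`stft_eq_integral`, `norm_stftFun_atom`). It turns statements
about `f` into estimates for a continuous function on phase space that is dominated by its own
convolution with a Gaussian.

For a general `f` in `S_{1/2}'` the formula needs justification. The seminorms of the Gaussian atom
at `z` grow at most like `exp(δ|z|²)` with `δ` arbitrarily small (`exists_gaussTensor_le`), hence so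
does `F`. The transform of a test function `ψ` decays like `exp(-ε|z|²)` for some `ε > 0`
(`exists_norm_stftFun_le`). Fourier inversion writes `ψ` as a superposition of atoms with the values
of its transform as coefficients. By the two estimates this superposition converges as a Bochner
integral in a Banach space of seminorm values, so `f` may be taken under the integral
(`apply_eq_integral_stft`). Testing with an atom gives the reproducing formula.

The first consequence is `M^p ⊆ M^∞` for all `p > 0` (`exists_enorm_stft_le`), so after scaling by a
multiple of the `M^p` norm only small arguments of `Φ` occur. There `-t² log t ≤ t^p / (2 - p)`,
which gives `M^p ⊆ M^Φ`. Conversely `t² ≤ -t² log t` for `t ≤ 1/e`. For large `t` convexity yields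
only that `Φ` grows at least linearly. That suffices to bound `F` through the reproducing formula,
and for bounded `F` a linear lower bound on `Φ` controls the square.

For density, `F` in `L²` is approximated by a compactly supported continuous `h`. Superposing atoms
with coefficients `h` gives an element of `M¹ ⊆ M^Φ`, whose distance from `f` in `M²` is controlled
by `‖F - h‖₂` and Young's inequality.

The limit `p → 2-` is dominated convergence with majorant `|F|^p₀ + |F|²`. For other windows, the
transform is an isometry on test functions, so `f` in `M²` is `L²`-bounded there and is an `L²`
function by Riesz. A window in `M¹` is itself a superposition of atoms, so `V_φ f` is dominated by a
convolution of an `L¹` function with `|F|`, and the same limit lemma applies. -/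

/-- After squaring, this is a single Taylor term, `(2κs²)^b / b! ≤ exp(2κs²)`. The condition on `K`
is what makes `s² ≤ K² · 2κs²`. -/
lemma pow_le_sqrt_factorial_mul_exp {κ K s : ℝ} (hκ : 0 < κ) (hK0 : 0 ≤ K)
    (hK : 1 ≤ 2 * κ * K ^ 2) (b : ℕ) :
    s ^ b ≤ K ^ b * Real.sqrt b.factorial * Real.exp (κ * s ^ 2) := by
  apply le_of_sq_le_sq _ (by positivity)
  rw [mul_pow, mul_pow, Real.sq_sqrt (by positivity), ← Real.exp_nat_mul]
  have h4 := Real.pow_div_factorial_le_exp (2 * κ * s ^ 2) (by positivity) b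
  rw [div_le_iff₀ (by positivity)] at h4
  calc (s ^ b) ^ 2 = (1 * s ^ 2) ^ b := by rw [one_mul, ← pow_mul, ← pow_mul, mul_comm]
    _ ≤ ((2 * κ * K ^ 2) * s ^ 2) ^ b := by gcongr
    _ = (K ^ b) ^ 2 * (2 * κ * s ^ 2) ^ b := by rw [← pow_mul, mul_comm b 2, pow_mul, ← mul_pow]; ring
    _ ≤ (K ^ b) ^ 2 * (Real.exp (2 * κ * s ^ 2) * b.factorial) := by gcongr
    _ = _ := by push_cast; ring_nf

lemma norm_gaussDeriv_zero (x ξ t : ℝ) :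
    ‖gaussDeriv x ξ 0 t‖ = Real.exp (-(t - x) ^ 2 / 2) := by
  simp only [gaussDeriv, Complex.norm_exp]
  congr 1
  have : (-((t : ℂ) - x) ^ 2 / 2 - Complex.I * t * ξ)
      = ((-(t - x) ^ 2 / 2 : ℝ) : ℂ) + ((-(t * ξ) : ℝ) : ℂ) * Complex.I := by
    push_cast; ring
  rw [this, Complex.add_re, Complex.ofReal_re, Complex.re_ofReal_mul, Complex.I_re]
  ring

lemma sqrt_factorial_mul_le (m n : ℕ) :
    Real.sqrt m.factorial * Real.sqrt n.factorial ≤ Real.sqrt (m + n).factorial := by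
  rw [← Real.sqrt_mul (by positivity)]
  apply Real.sqrt_le_sqrt
  exact_mod_cast Nat.le_of_dvd (Nat.factorial_pos _) (Nat.factorial_mul_factorial_dvd_factorial_add m n)

/-- The three powers are paid for by `exp(δt²/2)`, `exp(δξ²)` and `exp((t-x)²/4)`. Since `t² ≤
2(t-x)² + 2x²` and `δ ≤ 1/4`, the Gaussian `exp(-(t-x)²/2)` absorbs all but `exp(δ(x²+ξ²))`. -/
lemma weighted_gaussDeriv_zero_le {δ K : ℝ} (hδ : 0 < δ) (hδ4 : δ ≤ 1 / 4) (hK0 : 0 ≤ K)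
    (hK : 1 ≤ δ * K ^ 2) (x ξ t : ℝ) (b m n : ℕ) :
    |t| ^ b * |ξ| ^ m * |t - x| ^ n * ‖gaussDeriv x ξ 0 t‖ ≤
      Real.exp (δ * (x ^ 2 + ξ ^ 2)) * Real.sqrt b.factorial * K ^ (b + m + n) *
        Real.sqrt (m + n).factorial := by
  have h1 := pow_le_sqrt_factorial_mul_exp (κ := δ / 2) (s := |t|) (by positivity) hK0
    (by linarith) b
  have h2 := pow_le_sqrt_factorial_mul_exp (s := |ξ|) hδ hK0 (by linarith) m
  have h3 := pow_le_sqrt_factorial_mul_exp (κ := 1 / 4) (s := |t - x|) (by positivity)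
    hK0 (by nlinarith [sq_nonneg K]) n
  rw [sq_abs] at h1 h2 h3
  rw [norm_gaussDeriv_zero]
  have he : Real.exp (δ / 2 * t ^ 2) * Real.exp (δ * ξ ^ 2) * Real.exp (1 / 4 * (t - x) ^ 2) *
      Real.exp (-(t - x) ^ 2 / 2) ≤ Real.exp (δ * (x ^ 2 + ξ ^ 2)) := by
    rw [← Real.exp_add, ← Real.exp_add, ← Real.exp_add]
    apply Real.exp_le_exp.mpr
    have : 0 ≤ (1 / 4 - δ) * (t - x) ^ 2 := mul_nonneg (by linarith) (sq_nonneg _)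
    have : 0 ≤ δ * (t - 2 * x) ^ 2 := by positivity
    nlinarith
  calc |t| ^ b * |ξ| ^ m * |t - x| ^ n * Real.exp (-(t - x) ^ 2 / 2)
      ≤ (K ^ b * Real.sqrt b.factorial * Real.exp (δ / 2 * t ^ 2)) *
        (K ^ m * Real.sqrt m.factorial * Real.exp (δ * ξ ^ 2)) *
        (K ^ n * Real.sqrt n.factorial * Real.exp (1 / 4 * (t - x) ^ 2)) *
          Real.exp (-(t - x) ^ 2 / 2) := by gcongr
    _ = (Real.exp (δ / 2 * t ^ 2) * Real.exp (δ * ξ ^ 2) * Real.exp (1 / 4 * (t - x) ^ 2) *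
      Real.exp (-(t - x) ^ 2 / 2)) * Real.sqrt b.factorial * K ^ (b + m + n) *
        (Real.sqrt m.factorial * Real.sqrt n.factorial) := by rw [pow_add, pow_add]; ring
    _ ≤ _ := by
      have := sqrt_factorial_mul_le m n
      gcongr

/-- The factor `x - iξ - t` in the recurrence is not bounded uniformly in `(x, ξ)`, but it is at
most `|ξ| + |t - x|`. Carrying the powers `m` and `n` through the induction lets each derivative
raise one of them by one, at the price of a constant independent of `(x, ξ)`. -/
lemma weighted_gaussDeriv_le {δ K : ℝ} (hδ : 0 < δ) (hδ4 : δ ≤ 1 / 4) (hK0 : 0 ≤ K)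
    (hK : 1 ≤ δ * K ^ 2) (x ξ t : ℝ) (b a : ℕ) : ∀ m n : ℕ,
    |t| ^ b * |ξ| ^ m * |t - x| ^ n * ‖gaussDeriv x ξ a t‖ ≤
      Real.exp (δ * (x ^ 2 + ξ ^ 2)) * Real.sqrt b.factorial * (2 * K + 1) ^ a *
        K ^ (b + m + n) * Real.sqrt (a + m + n).factorial := by
  set M := Real.exp (δ * (x ^ 2 + ξ ^ 2)) * Real.sqrt b.factorial with hM
  have hM0 : 0 ≤ M := by positivity
  have hc : ‖(x : ℂ) - Complex.I * ξ - t‖ ≤ |ξ| + |t - x| := by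
    have h1 : (x : ℂ) - Complex.I * ξ - t = -((t - x : ℝ) : ℂ) - Complex.I * ξ := by
      push_cast; ring
    rw [h1]
    refine (norm_sub_le _ _).trans ?_
    simp only [norm_neg, Complex.norm_real, norm_mul, Complex.norm_I, one_mul, Real.norm_eq_abs]
    linarith
  induction a using Nat.strong_induction_on with
  | _ a ih =>
    intro m n
    match a, ih with
    | 0, _ => simpa using weighted_gaussDeriv_zero_le hδ hδ4 hK0 hK x ξ t b m n
    | 1, ih =>
      have e1 := ih 0 (by omega) (m + 1) n
      have e2 := ih 0 (by omega) m (n + 1)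
      rw [show 0 + (m + 1) + n = 1 + m + n by ring, show b + (m + 1) + n = b + m + n + 1 by ring]
        at e1
      rw [show 0 + m + (n + 1) = 1 + m + n by ring, show b + m + (n + 1) = b + m + n + 1 by ring]
        at e2
      have hk : gaussDeriv x ξ 1 t = ((x : ℂ) - Complex.I * ξ - t) * gaussDeriv x ξ 0 t := by
        simp [gaussDeriv]
      rw [hk, norm_mul]
      set S := Real.sqrt (1 + m + n).factorial
      calc |t| ^ b * |ξ| ^ m * |t - x| ^ n *
            (‖(x : ℂ) - Complex.I * ξ - t‖ * ‖gaussDeriv x ξ 0 t‖)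
          ≤ |t| ^ b * |ξ| ^ m * |t - x| ^ n * ((|ξ| + |t - x|) * ‖gaussDeriv x ξ 0 t‖) := by
            gcongr
        _ = |t| ^ b * |ξ| ^ (m + 1) * |t - x| ^ n * ‖gaussDeriv x ξ 0 t‖ +
            |t| ^ b * |ξ| ^ m * |t - x| ^ (n + 1) * ‖gaussDeriv x ξ 0 t‖ := by ring
        _ ≤ M * (2 * K + 1) ^ 0 * K ^ (b + m + n + 1) * S +
            M * (2 * K + 1) ^ 0 * K ^ (b + m + n + 1) * S := add_le_add e1 e2
        _ = M * (2 * K) * K ^ (b + m + n) * S := by ring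
        _ ≤ M * (2 * K + 1) ^ 1 * K ^ (b + m + n) * S := by
            gcongr; linarith
    | (a + 2), ih =>
      have e1 := ih (a + 1) (by omega) (m + 1) n
      have e2 := ih (a + 1) (by omega) m (n + 1)
      have e3 := ih a (by omega) m n
      rw [show a + 1 + (m + 1) + n = a + 2 + m + n by ring,
        show b + (m + 1) + n = b + m + n + 1 by ring] at e1
      rw [show a + 1 + m + (n + 1) = a + 2 + m + n by ring,
        show b + m + (n + 1) = b + m + n + 1 by ring] at e2
      have hk : gaussDeriv x ξ (a + 2) t = ((x : ℂ) - Complex.I * ξ - t) * gaussDeriv x ξ (a + 1) t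
          - (a + 1) * gaussDeriv x ξ a t := by simp [gaussDeriv]
      have hn : ‖gaussDeriv x ξ (a + 2) t‖ ≤ (|ξ| + |t - x|) * ‖gaussDeriv x ξ (a + 1) t‖
          + ((a : ℝ) + 1) * ‖gaussDeriv x ξ a t‖ := by
        rw [hk]
        refine (norm_sub_le _ _).trans ?_
        rw [norm_mul, norm_mul]
        have : ‖(a : ℂ) + 1‖ = (a : ℝ) + 1 := by
          have := Complex.norm_natCast (a + 1); push_cast at this; exact this
        rw [this]
        gcongr
      -- The two extra factors of the larger factorial absorb `(a + 1)²`.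
      have hs : ((a : ℝ) + 1) * Real.sqrt (a + m + n).factorial ≤
          Real.sqrt (a + 2 + m + n).factorial := by
        apply Real.le_sqrt_of_sq_le
        rw [mul_pow, Real.sq_sqrt (by positivity), show a + 2 + m + n = a + m + n + 1 + 1 by ring,
          Nat.factorial_succ, Nat.factorial_succ, ← mul_assoc]
        push_cast
        gcongr
        have : (0 : ℝ) ≤ m := by positivity
        have : (0 : ℝ) ≤ n := by positivity
        have : (0 : ℝ) ≤ a := by positivity
        nlinarith
      set S := Real.sqrt (a + 2 + m + n).factorial
      set H := 2 * K + 1 with hH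
      have hH1 : 0 ≤ H := by linarith
      calc |t| ^ b * |ξ| ^ m * |t - x| ^ n * ‖gaussDeriv x ξ (a + 2) t‖
          ≤ |t| ^ b * |ξ| ^ m * |t - x| ^ n * ((|ξ| + |t - x|) * ‖gaussDeriv x ξ (a + 1) t‖
          + ((a : ℝ) + 1) * ‖gaussDeriv x ξ a t‖) := by gcongr
        _ = |t| ^ b * |ξ| ^ (m + 1) * |t - x| ^ n * ‖gaussDeriv x ξ (a + 1) t‖ +
            |t| ^ b * |ξ| ^ m * |t - x| ^ (n + 1) * ‖gaussDeriv x ξ (a + 1) t‖ +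
            ((a : ℝ) + 1) * (|t| ^ b * |ξ| ^ m * |t - x| ^ n * ‖gaussDeriv x ξ a t‖) := by ring
        _ ≤ M * H ^ (a + 1) * K ^ (b + m + n + 1) * S +
            M * H ^ (a + 1) * K ^ (b + m + n + 1) * S +
            ((a : ℝ) + 1) * (M * H ^ a * K ^ (b + m + n) * Real.sqrt (a + m + n).factorial) := by
            gcongr
        _ = M * H ^ (a + 1) * (2 * K) * K ^ (b + m + n) * S +
            M * H ^ a * K ^ (b + m + n) * (((a : ℝ) + 1) * Real.sqrt (a + m + n).factorial) := by
            ring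
        _ ≤ M * H ^ (a + 1) * (2 * K) * K ^ (b + m + n) * S +
            M * H ^ (a + 1) * K ^ (b + m + n) * S := by
            gcongr
            · linarith
            · omega
        _ = M * H ^ (a + 2) * K ^ (b + m + n) * S := by rw [hH]; ring

/-- The seminorms of the Gaussian atoms grow like `exp (δ (x² + ξ²))`, with `δ` as small as
desired. -/
lemma exists_gaussDeriv_le {δ : ℝ} (hδ : 0 < δ) (hδ4 : δ ≤ 1 / 4) :
    ∃ H > 0, ∀ (x ξ t : ℝ) (a b : ℕ), |t| ^ b * ‖gaussDeriv x ξ a t‖ ≤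
      Real.exp (δ * (x ^ 2 + ξ ^ 2)) * H ^ (a + b) *
        Real.sqrt ((a.factorial * b.factorial : ℕ)) := by
  set K := Real.sqrt δ⁻¹ with hKdef
  have hK0 : 0 ≤ K := Real.sqrt_nonneg _
  have hK : 1 ≤ δ * K ^ 2 := by
    rw [hKdef, Real.sq_sqrt (by positivity), mul_inv_cancel₀ hδ.ne']
  refine ⟨2 * K + 1, by positivity, fun x ξ t a b => ?_⟩
  have h := weighted_gaussDeriv_le hδ hδ4 hK0 hK x ξ t b a 0 0
  simp only [pow_zero, mul_one, add_zero] at h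
  refine h.trans ?_
  have h2 : K ^ b ≤ (2 * K + 1) ^ b := pow_le_pow_left₀ hK0 (by linarith) b
  calc _ ≤ Real.exp (δ * (x ^ 2 + ξ ^ 2)) * Real.sqrt b.factorial * (2 * K + 1) ^ a *
        (2 * K + 1) ^ b * Real.sqrt a.factorial := by gcongr
    _ = _ := by
      rw [Nat.cast_mul, Real.sqrt_mul (by positivity), pow_add]; ring

/-! ### Gaussian atoms on phase space and their derivatives -/

/-- The square of the Euclidean norm on phase space. -/
def sqNorm {d : ℕ} (z : E d × E d) : ℝ := ‖z.1‖ ^ 2 + ‖z.2‖ ^ 2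

/-- The derivative `∂^α` of the unnormalised atom at `z`. -/
def gaussTensor {d : ℕ} (z : E d × E d) (α : Fin d → ℕ) : E d → ℂ :=
  tensor fun i => gaussDeriv (z.1 i) (z.2 i) (α i)

/-- The constant in front of the Gaussian atoms. -/
def atomConst (d : ℕ) : ℝ := (2 * Real.pi) ^ (-(d : ℝ) / 2) * Real.pi ^ (-(d : ℝ) / 4)

lemma atomConst_pos (d : ℕ) : 0 < atomConst d := by unfold atomConst; positivity

lemma contDiff_gaussDeriv (x ξ : ℝ) (a : ℕ) : ContDiff ℝ ∞ (gaussDeriv x ξ a) := by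
  rw [← deriv_iter_gauss]
  exact contDiff_deriv_iter (contDiff_gauss x ξ) a

lemma contDiff_gaussTensor {d : ℕ} (z : E d × E d) (α : Fin d → ℕ) :
    ContDiff ℝ ∞ (gaussTensor z α) :=
  contDiff_tensor fun _ => contDiff_gaussDeriv _ _ _

lemma mderiv_gaussTensor_zero {d : ℕ} (z : E d × E d) (α : Fin d → ℕ) :
    mderiv α (gaussTensor z 0) = gaussTensor z α := by
  unfold gaussTensor
  rw [mderiv_tensor α fun i => contDiff_gaussDeriv _ _ _]
  simp [deriv_iter_gauss]

lemma pderiv_gaussTensor {d : ℕ} (i : Fin d) (z : E d × E d) (α : Fin d → ℕ) :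
    pderiv i (gaussTensor z α) = gaussTensor z (Function.update α i (α i + 1)) := by
  unfold gaussTensor
  rw [pderiv_tensor i fun i => contDiff_gaussDeriv _ _ _]
  congr 1
  funext j
  by_cases h : j = i
  · subst h
    simp only [Function.update_self]
    funext t
    exact (hasDerivAt_gaussDeriv _ _ _ t).deriv
  · simp [h]

lemma atom_gaussian_eq {d : ℕ} (x ξ : E d) :
    atom (gaussian d) x ξ = ((atomConst d : ℝ) : ℂ) • gaussTensor (x, ξ) 0 := by
  funext y
  simp only [atom, gaussian, gaussTensor, tensor, gaussDeriv, Pi.smul_apply, smul_eq_mul,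
    Complex.conj_ofReal, atomConst]
  rw [← Complex.exp_sum, EuclideanSpace.norm_sq_eq, PiLp.inner_apply, Complex.ofReal_mul,
    Complex.ofReal_exp, Complex.ofReal_mul, mul_assoc, mul_assoc, mul_assoc, ← Complex.exp_add]
  congr 3
  simp only [PiLp.sub_apply, Real.norm_eq_abs, sq_abs, RCLike.inner_apply, conj_trivial]
  push_cast
  rw [Finset.sum_sub_distrib, ← Finset.sum_div, Finset.sum_neg_distrib, sub_eq_add_neg]
  congr 1
  rw [Finset.mul_sum, ← Finset.sum_neg_distrib]
  exact Finset.sum_congr rfl fun i _ => by ring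

lemma mderiv_atom_gaussian {d : ℕ} (x ξ : E d) (α : Fin d → ℕ) :
    mderiv α (atom (gaussian d) x ξ) = ((atomConst d : ℝ) : ℂ) • gaussTensor (x, ξ) α := by
  rw [atom_gaussian_eq, mderiv_smul α _ (contDiff_gaussTensor _ _), mderiv_gaussTensor_zero]

/-- The factor `h^{|α + β|} (α! β!)^{1/2}`. -/
def gsWeight {d : ℕ} (h : ℝ) (α β : Fin d → ℕ) : ℝ :=
  h ^ (∑ i, (α i + β i)) * ((∏ i, ((α i).factorial * (β i).factorial) : ℕ) : ℝ) ^ (1 / 2 : ℝ)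

lemma gsWeight_pos {d : ℕ} {h : ℝ} (hh : 0 < h) (α β : Fin d → ℕ) : 0 < gsWeight h α β := by
  unfold gsWeight
  have : 0 < (∏ i, ((α i).factorial * (β i).factorial) : ℕ) :=
    Finset.prod_pos fun i _ => by positivity
  positivity

lemma gsWeight_eq {d : ℕ} (h : ℝ) (α β : Fin d → ℕ) :
    gsWeight h α β = ∏ i, (h ^ (α i + β i) *
      Real.sqrt ((α i).factorial * (β i).factorial : ℕ)) := by
  unfold gsWeight
  symm
  rw [Finset.prod_mul_distrib, Finset.prod_pow_eq_pow_sum,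
    Nat.cast_prod, ← Real.finsetProd_rpow _ _ (fun i _ => by positivity)]
  simp only [Real.sqrt_eq_rpow]

/-- The same `H` serves all `z`: every atom lies in one space `S_{1/2,H}`, so a single continuity
estimate for a distribution controls its transform on all of phase space. -/
lemma exists_gaussTensor_le (d : ℕ) {δ : ℝ} (hδ : 0 < δ) (hδ4 : δ ≤ 1 / 4) :
    ∃ H > 0, ∀ (z : E d × E d) (α β : Fin d → ℕ) (y : E d),
      ‖((∏ i, y i ^ β i : ℝ) : ℂ) * gaussTensor z α y‖ ≤
        Real.exp (δ * sqNorm z) * gsWeight H α β := by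
  obtain ⟨H, hH, hb⟩ := exists_gaussDeriv_le hδ hδ4
  refine ⟨H, hH, fun z α β y => ?_⟩
  have he : Real.exp (δ * sqNorm z) = ∏ i, Real.exp (δ * (z.1 i ^ 2 + z.2 i ^ 2)) := by
    rw [← Real.exp_sum, sqNorm, EuclideanSpace.norm_sq_eq, EuclideanSpace.norm_sq_eq,
      ← Finset.sum_add_distrib, Finset.mul_sum]
    simp
  rw [gsWeight_eq, he, ← Finset.prod_mul_distrib, gaussTensor, tensor, norm_mul,
    Complex.norm_real, norm_prod, norm_prod, ← Finset.prod_mul_distrib]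
  refine Finset.prod_le_prod (fun i _ => by positivity) fun i _ => ?_
  rw [norm_pow, Real.norm_eq_abs]
  refine (hb _ _ _ _ _).trans_eq ?_
  ring

lemma seminormLE_half_iff {d : ℕ} {h B : ℝ} {f : E d → ℂ} :
    SeminormLE (1 / 2) h B f ↔ ∀ (α β : Fin d → ℕ) (x : E d),
      ‖((∏ i, x i ^ β i : ℝ) : ℂ) * mderiv α f x‖ ≤ B * gsWeight h α β := by
  simp only [SeminormLE, gsWeight, mul_assoc]

/-! ### Gelfand-Shilov functions as bounded families -/

/-- The index set of the Gelfand-Shilov seminorms. -/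
abbrev GSIndex (d : ℕ) : Type := (Fin d → ℕ) × (Fin d → ℕ) × E d

/-- The Banach space of bounded families into which `S_{1/2,h}` embeds isometrically. -/
abbrev GSBounded (d : ℕ) : Type := lp (fun _ : GSIndex d => ℂ) ∞

/-- The normalised values `x^β D_α(x)` of a family `D` of functions. -/
def gsCoeff {d : ℕ} (h : ℝ) (D : (Fin d → ℕ) → E d → ℂ) (k : GSIndex d) : ℂ :=
  (((gsWeight h k.1 k.2.1)⁻¹ : ℝ) : ℂ) * (((∏ i, k.2.2 i ^ k.2.1 i : ℝ) : ℂ) * D k.1 k.2.2)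

lemma norm_gsCoeff_le_iff {d : ℕ} {h : ℝ} (hh : 0 < h) (D : (Fin d → ℕ) → E d → ℂ)
    (k : GSIndex d) (B : ℝ) : ‖gsCoeff h D k‖ ≤ B ↔
      ‖((∏ i, k.2.2 i ^ k.2.1 i : ℝ) : ℂ) * D k.1 k.2.2‖ ≤ B * gsWeight h k.1 k.2.1 := by
  have hw := gsWeight_pos hh k.1 k.2.1
  rw [gsCoeff, norm_mul, Complex.norm_real, Real.norm_of_nonneg (by positivity),
    inv_mul_le_iff₀ hw, mul_comm B]

lemma mderiv_zero {d : ℕ} (f : E d → ℂ) : mderiv 0 f = f := by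
  unfold mderiv
  induction List.finRange d with
  | nil => rfl
  | cons i l ih => simp

/-- A Gelfand-Shilov distribution extends to a bounded functional on the space of bounded
families. -/
lemma exists_extension_gsBounded {d : ℕ} (f : GSDistribution (1 / 2) d) {h : ℝ} (hh : 0 < h) :
    ∃ T : GSBounded d →L[ℂ] ℂ, ∀ (ψ : GelfandShilov (1 / 2) d) (v : GSBounded d),
      (∀ k, v k = gsCoeff h (fun α => mderiv α (ψ : E d → ℂ)) k) →
        T v = (f : GelfandShilov (1 / 2) d →ₗ[ℂ] ℂ) ψ := by
  -- The functional is defined on the families that come from some `ψ`, through a choice of `ψ`. The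
  -- choice is immaterial by `runi`, because the entries with `α = β = 0` are the values of `ψ`.
  set R : GSBounded d → GelfandShilov (1 / 2) d → Prop := fun v ψ =>
    ∀ k, v k = gsCoeff h (fun α => mderiv α (ψ : E d → ℂ)) k with hR
  have radd : ∀ v w ψ χ, R v ψ → R w χ → R (v + w) (ψ + χ) := by
    intro v w ψ χ hv hw k
    rw [lp.coeFn_add, Pi.add_apply, hv k, hw k]
    simp only [gsCoeff, Submodule.coe_add, mderiv_add _ ψ.2.1 χ.2.1, Pi.add_apply]
    ring
  have rsmul : ∀ (c : ℂ) v ψ, R v ψ → R (c • v) (c • ψ) := by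
    intro c v ψ hv k
    rw [lp.coeFn_smul, Pi.smul_apply, hv k]
    simp only [gsCoeff, Submodule.coe_smul, mderiv_smul _ c ψ.2.1, Pi.smul_apply, smul_eq_mul]
    ring
  have runi : ∀ v ψ χ, R v ψ → R v χ → ψ = χ := by
    intro v ψ χ h1 h2
    ext y
    have := (h1 (0, 0, y)).symm.trans (h2 (0, 0, y))
    simpa [gsCoeff, gsWeight, mderiv_zero] using this
  let p : Submodule ℂ (GSBounded d) :=
    { carrier := {v | ∃ ψ, R v ψ}
      zero_mem' := ⟨0, fun k => by
        have : mderiv k.1 (0 : E d → ℂ) = 0 := by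
          simpa using mderiv_smul k.1 (0 : ℂ) (f := (0 : E d → ℂ)) contDiff_const
        simp [gsCoeff, this]⟩
      add_mem' := by
        rintro v w ⟨ψ, hψ⟩ ⟨χ, hχ⟩
        exact ⟨_, radd _ _ _ _ hψ hχ⟩
      smul_mem' := by
        rintro c v ⟨ψ, hψ⟩
        exact ⟨_, rsmul _ _ _ hψ⟩ }
  let T₀ : p →ₗ[ℂ] ℂ :=
    { toFun := fun v => (f : GelfandShilov (1 / 2) d →ₗ[ℂ] ℂ) v.2.choose
      map_add' := by
        intro v w
        rw [← map_add]
        congr 1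
        exact runi _ _ _ (v + w).2.choose_spec (radd _ _ _ _ v.2.choose_spec w.2.choose_spec)
      map_smul' := by
        intro c v
        rw [RingHom.id_apply, ← map_smul]
        congr 1
        exact runi _ _ _ (c • v).2.choose_spec (rsmul _ _ _ v.2.choose_spec) }
  obtain ⟨C, hC, hf⟩ := f.2 h hh
  have hT₀ : ∀ v, ‖T₀ v‖ ≤ C * ‖v‖ := by
    intro v
    refine hf _ _ (norm_nonneg v) ?_
    rw [seminormLE_half_iff]
    intro α β x
    have := v.2.choose_spec (α, β, x)
    exact (norm_gsCoeff_le_iff hh _ (α, β, x) _).mp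
      (this ▸ lp.norm_apply_le_norm (by simp) (v : GSBounded d) (α, β, x))
  -- Hahn-Banach supplies a functional on a complete space, so Bochner integrals of families can be
  -- used without completeness of `S_{1/2,h}`.
  obtain ⟨T, hT, -⟩ := exists_extension_norm_eq p (T₀.mkContinuous C hT₀)
  refine ⟨T, fun ψ v hv => ?_⟩
  have hp : v ∈ p := ⟨ψ, hv⟩
  rw [show T v = T₀ ⟨v, hp⟩ from hT ⟨v, hp⟩]
  exact congrArg _ (runi _ _ _ (Exists.choose_spec hp) hv)

/-! ### Continuous dependence of the atoms on the base point -/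

/-- The derivatives of `t ↦ exp (-t²/2 + c t)`, through their recurrence. -/
def expQuadDeriv (c : ℂ) : ℕ → ℝ → ℂ
  | 0, t => Complex.exp (-(t : ℂ) ^ 2 / 2 + c * t)
  | 1, t => (c - t) * Complex.exp (-(t : ℂ) ^ 2 / 2 + c * t)
  | (a + 2), t => (c - t) * expQuadDeriv c (a + 1) t - (a + 1) * expQuadDeriv c a t

/-- Expanding the square isolates the only non-holomorphic dependence on the base point; the other
factor is entire in `x - iξ`. Continuity in `z` can thus be obtained from complex analysis. -/
lemma gaussDeriv_eq_expQuadDeriv (x ξ : ℝ) (a : ℕ) (t : ℝ) :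
    gaussDeriv x ξ a t = Complex.exp (-(x : ℂ) ^ 2 / 2) *
      expQuadDeriv (x - Complex.I * ξ) a t := by
  have h0 : Complex.exp (-((t : ℂ) - x) ^ 2 / 2 - Complex.I * t * ξ) =
      Complex.exp (-(x : ℂ) ^ 2 / 2) *
        Complex.exp (-(t : ℂ) ^ 2 / 2 + (x - Complex.I * ξ) * t) := by
    rw [← Complex.exp_add]; congr 1; ring
  induction a using Nat.strong_induction_on with
  | _ a ih =>
    match a, ih with
    | 0, _ => exact h0
    | 1, _ => simp only [gaussDeriv, expQuadDeriv]; rw [h0]; ring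
    | (a + 2), ih =>
      simp only [gaussDeriv, expQuadDeriv]
      rw [ih (a + 1) (by omega), ih a (by omega)]
      ring

lemma differentiable_expQuadDeriv (a : ℕ) (t : ℝ) :
    Differentiable ℂ fun c => expQuadDeriv c a t := by
  induction a using Nat.strong_induction_on with
  | _ a ih =>
    match a, ih with
    | 0, _ => simp only [expQuadDeriv]; fun_prop
    | 1, _ => simp only [expQuadDeriv]; fun_prop
    | (a + 2), ih =>
      have h1 := ih (a + 1) (by omega)
      have h2 := ih a (by omega)
      simp only [expQuadDeriv]
      fun_prop

/-- The tensor product of `expQuadDeriv`. -/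
def expQuadTensor {d : ℕ} (ζ : Fin d → ℂ) (α : Fin d → ℕ) : E d → ℂ :=
  tensor fun i => expQuadDeriv (ζ i) (α i)

lemma gaussTensor_eq_expQuadTensor {d : ℕ} (z : E d × E d) (α : Fin d → ℕ) (y : E d) :
    gaussTensor z α y = ((Real.exp (-‖z.1‖ ^ 2 / 2) : ℝ) : ℂ) *
      expQuadTensor (fun i => z.1 i - Complex.I * z.2 i) α y := by
  simp only [gaussTensor, expQuadTensor, tensor]
  simp_rw [gaussDeriv_eq_expQuadDeriv]
  rw [Finset.prod_mul_distrib, ← Complex.exp_sum, EuclideanSpace.norm_sq_eq]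
  congr 1
  push_cast
  rw [← Finset.sum_div, Finset.sum_neg_distrib]
  simp only [Real.norm_eq_abs, ← Complex.ofReal_pow, sq_abs]

/-- Every `ζ` equals `x - iξ` with `x = Re ζ`, `ξ = -Im ζ`. Removing the factor `exp(-|x|²/2)` costs
`exp(|x|²/2)`, and `1/2 + δ ≤ 1`. -/
lemma norm_gsCoeff_expQuadTensor_le {d : ℕ} {δ H : ℝ} (hδ4 : δ ≤ 1 / 4) (hH : 0 < H)
    (hb : ∀ (z : E d × E d) (α β : Fin d → ℕ) (y : E d),
      ‖((∏ i, y i ^ β i : ℝ) : ℂ) * gaussTensor z α y‖ ≤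
        Real.exp (δ * sqNorm z) * gsWeight H α β) (ζ : Fin d → ℂ) (k : GSIndex d) :
    ‖gsCoeff H (expQuadTensor ζ) k‖ ≤ Real.exp (∑ i, ‖ζ i‖ ^ 2) := by
  rw [norm_gsCoeff_le_iff hH]
  set z : E d × E d := (WithLp.toLp 2 fun i => (ζ i).re, WithLp.toLp 2 fun i => -(ζ i).im) with hz
  have h1 := gaussTensor_eq_expQuadTensor z k.1 k.2.2
  have hζ : (fun i => (z.1 i : ℂ) - Complex.I * z.2 i) = ζ := by
    funext i
    apply Complex.ext <;> simp [hz]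
  rw [hζ] at h1
  have hq : sqNorm z = ∑ i, ‖ζ i‖ ^ 2 := by
    rw [sqNorm, EuclideanSpace.norm_sq_eq, EuclideanSpace.norm_sq_eq, ← Finset.sum_add_distrib]
    refine Finset.sum_congr rfl fun i _ => ?_
    rw [← Complex.normSq_eq_norm_sq, Complex.normSq_apply]
    simp [hz, sq]
  have h2 : expQuadTensor ζ k.1 k.2.2 = ((Real.exp (‖z.1‖ ^ 2 / 2) : ℝ) : ℂ) *
      gaussTensor z k.1 k.2.2 := by
    rw [h1, ← mul_assoc, ← Complex.ofReal_mul, ← Real.exp_add]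
    simp [neg_div]
  rw [h2, mul_left_comm, norm_mul, Complex.norm_real, Real.norm_of_nonneg (by positivity)]
  calc _ ≤ Real.exp (‖z.1‖ ^ 2 / 2) * (Real.exp (δ * sqNorm z) * gsWeight H k.1 k.2.1) := by
        gcongr; exact hb _ _ _ _
    _ = Real.exp (‖z.1‖ ^ 2 / 2 + δ * sqNorm z) * gsWeight H k.1 k.2.1 := by
        rw [Real.exp_add]; ring
    _ ≤ _ := by
        have := gsWeight_pos hH k.1 k.2.1
        gcongr
        rw [← hq]
        unfold sqNorm
        nlinarith [sq_nonneg ‖z.1‖, sq_nonneg ‖z.2‖]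

/-- Schwarz lemma on the complex line through `ζ₀` and `ζ`: the parameter `1` lies in the disc of
radius `1 / ‖ζ - ζ₀‖`, on which the coefficient is bounded by `M`. The constant does not depend on
`k`, as continuity in the sup norm requires. -/
lemma norm_gsCoeff_expQuadTensor_sub_le {d : ℕ} {δ H : ℝ} (hδ4 : δ ≤ 1 / 4) (hH : 0 < H)
    (hb : ∀ (z : E d × E d) (α β : Fin d → ℕ) (y : E d),
      ‖((∏ i, y i ^ β i : ℝ) : ℂ) * gaussTensor z α y‖ ≤
        Real.exp (δ * sqNorm z) * gsWeight H α β) (ζ₀ ζ : Fin d → ℂ) (hζ : ‖ζ - ζ₀‖ < 1)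
    (k : GSIndex d) :
    ‖gsCoeff H (expQuadTensor ζ) k - gsCoeff H (expQuadTensor ζ₀) k‖ ≤
      (2 * Real.exp (d * (‖ζ₀‖ + 1) ^ 2) + 1) * ‖ζ - ζ₀‖ := by
  by_cases h0 : ζ - ζ₀ = 0
  · rw [sub_eq_zero.mp h0]; simp
  have hr : 0 < ‖ζ - ζ₀‖ := norm_pos_iff.mpr h0
  set M := Real.exp (d * (‖ζ₀‖ + 1) ^ 2) with hM
  set a : ℂ → ℂ := fun s => gsCoeff H (expQuadTensor (ζ₀ + s • (ζ - ζ₀))) k with ha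
  have hd : Differentiable ℂ a := by
    simp only [ha, gsCoeff, expQuadTensor, tensor]
    refine Differentiable.const_mul (Differentiable.const_mul ?_ _) _
    refine Differentiable.fun_finsetProd fun i _ => ?_
    refine (differentiable_expQuadDeriv (k.1 i) (k.2.2 i)).comp ?_
    simp only [Pi.add_apply, Pi.smul_apply, smul_eq_mul]
    fun_prop
  have hbd : ∀ s : ℂ, ‖s‖ < 1 / ‖ζ - ζ₀‖ → ‖a s‖ ≤ M := by
    intro s hs
    refine (norm_gsCoeff_expQuadTensor_le hδ4 hH hb _ k).trans ?_
    rw [hM]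
    gcongr
    rw [lt_div_iff₀ hr] at hs
    have hn : ‖ζ₀ + s • (ζ - ζ₀)‖ ≤ ‖ζ₀‖ + 1 :=
      (norm_add_le _ _).trans (by rw [norm_smul]; linarith)
    calc ∑ i, ‖(ζ₀ + s • (ζ - ζ₀)) i‖ ^ 2 ≤ ∑ _i : Fin d, (‖ζ₀‖ + 1) ^ 2 := by
          gcongr with i
          exact (norm_le_pi_norm _ i).trans hn
      _ = _ := by simp
  -- The bound `M` for both values gives distance at most `2M`; the `+ 1` puts the image in an open
  -- ball.
  have hmaps : Set.MapsTo a (Metric.ball 0 (1 / ‖ζ - ζ₀‖)) (Metric.ball (a 0) (2 * M + 1)) := by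
    intro s hs
    rw [mem_ball_zero_iff] at hs
    rw [mem_ball_iff_norm]
    have h1 := hbd s hs
    have h2 := hbd 0 (by rw [norm_zero]; positivity)
    linarith [norm_sub_le (a s) (a 0)]
  have h1 : (1 : ℂ) ∈ Metric.ball (0 : ℂ) (1 / ‖ζ - ζ₀‖) := by
    rw [mem_ball_zero_iff, norm_one, lt_div_iff₀ hr]; simpa using hζ
  have := Complex.dist_le_div_mul_dist_of_mapsTo_ball hd.differentiableOn
    (hmaps.mono_right Metric.ball_subset_closedBall) h1
  rw [dist_eq_norm, dist_zero_right, norm_one, mul_one, div_div_eq_mul_div, div_one] at this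
  simpa [ha] using this

lemma continuous_gaussTensor_left {d : ℕ} (α : Fin d → ℕ) (y : E d) :
    Continuous fun z : E d × E d => gaussTensor z α y := by
  simp_rw [gaussTensor_eq_expQuadTensor]
  have h1 : Continuous fun z : E d × E d => Real.exp (-‖z.1‖ ^ 2 / 2) := by fun_prop
  have h2 : Continuous fun z : E d × E d =>
      expQuadTensor (fun i => (z.1 i : ℂ) - Complex.I * z.2 i) α y := by
    unfold expQuadTensor tensor
    refine continuous_finsetProd _ fun i _ => ?_
    have h3 : Continuous fun z : E d × E d => (z.1 i : ℂ) - Complex.I * z.2 i := by fun_prop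
    exact (differentiable_expQuadDeriv (α i) (y i)).continuous.comp h3
  exact (Complex.continuous_ofReal.comp h1).mul h2

/-- The family of seminorm values of the atom at `z` depends continuously on `z`. -/
lemma exists_continuous_atom_gsBounded (d : ℕ) {δ : ℝ} (hδ : 0 < δ) (hδ4 : δ ≤ 1 / 4) :
    ∃ H > 0, ∃ v : E d × E d → GSBounded d, Continuous v ∧
      (∀ z, ‖v z‖ ≤ atomConst d * Real.exp (δ * sqNorm z)) ∧
      ∀ z k, v z k = gsCoeff H (fun α => ((atomConst d : ℝ) : ℂ) • gaussTensor z α) k := by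
  obtain ⟨H, hH, hb⟩ := exists_gaussTensor_le d hδ hδ4
  let w : (Fin d → ℂ) → GSBounded d := fun ζ => ⟨fun k => gsCoeff H (expQuadTensor ζ) k,
    memℓp_infty ⟨Real.exp (∑ i, ‖ζ i‖ ^ 2), by
      rintro _ ⟨k, rfl⟩
      exact norm_gsCoeff_expQuadTensor_le hδ4 hH hb ζ k⟩⟩
  have hw : Continuous w := by
    rw [continuous_iff_continuousAt]
    intro ζ₀
    rw [ContinuousAt, tendsto_iff_norm_sub_tendsto_zero]
    have hlim : Tendsto (fun ζ => (2 * Real.exp (d * (‖ζ₀‖ + 1) ^ 2) + 1) * ‖ζ - ζ₀‖) (𝓝 ζ₀)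
        (𝓝 0) := by
      have : Continuous fun ζ => (2 * Real.exp (d * (‖ζ₀‖ + 1) ^ 2) + 1) * ‖ζ - ζ₀‖ := by
        fun_prop
      simpa using this.tendsto ζ₀
    refine squeeze_zero' (Eventually.of_forall fun _ => norm_nonneg _) ?_ hlim
    filter_upwards [Metric.ball_mem_nhds ζ₀ one_pos] with ζ hζ
    refine lp.norm_le_of_forall_le (by positivity) fun k => ?_
    exact norm_gsCoeff_expQuadTensor_sub_le hδ4 hH hb ζ₀ ζ (mem_ball_iff_norm.mp hζ) k
  let c : E d × E d → ℂ := fun z => ((atomConst d * Real.exp (-‖z.1‖ ^ 2 / 2) : ℝ) : ℂ)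
  have hcoord : ∀ z k, (c z • w fun i => z.1 i - Complex.I * z.2 i) k =
      gsCoeff H (fun α => ((atomConst d : ℝ) : ℂ) • gaussTensor z α) k := by
    intro z k
    rw [lp.coeFn_smul, Pi.smul_apply, smul_eq_mul]
    simp only [w, gsCoeff, c, Pi.smul_apply, gaussTensor_eq_expQuadTensor, smul_eq_mul]
    push_cast
    ring
  refine ⟨H, hH, fun z => c z • w fun i => z.1 i - Complex.I * z.2 i, ?_, fun z => ?_, hcoord⟩
  · have h1 : Continuous fun z : E d × E d => atomConst d * Real.exp (-‖z.1‖ ^ 2 / 2) := by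
      fun_prop
    have h2 : Continuous fun (z : E d × E d) i => (z.1 i : ℂ) - Complex.I * z.2 i := by
      fun_prop
    exact (Complex.continuous_ofReal.comp h1).smul (hw.comp h2)
  · have := atomConst_pos d
    refine lp.norm_le_of_forall_le (by positivity) fun k => ?_
    rw [hcoord, norm_gsCoeff_le_iff hH, Pi.smul_apply, smul_eq_mul, mul_left_comm, norm_mul,
      Complex.norm_real, Real.norm_of_nonneg this.le, mul_assoc]
    exact mul_le_mul_of_nonneg_left (hb _ _ _ _) this.le

/-! ### Continuity and growth of the short-time Fourier transform -/

/-- The atom at `z` as an element of `S_{1/2}`. -/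
def gsAtom {d : ℕ} (z : E d × E d) : GelfandShilov (1 / 2) d :=
  ⟨atom (gaussian d) z.1 z.2, atom_gaussian_mem z.1 z.2⟩

lemma stft_eq {d : ℕ} (f : GSDistribution (1 / 2) d) (z : E d × E d) :
    stft f z = (f : GelfandShilov (1 / 2) d →ₗ[ℂ] ℂ) (gsAtom z) := rfl

lemma exists_stft_eq_comp {d : ℕ} (f : GSDistribution (1 / 2) d) {δ : ℝ} (hδ : 0 < δ)
    (hδ4 : δ ≤ 1 / 4) :
    ∃ H > 0, ∃ (v : E d × E d → GSBounded d) (T : GSBounded d →L[ℂ] ℂ), Continuous v ∧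
      (∀ z, ‖v z‖ ≤ atomConst d * Real.exp (δ * sqNorm z)) ∧
      (∀ z k, v z k = gsCoeff H (fun α => ((atomConst d : ℝ) : ℂ) • gaussTensor z α) k) ∧
      (∀ (ψ : GelfandShilov (1 / 2) d) (v : GSBounded d),
        (∀ k, v k = gsCoeff H (fun α => mderiv α (ψ : E d → ℂ)) k) →
        T v = (f : GelfandShilov (1 / 2) d →ₗ[ℂ] ℂ) ψ) ∧
      ∀ z, stft f z = T (v z) := by
  obtain ⟨H, hH, v, hv, hvn, hvk⟩ := exists_continuous_atom_gsBounded d hδ hδ4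
  obtain ⟨T, hT⟩ := exists_extension_gsBounded f hH
  refine ⟨H, hH, v, T, hv, hvn, hvk, hT, fun z => ?_⟩
  rw [stft_eq, hT (gsAtom z) (v z)]
  intro k
  rw [hvk]
  congr 1
  funext α
  exact (mderiv_atom_gaussian z.1 z.2 α).symm

lemma continuous_stft {d : ℕ} (f : GSDistribution (1 / 2) d) : Continuous (stft f) := by
  obtain ⟨H, hH, v, T, hv, -, -, -, hs⟩ := exists_stft_eq_comp f (δ := 1 / 4) (by norm_num) le_rfl
  rw [funext hs]
  exact T.continuous.comp hv

/-- That `δ` is arbitrary is essential: the rate of Gaussian decay available for a test function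
depends on that function and may be very small. -/
lemma exists_norm_stft_le {d : ℕ} (f : GSDistribution (1 / 2) d) {δ : ℝ} (hδ : 0 < δ) :
    ∃ C > 0, ∀ z, ‖stft f z‖ ≤ C * Real.exp (δ * sqNorm z) := by
  obtain ⟨H, hH, v, T, -, hvn, -, -, hs⟩ := exists_stft_eq_comp f (δ := min δ (1 / 4))
    (by positivity) (min_le_right _ _)
  have hc := atomConst_pos d
  refine ⟨(‖T‖ + 1) * atomConst d, by positivity, fun z => ?_⟩
  have hq : 0 ≤ sqNorm z := by unfold sqNorm; positivity
  calc ‖stft f z‖ ≤ ‖T‖ * ‖v z‖ := by rw [hs]; exact T.le_opNorm _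
    _ ≤ (‖T‖ + 1) * (atomConst d * Real.exp (min δ (1 / 4) * sqNorm z)) := by
        gcongr
        · linarith
        · exact hvn z
    _ ≤ (‖T‖ + 1) * (atomConst d * Real.exp (δ * sqNorm z)) := by
        gcongr; exact min_le_left _ _
    _ = _ := by ring

/-! ### Gaussian decay from factorial moment bounds -/

/-- Expand the exponential. By the moment of order `2n` and `√(2n)! ≤ 2^n n!`, the `n`-th term is at
most `C 2^{-n}`. -/
lemma mul_exp_le_of_pow_mul_le {s v C H : ℝ} (hC : 0 ≤ C) (hH : 0 < H)
    (hv : ∀ n : ℕ, s ^ n * v ≤ C * H ^ n * Real.sqrt n.factorial) :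
    v * Real.exp (s ^ 2 / (4 * H ^ 2)) ≤ 2 * C := by
  have h1 : HasSum (fun n : ℕ => v * ((s ^ 2 / (4 * H ^ 2)) ^ n / n.factorial))
      (v * Real.exp (s ^ 2 / (4 * H ^ 2))) := by
    rw [Real.exp_eq_exp_ℝ]
    exact (NormedSpace.expSeries_div_hasSum_exp (s ^ 2 / (4 * H ^ 2))).mul_left v
  have h2 : HasSum (fun n : ℕ => C * (1 / 2 : ℝ) ^ n) (C * 2) := hasSum_geometric_two.mul_left C
  rw [mul_comm 2 C]
  refine hasSum_le (fun n => ?_) h1 h2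
  have h3 := hv (2 * n)
  have h4 : Real.sqrt (2 * n).factorial ≤ 2 ^ n * n.factorial := by
    apply Real.sqrt_le_iff.mpr
    refine ⟨by positivity, ?_⟩
    have h5 : (2 * n).factorial ≤ 2 ^ (2 * n) * (n.factorial * n.factorial) := by
      rw [two_mul, ← Nat.add_choose_mul_factorial_mul_factorial n n, mul_assoc]
      exact Nat.mul_le_mul_right _ (Nat.choose_le_two_pow _ _)
    calc ((2 * n).factorial : ℝ) ≤ 2 ^ (2 * n) * (n.factorial * n.factorial) := by
          exact_mod_cast h5
      _ = _ := by ring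
  have h6 : s ^ (2 * n) * v ≤ C * H ^ (2 * n) * (2 ^ n * n.factorial) :=
    h3.trans (by gcongr)
  have hf : (0 : ℝ) < n.factorial := by positivity
  calc v * ((s ^ 2 / (4 * H ^ 2)) ^ n / n.factorial)
      = s ^ (2 * n) * v / (4 ^ n * H ^ (2 * n) * n.factorial) := by
        rw [div_pow, mul_pow, pow_mul, pow_mul]; field_simp
    _ ≤ C * H ^ (2 * n) * (2 ^ n * n.factorial) / (4 ^ n * H ^ (2 * n) * n.factorial) := by
        gcongr
    _ = C * (1 / 2) ^ n := by
        rw [one_div, inv_pow, show (4 : ℝ) = 2 * 2 by norm_num, mul_pow 2 2 n]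
        field_simp

/-- The largest `c i ^ 2` is at least the sum divided by `d`, so decay in that one coordinate
suffices. The constant has `d + 1` to stay meaningful for `d = 0`, where the sum is empty and `v ≤
C` is used. -/
lemma le_exp_of_pow_mul_le {d : ℕ} {c : Fin d → ℝ} {v C H : ℝ} (hv0 : 0 ≤ v) (hC : v ≤ C)
    (hH : 0 < H) (hv : ∀ i, ∀ n : ℕ, c i ^ n * v ≤ C * H ^ n * Real.sqrt n.factorial) :
    v ≤ 2 * C * Real.exp (-(1 / (4 * H ^ 2 * (d + 1))) * ∑ i, c i ^ 2) := by
  have hC0 : 0 ≤ C := hv0.trans hC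
  rcases isEmpty_or_nonempty (Fin d) with hd | hd
  · simp; linarith
  obtain ⟨i, -, hi⟩ := Finset.exists_max_image Finset.univ (fun i => c i ^ 2)
    Finset.univ_nonempty
  have h1 : ∑ j, c j ^ 2 ≤ (d + 1) * c i ^ 2 := by
    have := Finset.sum_le_card_nsmul Finset.univ (fun j => c j ^ 2) (c i ^ 2) hi
    simp only [Finset.card_univ, Fintype.card_fin, nsmul_eq_mul] at this
    nlinarith [sq_nonneg (c i)]
  have h2 := mul_exp_le_of_pow_mul_le hC0 hH (hv i)
  have h3 : (1 / (4 * H ^ 2 * (d + 1))) * ∑ j, c j ^ 2 ≤ c i ^ 2 / (4 * H ^ 2) := by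
    rw [div_mul_eq_mul_div, one_mul, div_le_div_iff₀ (by positivity) (by positivity)]
    calc (∑ j, c j ^ 2) * (4 * H ^ 2) ≤ ((d + 1) * c i ^ 2) * (4 * H ^ 2) := by gcongr
      _ = _ := by ring
  rw [neg_mul, Real.exp_neg, ← div_eq_mul_inv, le_div_iff₀ (Real.exp_pos _)]
  refine le_trans ?_ h2
  gcongr

/-! ### Gaussian decay of Gelfand-Shilov functions and of their transforms -/

lemma norm_gaussTensor_zero {d : ℕ} (z : E d × E d) (y : E d) :
    ‖gaussTensor z 0 y‖ = Real.exp (-‖y - z.1‖ ^ 2 / 2) := by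
  simp only [gaussTensor, tensor, norm_prod, Pi.zero_apply, norm_gaussDeriv_zero]
  rw [← Real.exp_sum, EuclideanSpace.norm_sq_eq, ← Finset.sum_div, Finset.sum_neg_distrib]
  simp

lemma integrable_exp_neg_mul_sq_norm {d : ℕ} {b : ℝ} (hb : 0 < b) :
    Integrable fun y : E d => Real.exp (-b * ‖y‖ ^ 2) := by
  have := (GaussianFourier.integrable_cexp_neg_mul_sq_norm_add (V := E d) (b := (b : ℂ))
    (by simpa using hb) 0 0).norm
  refine this.congr (ae_of_all _ fun y => ?_)
  simp only [Complex.norm_exp]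
  congr 1
  simp [← Complex.ofReal_pow]

lemma integrable_exp_neg_sq_norm_sub {d : ℕ} (x : E d) :
    Integrable fun y : E d => Real.exp (-‖y - x‖ ^ 2 / 2) := by
  have := (integrable_exp_neg_mul_sq_norm (d := d) (b := 1 / 2) (by norm_num)).comp_sub_right x
  refine this.congr (ae_of_all _ fun y => ?_)
  simp only
  ring_nf

lemma integral_exp_neg_sq_norm_sub {d : ℕ} (x : E d) :
    ∫ y : E d, Real.exp (-‖y - x‖ ^ 2 / 2) = ∫ y : E d, Real.exp (-‖y‖ ^ 2 / 2) :=
  integral_sub_right_eq_self (fun y : E d => Real.exp (-‖y‖ ^ 2 / 2)) x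

lemma integrable_mul_gaussTensor {d : ℕ} {χ : E d → ℂ} {B : ℝ} (hχ : Continuous χ)
    (hB : ∀ y, ‖χ y‖ ≤ B) (z : E d × E d) : Integrable fun y => χ y * gaussTensor z 0 y := by
  refine ((integrable_exp_neg_sq_norm_sub z.1).const_mul B).mono'
    (hχ.mul (contDiff_gaussTensor z 0).continuous).aestronglyMeasurable (ae_of_all _ fun y => ?_)
  rw [norm_mul, norm_gaussTensor_zero]
  gcongr
  exact hB y

lemma norm_integral_mul_gaussTensor_le {d : ℕ} {χ : E d → ℂ} {B : ℝ}
    (hB : ∀ y, ‖χ y‖ ≤ B) (z : E d × E d) :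
    ‖∫ y, χ y * gaussTensor z 0 y‖ ≤ B * ∫ y : E d, Real.exp (-‖y‖ ^ 2 / 2) := by
  rw [← integral_exp_neg_sq_norm_sub z.1, ← integral_const_mul]
  refine norm_integral_le_of_norm_le ((integrable_exp_neg_sq_norm_sub z.1).const_mul B)
    (ae_of_all _ fun y => ?_)
  rw [norm_mul, norm_gaussTensor_zero]
  gcongr
  exact hB y

lemma pderiv_gaussTensor_zero {d : ℕ} (i : Fin d) (z : E d × E d) (y : E d) :
    pderiv i (gaussTensor z 0) y =
      ((z.1 i : ℂ) - Complex.I * z.2 i - y i) * gaussTensor z 0 y := by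
  rw [pderiv_gaussTensor]
  simp only [gaussTensor, tensor, Pi.zero_apply, zero_add]
  rw [← Finset.mul_prod_erase _ _ (Finset.mem_univ i),
    ← Finset.mul_prod_erase Finset.univ (fun j => gaussDeriv (z.1 j) (z.2 j) 0 (y j))
      (Finset.mem_univ i), ← mul_assoc]
  congr 1
  · simp [gaussDeriv]
  · refine Finset.prod_congr rfl fun j hj => ?_
    simp [Finset.ne_of_mem_erase hj]

lemma mderiv_single {d : ℕ} (i : Fin d) (a : ℕ) (f : E d → ℂ) :
    mderiv (Pi.single i a) f = (pderiv i)^[a] f := by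
  have key : ∀ l : List (Fin d), l.Nodup →
      l.foldr (fun j g => (pderiv j)^[(Pi.single i a : Fin d → ℕ) j] g) f =
        if i ∈ l then (pderiv i)^[a] f else f := by
    intro l hl
    induction l with
    | nil => simp
    | cons j l ih =>
      rw [List.nodup_cons] at hl
      rw [List.foldr_cons, ih hl.2]
      by_cases h : j = i
      · subst h; simp [hl.1]
      · simp [h, Ne.symm h]
  rw [mderiv, key _ (List.nodup_finRange d)]
  simp

lemma SeminormLE.norm_pow_mul_pderiv_iter_le {d : ℕ} {h B : ℝ} {f : E d → ℂ}
    (hf : SeminormLE (1 / 2) h B f) (i : Fin d) (a b : ℕ) (y : E d) :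
    ‖((y i : ℂ) ^ b) * (pderiv i)^[a] f y‖ ≤
      B * h ^ (a + b) * Real.sqrt (a.factorial * b.factorial : ℕ) := by
  have h1 := hf (Pi.single i a) (Pi.single i b) y
  rw [mderiv_single] at h1
  have h2 : ∏ j, y j ^ (Pi.single i b : Fin d → ℕ) j = y i ^ b := by
    rw [Finset.prod_eq_single i (fun j _ hj => by simp [hj]) (by simp)]
    simp
  have h3 : ∏ j, (((Pi.single i a : Fin d → ℕ) j).factorial *
      ((Pi.single i b : Fin d → ℕ) j).factorial) = a.factorial * b.factorial := by
    rw [Finset.prod_eq_single i (fun j _ hj => by simp [hj]) (by simp)]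
    simp
  have h4 : ∑ j, ((Pi.single i a : Fin d → ℕ) j + (Pi.single i b : Fin d → ℕ) j) = a + b := by
    rw [Finset.sum_eq_single i (fun j _ hj => by simp [hj]) (by simp)]
    simp
  rw [h2, h3, h4, ← Real.sqrt_eq_rpow] at h1
  simpa using h1

lemma SeminormLE.norm_le {d : ℕ} {s h B : ℝ} {f : E d → ℂ}
    (hf : SeminormLE s h B f) (y : E d) : ‖f y‖ ≤ B := by
  have := hf 0 0 y
  simpa [mderiv_zero] using this

lemma exists_seminormLE {d : ℕ} {s : ℝ} (ψ : GelfandShilov s d) :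
    ∃ h ≥ 1, ∃ B ≥ 0, SeminormLE s h B (ψ : E d → ℂ) := by
  obtain ⟨-, h, hh, B, hB, hψ⟩ := ψ.2
  exact ⟨max h 1, le_max_right _ _, B, hB, hψ.mono hh (le_max_left _ _) hB⟩

lemma continuous_gelfandShilov {d : ℕ} {s : ℝ} (ψ : GelfandShilov s d) :
    Continuous (ψ : E d → ℂ) := ψ.2.1.continuous

lemma exists_norm_gelfandShilov_le {d : ℕ} (ψ : GelfandShilov (1 / 2) d) :
    ∃ C > 0, ∃ ε > 0, ∀ y, ‖(ψ : E d → ℂ) y‖ ≤ C * Real.exp (-ε * ‖y‖ ^ 2) := by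
  obtain ⟨h, hh, B, hB, hψ⟩ := exists_seminormLE ψ
  refine ⟨2 * (B + 1), by positivity, 1 / (4 * h ^ 2 * (d + 1)), by positivity, fun y => ?_⟩
  rw [EuclideanSpace.norm_sq_eq]
  refine le_exp_of_pow_mul_le (norm_nonneg _) ((hψ.norm_le y).trans (by linarith))
    (by linarith) fun i n => ?_
  have h1 := hψ.norm_pow_mul_pderiv_iter_le i 0 n y
  simp only [Function.iterate_zero, id, norm_mul, norm_pow, Complex.norm_real, zero_add,
    Nat.factorial_zero, one_mul] at h1
  refine h1.trans ?_
  gcongr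
  linarith

/-- The moments `∫ y_i^b ∂_i^a ψ(y) g_z(y) dy` against an unnormalised atom. -/
def gaussMoment {d : ℕ} (ψ : E d → ℂ) (z : E d × E d) (i : Fin d) (a b : ℕ) : ℂ :=
  ∫ y : E d, ((y i : ℂ) ^ b * (pderiv i)^[a] ψ y) * gaussTensor z 0 y

/-- Integration by parts in `y i`, since `∂_i` of the atom is `(x_i - iξ_i - y_i)` times the atom. A
factor `x_i - iξ_i` is thereby traded for one more power of `y i`, one more derivative on `ψ`, or
one power fewer. For `b = 0` the truncated `b - 1` is harmless, its coefficient being zero. -/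
lemma gaussMoment_recurrence {d : ℕ} {h B : ℝ} {ψ : E d → ℂ} (hψ : ContDiff ℝ ∞ ψ)
    (hB : SeminormLE (1 / 2) h B ψ) (z : E d × E d) (i : Fin d) (a b : ℕ) :
    ((z.1 i : ℂ) - Complex.I * z.2 i) * gaussMoment ψ z i a b =
      gaussMoment ψ z i a (b + 1) - gaussMoment ψ z i (a + 1) b -
        b * gaussMoment ψ z i a (b - 1) := by
  have hsm : ∀ a, ContDiff ℝ ∞ ((pderiv i)^[a] ψ) := fun a => contDiff_pderiv_iter i a hψ
  have hint : ∀ a b, Integrable fun y : E d =>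
      ((y i : ℂ) ^ b * (pderiv i)^[a] ψ y) * gaussTensor z 0 y := fun a b => by
    refine integrable_mul_gaussTensor ?_ (fun y => hB.norm_pow_mul_pderiv_iter_le i a b y) z
    have := (hsm a).continuous
    have h1 : Continuous fun y : E d => (y i : ℂ) := by fun_prop
    exact (h1.pow b).mul this
  set χ : E d → ℂ := fun y => (y i : ℂ) ^ b * (pderiv i)^[a] ψ y with hχ
  have hcoord : ∀ y : E d, HasFDerivAt (fun y : E d => (y i : ℂ))
      (Complex.ofRealCLM.comp (EuclideanSpace.proj i : E d →L[ℝ] ℝ)) y := fun y =>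
    (Complex.ofRealCLM.comp (EuclideanSpace.proj i : E d →L[ℝ] ℝ)).hasFDerivAt
  have hχd : ∀ y, fderiv ℝ χ y (EuclideanSpace.single i 1) =
      b * ((y i : ℂ) ^ (b - 1) * (pderiv i)^[a] ψ y) +
        (y i : ℂ) ^ b * (pderiv i)^[a + 1] ψ y := by
    intro y
    have h1 := ((hcoord y).pow b).mul ((hsm a).differentiable (by simp) y).hasFDerivAt
    rw [show χ = (fun y : E d => (y i : ℂ) ^ b) * (pderiv i)^[a] ψ from rfl, h1.fderiv,
      Function.iterate_succ_apply']
    simp [pderiv]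
    ring
  have hχdiff : Differentiable ℝ χ := fun y =>
    (((hcoord y).pow b).mul ((hsm a).differentiable (by simp) y).hasFDerivAt).differentiableAt
  have hTd : ∀ y, fderiv ℝ (gaussTensor z 0) y (EuclideanSpace.single i 1) =
      ((z.1 i : ℂ) - Complex.I * z.2 i - y i) * gaussTensor z 0 y :=
    fun y => pderiv_gaussTensor_zero i z y
  have e1 : (fun y => χ y * fderiv ℝ (gaussTensor z 0) y (EuclideanSpace.single i 1)) =
      fun y => ((z.1 i : ℂ) - Complex.I * z.2 i) * (χ y * gaussTensor z 0 y) -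
        ((y i : ℂ) ^ (b + 1) * (pderiv i)^[a] ψ y) * gaussTensor z 0 y := by
    funext y; rw [hTd, hχ]; ring
  have e2 : (fun y => fderiv ℝ χ y (EuclideanSpace.single i 1) * gaussTensor z 0 y) =
      fun y => (b : ℂ) * (((y i : ℂ) ^ (b - 1) * (pderiv i)^[a] ψ y) * gaussTensor z 0 y) +
        ((y i : ℂ) ^ b * (pderiv i)^[a + 1] ψ y) * gaussTensor z 0 y := by
    funext y; rw [hχd]; ring
  have ibp := integral_mul_fderiv_eq_neg_fderiv_mul_of_integrable (μ := volume) (f := χ)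
    (g := gaussTensor z 0) (v := EuclideanSpace.single i (1 : ℝ))
    (by rw [e2]; exact ((hint a (b - 1)).const_mul _).add (hint (a + 1) b))
    (by rw [e1]; exact ((hint a b).const_mul _).sub (hint a (b + 1)))
    (hint a b) (fun y _ => hχdiff y)
    (fun y _ => (contDiff_gaussTensor z 0).differentiable (by simp) y)
  rw [e1, e2, integral_sub ((hint a b).const_mul _) (hint a (b + 1)), integral_const_mul,
    integral_add ((hint a (b - 1)).const_mul _) (hint (a + 1) b), integral_const_mul] at ibp
  simp only [gaussMoment]
  linear_combination ibp

/-- Iterating the recurrence: two of its terms cost a factor `h` each, and the factor `b` of the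
third is absorbed by the factorial, whence `2h + 1` per step. All `a` and `b` must be carried,
because the recurrence changes both. -/
lemma norm_pow_mul_gaussMoment_le {d : ℕ} {h B : ℝ} (hh : 1 ≤ h) (hB0 : 0 ≤ B) {ψ : E d → ℂ}
    (hψ : ContDiff ℝ ∞ ψ) (hB : SeminormLE (1 / 2) h B ψ) (z : E d × E d) (i : Fin d) (n : ℕ) :
    ∀ a b : ℕ, ‖(z.1 i : ℂ) - Complex.I * z.2 i‖ ^ n * ‖gaussMoment ψ z i a b‖ ≤
      B * (∫ y : E d, Real.exp (-‖y‖ ^ 2 / 2)) * (2 * h + 1) ^ n * h ^ (a + b) *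
        Real.sqrt (n + a + b).factorial := by
  set J := ∫ y : E d, Real.exp (-‖y‖ ^ 2 / 2) with hJ
  have hJ0 : 0 ≤ J := integral_nonneg fun y => (Real.exp_pos _).le
  set c := (z.1 i : ℂ) - Complex.I * z.2 i with hc
  have hh0 : 0 ≤ h := by linarith
  induction n with
  | zero =>
    intro a b
    have h1 := norm_integral_mul_gaussTensor_le
      (fun y => hB.norm_pow_mul_pderiv_iter_le i a b y) z
    rw [pow_zero, one_mul, pow_zero, mul_one, zero_add]
    refine h1.trans ?_
    have h2 : Real.sqrt (a.factorial * b.factorial : ℕ) ≤ Real.sqrt (a + b).factorial := by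
      rw [Nat.cast_mul, Real.sqrt_mul (by positivity)]
      exact sqrt_factorial_mul_le a b
    calc _ ≤ B * h ^ (a + b) * Real.sqrt (a + b).factorial * J := by gcongr
      _ = _ := by ring
  | succ n ih =>
    intro a b
    have h1 := gaussMoment_recurrence hψ hB z i a b
    have h2 : ‖c‖ * ‖gaussMoment ψ z i a b‖ ≤ ‖gaussMoment ψ z i a (b + 1)‖ +
        ‖gaussMoment ψ z i (a + 1) b‖ + b * ‖gaussMoment ψ z i a (b - 1)‖ := by
      rw [← norm_mul, h1]
      refine (norm_sub_le _ _).trans ?_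
      rw [norm_mul, Complex.norm_natCast]
      gcongr
      exact norm_sub_le _ _
    have e1 := ih a (b + 1)
    have e2 := ih (a + 1) b
    have e3 := ih a (b - 1)
    rw [show n + a + (b + 1) = n + 1 + a + b by ring, show a + (b + 1) = a + b + 1 by ring] at e1
    rw [show n + (a + 1) + b = n + 1 + a + b by ring, show a + 1 + b = a + b + 1 by ring] at e2
    set S := Real.sqrt (n + 1 + a + b).factorial with hS
    have h3 : (b : ℝ) * (‖c‖ ^ n * ‖gaussMoment ψ z i a (b - 1)‖) ≤
        B * J * (2 * h + 1) ^ n * h ^ (a + b) * S := by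
      rcases Nat.eq_zero_or_pos b with hb | hb
      · subst hb; simp only [Nat.cast_zero, zero_mul]; positivity
      obtain ⟨b, rfl⟩ := Nat.exists_eq_succ_of_ne_zero hb.ne'
      simp only [Nat.succ_eq_add_one, Nat.add_sub_cancel] at e3 ⊢
      have h4 : ((b + 1 : ℕ) : ℝ) * Real.sqrt (n + a + b).factorial ≤ S := by
        apply Real.le_sqrt_of_sq_le
        rw [mul_pow, Real.sq_sqrt (by positivity),
          show n + 1 + a + (b + 1) = n + a + b + 1 + 1 by ring,
          Nat.factorial_succ, Nat.factorial_succ, ← mul_assoc]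
        push_cast
        gcongr
        have : (0 : ℝ) ≤ n := by positivity
        have : (0 : ℝ) ≤ b := by positivity
        have : (0 : ℝ) ≤ a := by positivity
        nlinarith
      calc _ ≤ ((b + 1 : ℕ) : ℝ) * (B * J * (2 * h + 1) ^ n * h ^ (a + b) *
            Real.sqrt (n + a + b).factorial) := by gcongr
        _ = B * J * (2 * h + 1) ^ n * h ^ (a + b) *
            (((b + 1 : ℕ) : ℝ) * Real.sqrt (n + a + b).factorial) := by ring
        _ ≤ B * J * (2 * h + 1) ^ n * h ^ (a + (b + 1)) * S := by
            gcongr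
            omega
    calc ‖c‖ ^ (n + 1) * ‖gaussMoment ψ z i a b‖
        = ‖c‖ ^ n * (‖c‖ * ‖gaussMoment ψ z i a b‖) := by ring
      _ ≤ ‖c‖ ^ n * (‖gaussMoment ψ z i a (b + 1)‖ + ‖gaussMoment ψ z i (a + 1) b‖ +
            b * ‖gaussMoment ψ z i a (b - 1)‖) := by gcongr
      _ = ‖c‖ ^ n * ‖gaussMoment ψ z i a (b + 1)‖ + ‖c‖ ^ n * ‖gaussMoment ψ z i (a + 1) b‖ +
            b * (‖c‖ ^ n * ‖gaussMoment ψ z i a (b - 1)‖) := by ring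
      _ ≤ B * J * (2 * h + 1) ^ n * h ^ (a + b + 1) * S +
            B * J * (2 * h + 1) ^ n * h ^ (a + b + 1) * S +
            B * J * (2 * h + 1) ^ n * h ^ (a + b) * S := by gcongr
      _ = B * J * (2 * h + 1) ^ (n + 1) * h ^ (a + b) * S := by ring

lemma stftFun_gaussian_eq {d : ℕ} (ψ : E d → ℂ) (z : E d × E d) :
    stftFun (gaussian d) ψ z = (atomConst d : ℂ) * ∫ y, ψ y * gaussTensor z 0 y := by
  rw [stftFun, ← integral_const_mul]
  congr 1
  funext y
  rw [atom_gaussian_eq, Pi.smul_apply, smul_eq_mul]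
  ring

lemma sum_norm_sq_eq_sqNorm {d : ℕ} (z : E d × E d) :
    ∑ i, ‖(z.1 i : ℂ) - Complex.I * z.2 i‖ ^ 2 = sqNorm z := by
  rw [sqNorm, EuclideanSpace.norm_sq_eq, EuclideanSpace.norm_sq_eq, ← Finset.sum_add_distrib]
  refine Finset.sum_congr rfl fun i _ => ?_
  rw [← Complex.normSq_eq_norm_sq, Complex.normSq_apply]
  simp [sq]

/-- The short-time Fourier transform of a function in `S_{1/2}` has Gaussian decay. -/
lemma exists_norm_stftFun_le {d : ℕ} (ψ : GelfandShilov (1 / 2) d) :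
    ∃ C > 0, ∃ ε > 0, ∀ z, ‖stftFun (gaussian d) (ψ : E d → ℂ) z‖ ≤
      C * Real.exp (-ε * sqNorm z) := by
  obtain ⟨h, hh, B, hB, hψ⟩ := exists_seminormLE ψ
  set J := ∫ y : E d, Real.exp (-‖y‖ ^ 2 / 2) with hJ
  have hJ0 : 0 ≤ J := integral_nonneg fun y => (Real.exp_pos _).le
  have hc := atomConst_pos d
  refine ⟨atomConst d * (2 * (B * J + 1)), by positivity, 1 / (4 * (2 * h + 1) ^ 2 * (d + 1)),
    by positivity, fun z => ?_⟩
  rw [stftFun_gaussian_eq, norm_mul, Complex.norm_real, Real.norm_of_nonneg hc.le, mul_assoc,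
    ← sum_norm_sq_eq_sqNorm]
  gcongr
  -- Here `c i = ‖x_i - iξ_i‖`, whose squares add up to `sqNorm z`, so decay in `x` and in `ξ` comes
  -- at once.
  refine le_exp_of_pow_mul_le (norm_nonneg _)
    ((norm_integral_mul_gaussTensor_le hψ.norm_le z).trans (by linarith)) (by linarith)
    fun i n => ?_
  have h1 := norm_pow_mul_gaussMoment_le hh hB ψ.2.1 hψ z i n 0 0
  simp only [gaussMoment, pow_zero, one_mul, Function.iterate_zero, id, add_zero, mul_one] at h1
  refine h1.trans ?_
  gcongr
  linarith

/-! ### Functions as distributions -/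

lemma integrable_gelfandShilov {d : ℕ} (ψ : GelfandShilov (1 / 2) d) :
    Integrable (ψ : E d → ℂ) := by
  obtain ⟨C, hC, ε, hε, h⟩ := exists_norm_gelfandShilov_le ψ
  exact ((integrable_exp_neg_mul_sq_norm hε).const_mul C).mono'
    (continuous_gelfandShilov ψ).aestronglyMeasurable (ae_of_all _ h)

lemma integrable_mul_gelfandShilov {d : ℕ} {g : E d → ℂ} (hg : Integrable g)
    (ψ : GelfandShilov (1 / 2) d) : Integrable fun y => g y * (ψ : E d → ℂ) y := by
  obtain ⟨h, hh, B, hB, hψ⟩ := exists_seminormLE ψ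
  exact hg.mul_bdd (c := B) (continuous_gelfandShilov ψ).aestronglyMeasurable (ae_of_all _ hψ.norm_le)

/-- The distribution given by an integrable function. -/
def distOfIntegrable {d : ℕ} (g : E d → ℂ) (hg : Integrable g) : GSDistribution (1 / 2) d :=
  ⟨{ toFun := fun ψ => ∫ y, g y * (ψ : E d → ℂ) y
     map_add' := fun ψ χ => by
      rw [← integral_add (integrable_mul_gelfandShilov hg ψ) (integrable_mul_gelfandShilov hg χ)]
      simp [mul_add]
     map_smul' := fun c ψ => by
      rw [RingHom.id_apply, smul_eq_mul, ← integral_const_mul]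
      congr 1
      funext y
      simp only [Submodule.coe_smul, Pi.smul_apply, smul_eq_mul]
      ring },
   fun h _ => ⟨∫ y, ‖g y‖, integral_nonneg fun _ => norm_nonneg _, fun ψ B _ hψ => by
    rw [← integral_mul_const]
    refine norm_integral_le_of_norm_le (hg.norm.mul_const B) (ae_of_all _ fun y => ?_)
    rw [norm_mul]
    gcongr
    exact hψ.norm_le y⟩⟩

lemma distOfIntegrable_apply {d : ℕ} (g : E d → ℂ) (hg : Integrable g)
    (ψ : GelfandShilov (1 / 2) d) :
    (distOfIntegrable g hg : GelfandShilov (1 / 2) d →ₗ[ℂ] ℂ) ψ =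
      ∫ y, g y * (ψ : E d → ℂ) y := rfl

lemma stft_distOfIntegrable {d : ℕ} (g : E d → ℂ) (hg : Integrable g) :
    stft (distOfIntegrable g hg) = stftFun (gaussian d) g := rfl

lemma continuous_stftFun_gelfandShilov {d : ℕ} (ψ : GelfandShilov (1 / 2) d) :
    Continuous (stftFun (gaussian d) (ψ : E d → ℂ)) := by
  rw [← stft_distOfIntegrable _ (integrable_gelfandShilov ψ)]
  exact continuous_stft _

/-! ### The inversion formula -/

/-- The reflection `(x, ξ) ↦ (x, -ξ)` of phase space. -/
def flipSnd {d : ℕ} (z : E d × E d) : E d × E d := (z.1, -z.2)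

lemma continuous_flipSnd {d : ℕ} : Continuous (flipSnd : E d × E d → E d × E d) := by
  unfold flipSnd; fun_prop

lemma sqNorm_flipSnd {d : ℕ} (z : E d × E d) : sqNorm (flipSnd z) = sqNorm z := by
  simp [sqNorm, flipSnd]

lemma sqNorm_nonneg {d : ℕ} (z : E d × E d) : 0 ≤ sqNorm z := by unfold sqNorm; positivity

lemma continuous_sqNorm {d : ℕ} : Continuous (sqNorm : E d × E d → ℝ) := by
  unfold sqNorm; fun_prop

lemma integrable_exp_neg_mul_sqNorm {d : ℕ} {b : ℝ} (hb : 0 < b) :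
    Integrable fun z : E d × E d => Real.exp (-b * sqNorm z) := by
  have := (integrable_exp_neg_mul_sq_norm (d := d) hb).mul_prod
    (integrable_exp_neg_mul_sq_norm (d := d) hb)
  refine this.congr (ae_of_all _ fun z => ?_)
  simp only [sqNorm]
  rw [← Real.exp_add]
  ring_nf

lemma gaussTensor_zero_eq {d : ℕ} (x ξ y : E d) :
    gaussTensor (x, ξ) 0 y = ((Real.exp (-‖y - x‖ ^ 2 / 2) : ℝ) : ℂ) *
      Complex.exp (-Complex.I * (inner ℝ y ξ : ℝ)) := by
  have h := congrFun (atom_gaussian_eq x ξ) y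
  have hc : ((atomConst d : ℝ) : ℂ) ≠ 0 := by exact_mod_cast (atomConst_pos d).ne'
  rw [Pi.smul_apply, smul_eq_mul] at h
  apply mul_left_cancel₀ hc
  rw [← h]
  simp only [atom, gaussian, atomConst, Complex.conj_ofReal]
  push_cast
  ring

/-- For fixed `x` the inner integral is the Fourier transform of `ψ · exp(-|· - x|²/2)`. It is
integrable in `ξ` by the Gaussian decay of the transform of `ψ`, so Fourier inversion applies. -/
lemma fourier_inversion_gaussTensor {d : ℕ} (ψ : GelfandShilov (1 / 2) d) (x y : E d) :
    ∫ ξ : E d, Complex.exp (Complex.I * (inner ℝ y ξ : ℝ)) *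
        ∫ y', (ψ : E d → ℂ) y' * gaussTensor (x, ξ) 0 y' =
      (2 * Real.pi) ^ d * ((ψ : E d → ℂ) y * Real.exp (-‖y - x‖ ^ 2 / 2)) := by
  obtain ⟨h, hh, B, hB, hψ⟩ := exists_seminormLE ψ
  set k : E d → ℂ := fun y => (ψ : E d → ℂ) y * Real.exp (-‖y - x‖ ^ 2 / 2) with hk
  set G : E d → ℂ := fun ξ => ∫ y', (ψ : E d → ℂ) y' * gaussTensor (x, ξ) 0 y' with hG
  have hkc : Continuous k := by
    have h1 : Continuous fun y : E d => Real.exp (-‖y - x‖ ^ 2 / 2) := by fun_prop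
    exact (continuous_gelfandShilov ψ).mul (Complex.continuous_ofReal.comp h1)
  have hki : Integrable k := by
    refine ((integrable_exp_neg_sq_norm_sub x).const_mul B).mono' hkc.aestronglyMeasurable
      (ae_of_all _ fun y => ?_)
    rw [hk, norm_mul, Complex.norm_real, Real.norm_of_nonneg (Real.exp_pos _).le]
    gcongr
    exact hψ.norm_le y
  have hF : ∀ η, FourierTransform.fourier k η = G ((2 * Real.pi) • η) := by
    intro η
    rw [Real.fourier_eq']
    refine integral_congr_ae (ae_of_all _ fun y => ?_)
    simp only [hk, gaussTensor_zero_eq, smul_eq_mul]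
    rw [inner_smul_right]
    push_cast
    ring_nf
  obtain ⟨C, hC, ε, hε, hV⟩ := exists_norm_stftFun_le ψ
  have hc := atomConst_pos d
  have hGb : ∀ ξ, ‖G ξ‖ ≤ C / atomConst d * Real.exp (-ε * ‖ξ‖ ^ 2) := by
    intro ξ
    have h1 := hV (x, ξ)
    rw [stftFun_gaussian_eq, norm_mul, Complex.norm_real, Real.norm_of_nonneg hc.le] at h1
    rw [div_mul_eq_mul_div, le_div_iff₀' hc]
    refine h1.trans ?_
    refine mul_le_mul_of_nonneg_left (Real.exp_le_exp.mpr ?_) hC.le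
    simp only [sqNorm]
    nlinarith [sq_nonneg ‖x‖]
  have hFi : Integrable (FourierTransform.fourier k) := by
    refine ((integrable_exp_neg_mul_sq_norm (d := d)
      (b := ε * (2 * Real.pi) ^ 2) (by positivity)).const_mul (C / atomConst d)).mono' ?_
      (ae_of_all _ fun η => ?_)
    · exact (VectorFourier.fourierIntegral_continuous Real.continuous_fourierChar
        (by exact continuous_inner) hki).aestronglyMeasurable
    · rw [hF]
      refine (hGb _).trans_eq ?_
      rw [norm_smul, Real.norm_of_nonneg (by positivity)]
      ring_nf
  have hinv := congrFun (hkc.fourierInv_fourier_eq hki hFi) y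
  rw [Real.fourierInv_eq'] at hinv
  set P : E d → ℂ := fun ξ => Complex.exp (Complex.I * (inner ℝ y ξ : ℝ)) * G ξ with hP
  have h2 : ∫ η, P ((2 * Real.pi) • η) = k y := by
    rw [← hinv]
    refine integral_congr_ae (ae_of_all _ fun η => ?_)
    simp only [hP, hF, smul_eq_mul]
    rw [inner_smul_right, real_inner_comm]
    push_cast
    ring_nf
  -- The Fourier transform here has kernel `exp(-2πi⟨y,η⟩)`; the substitution `ξ = 2πη` produces the
  -- factor `(2π)^d`.
  rw [Measure.integral_comp_smul, finrank_euclideanSpace_fin, abs_of_nonneg (by positivity)] at h2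
  change ∫ ξ, P ξ = (2 * Real.pi) ^ d * k y
  rw [← h2, Complex.real_smul, ← mul_assoc]
  have : ((2 * Real.pi : ℂ)) ≠ 0 := by exact_mod_cast (by positivity : 2 * Real.pi ≠ 0)
  push_cast
  rw [mul_inv_cancel₀ (pow_ne_zero _ this), one_mul]

/-- The window has `L²` norm one, and the factors `2π` of the atom and of Fourier inversion cancel.
Hence the inversion formula holds with constant one. -/
lemma atomConst_sq (d : ℕ) :
    atomConst d ^ 2 * ((2 * Real.pi) ^ d * ∫ x : E d, Real.exp (-1 * ‖x‖ ^ 2)) = 1 := by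
  rw [GaussianFourier.integral_rexp_neg_mul_sq_norm one_pos, atomConst, mul_pow,
    finrank_euclideanSpace_fin, div_one]
  have hp := Real.pi_pos
  rw [← Real.rpow_natCast, ← Real.rpow_mul (by positivity), ← Real.rpow_natCast (_ ^ _),
    ← Real.rpow_mul (by positivity), ← Real.rpow_natCast (2 * Real.pi) d]
  rw [mul_mul_mul_comm, ← Real.rpow_add (by positivity), ← Real.rpow_add (by positivity)]
  push_cast
  ring_nf
  simp

/-- Integrating in `ξ` first leaves a multiple of `ψ(y) exp(-|y - x|²)`, and the integral in `x`
normalises. The reflection appears because the pairing is bilinear: the coefficient of an atom is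
the pairing with its conjugate, the atom at the reflected point. -/
lemma integral_stftFun_mul_gaussTensor {d : ℕ} (ψ : GelfandShilov (1 / 2) d) (y : E d) :
    ∫ z, stftFun (gaussian d) (ψ : E d → ℂ) (flipSnd z) *
      ((atomConst d : ℂ) * gaussTensor z 0 y) = (ψ : E d → ℂ) y := by
  obtain ⟨C, hC, ε, hε, hV⟩ := exists_norm_stftFun_le ψ
  have hc := atomConst_pos d
  have hint : Integrable fun z : E d × E d => stftFun (gaussian d) (ψ : E d → ℂ) (flipSnd z) *
      ((atomConst d : ℂ) * gaussTensor z 0 y) := by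
    refine ((integrable_exp_neg_mul_sqNorm (d := d) hε).const_mul (C * atomConst d)).mono' ?_
      (ae_of_all _ fun z => ?_)
    · exact (((continuous_stftFun_gelfandShilov ψ).comp continuous_flipSnd).mul
        (continuous_const.mul (continuous_gaussTensor_left 0 y))).aestronglyMeasurable
    · rw [norm_mul, norm_mul, Complex.norm_real, Real.norm_of_nonneg hc.le, norm_gaussTensor_zero]
      have h1 : Real.exp (-‖y - z.1‖ ^ 2 / 2) ≤ 1 := by
        apply Real.exp_le_one_iff.mpr
        nlinarith [sq_nonneg ‖y - z.1‖]
      have h2 := hV (flipSnd z)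
      rw [sqNorm_flipSnd] at h2
      calc _ ≤ C * Real.exp (-ε * sqNorm z) * (atomConst d * 1) := by gcongr
        _ = _ := by ring
  rw [Measure.volume_eq_prod] at hint ⊢
  rw [integral_prod _ hint]
  have h1 : ∀ x : E d, ∫ ξ : E d, stftFun (gaussian d) (ψ : E d → ℂ) (flipSnd (x, ξ)) *
      ((atomConst d : ℂ) * gaussTensor (x, ξ) 0 y) =
      ((atomConst d ^ 2 * (2 * Real.pi) ^ d : ℝ) : ℂ) * (ψ : E d → ℂ) y *
        ((Real.exp (-1 * ‖y - x‖ ^ 2) : ℝ) : ℂ) := by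
    intro x
    rw [← integral_neg_eq_self (μ := (volume : Measure (E d)))]
    have h2 : ∀ ξ : E d, stftFun (gaussian d) (ψ : E d → ℂ) (flipSnd (x, -ξ)) *
        ((atomConst d : ℂ) * gaussTensor (x, -ξ) 0 y) =
        ((atomConst d ^ 2 * Real.exp (-‖y - x‖ ^ 2 / 2) : ℝ) : ℂ) *
          (Complex.exp (Complex.I * (inner ℝ y ξ : ℝ)) *
            ∫ y', (ψ : E d → ℂ) y' * gaussTensor (x, ξ) 0 y') := by
      intro ξ
      rw [stftFun_gaussian_eq, gaussTensor_zero_eq x (-ξ)]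
      simp only [flipSnd, neg_neg, inner_neg_right]
      push_cast
      ring_nf
    simp_rw [h2]
    rw [integral_const_mul, fourier_inversion_gaussTensor]
    have h3 : Real.exp (-1 * ‖y - x‖ ^ 2) =
        Real.exp (-‖y - x‖ ^ 2 / 2) * Real.exp (-‖y - x‖ ^ 2 / 2) := by
      rw [← Real.exp_add]; ring_nf
    rw [h3]
    push_cast
    ring
  simp_rw [h1]
  rw [integral_const_mul, integral_complex_ofReal,
    integral_sub_left_eq_self (fun x : E d => Real.exp (-1 * ‖x‖ ^ 2)) volume y,
    mul_right_comm, ← Complex.ofReal_mul, mul_assoc, atomConst_sq]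
  simp

/-! ### The inversion formula for derivatives -/

lemma hasDerivAt_line {d : ℕ} {f : E d → ℂ} (hf : ContDiff ℝ ∞ f) (i : Fin d) (y : E d) (s : ℝ) :
    HasDerivAt (fun s : ℝ => f (y + s • (EuclideanSpace.single i 1 : E d)))
      (pderiv i f (y + s • (EuclideanSpace.single i 1 : E d))) s := by
  have h1 : HasDerivAt (fun s : ℝ => y + s • (EuclideanSpace.single i 1 : E d))
      (EuclideanSpace.single i 1) s := by
    simpa using ((hasDerivAt_id s).smul_const
      (EuclideanSpace.single i (1 : ℝ) : E d)).const_add y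
  exact (hf.differentiable (by simp) _).hasFDerivAt.comp_hasDerivAt s h1

lemma exists_norm_gaussTensor_le {d : ℕ} {δ : ℝ} (hδ : 0 < δ) (α : Fin d → ℕ) :
    ∃ C > 0, ∀ (z : E d × E d) (y : E d), ‖gaussTensor z α y‖ ≤ C * Real.exp (δ * sqNorm z) := by
  obtain ⟨H, hH, hb⟩ := exists_gaussTensor_le d (δ := min δ (1 / 4)) (by positivity)
    (min_le_right _ _)
  refine ⟨gsWeight H α 0, gsWeight_pos hH α 0, fun z y => ?_⟩
  have h1 := hb z α 0 y
  simp only [Pi.zero_apply, pow_zero, Finset.prod_const_one, Complex.ofReal_one, one_mul] at h1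
  rw [mul_comm]
  have := gsWeight_pos hH α 0
  have := sqNorm_nonneg z
  refine h1.trans ?_
  gcongr
  exact min_le_left _ _

/-- A continuous function with Gaussian decay on phase space. -/
def GaussDecay {d : ℕ} (W : E d × E d → ℂ) : Prop :=
  Continuous W ∧ ∃ C > 0, ∃ ε > 0, ∀ z, ‖W z‖ ≤ C * Real.exp (-ε * sqNorm z)

/-- Decay at rate `ε` beats atom growth at rate `ε/2`. The majorant does not depend on `y`, which
permits differentiation under the integral to any order. -/
lemma GaussDecay.exists_bound {d : ℕ} {W : E d × E d → ℂ} (hW : GaussDecay W)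
    (α : Fin d → ℕ) : ∃ bound : E d × E d → ℝ, Integrable bound ∧
      ∀ z y, ‖W z * gaussTensor z α y‖ ≤ bound z := by
  obtain ⟨-, C, hC, ε, hε, hb⟩ := hW
  obtain ⟨C', hC', hb'⟩ := exists_norm_gaussTensor_le (d := d) (δ := ε / 2) (by positivity) α
  refine ⟨fun z => C * C' * Real.exp (-(ε / 2) * sqNorm z),
    (integrable_exp_neg_mul_sqNorm (by positivity)).const_mul _, fun z y => ?_⟩
  rw [norm_mul]
  calc _ ≤ (C * Real.exp (-ε * sqNorm z)) * (C' * Real.exp (ε / 2 * sqNorm z)) := by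
        gcongr
        · exact hb z
        · exact hb' z y
    _ = C * C' * (Real.exp (-ε * sqNorm z) * Real.exp (ε / 2 * sqNorm z)) := by ring
    _ = _ := by rw [← Real.exp_add]; ring_nf

lemma GaussDecay.integrable_mul {d : ℕ} {W : E d × E d → ℂ} (hW : GaussDecay W)
    (α : Fin d → ℕ) (y : E d) : Integrable fun z => W z * gaussTensor z α y := by
  obtain ⟨b, hb, h⟩ := hW.exists_bound α
  exact hb.mono' (hW.1.mul (continuous_gaussTensor_left α y)).aestronglyMeasurable
    (ae_of_all _ fun z => h z y)

lemma GaussDecay.pderiv_eq {d : ℕ} {W : E d × E d → ℂ} (hW : GaussDecay W)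
    {f : E d → ℂ} (hf : ContDiff ℝ ∞ f) {α : Fin d → ℕ}
    (h : ∀ y, f y = ∫ z, W z * gaussTensor z α y) (i : Fin d) (y : E d) :
    pderiv i f y = ∫ z, W z * gaussTensor z (Function.update α i (α i + 1)) y := by
  obtain ⟨b, hb, hbd⟩ := hW.exists_bound (Function.update α i (α i + 1))
  have h1 := hasDerivAt_line hf i y 0
  have h2 := hasDerivAt_integral_of_dominated_loc_of_deriv_le (μ := volume) (x₀ := (0 : ℝ))
    (s := Set.univ) (bound := b)
    (F := fun s z => W z * gaussTensor z α (y + s • (EuclideanSpace.single i 1 : E d)))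
    (F' := fun s z => W z * gaussTensor z (Function.update α i (α i + 1))
      (y + s • (EuclideanSpace.single i 1 : E d))) univ_mem
    (Eventually.of_forall fun s => (hW.integrable_mul α _).aestronglyMeasurable)
    (hW.integrable_mul α _) (hW.integrable_mul _ _).aestronglyMeasurable
    (ae_of_all _ fun z s _ => hbd z _) hb
    (ae_of_all _ fun z s _ => by
      have := (hasDerivAt_line (contDiff_gaussTensor z α) i y s).const_mul (W z)
      rwa [pderiv_gaussTensor] at this)
  have h3 := h2.2
  simp_rw [← h] at h3
  simpa using h1.unique h3

lemma GaussDecay.pderiv_iter_eq {d : ℕ} {W : E d × E d → ℂ} (hW : GaussDecay W)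
    {f : E d → ℂ} (hf : ContDiff ℝ ∞ f) {α : Fin d → ℕ}
    (h : ∀ y, f y = ∫ z, W z * gaussTensor z α y) (i : Fin d) (n : ℕ) :
    ∀ y, (pderiv i)^[n] f y =
      ∫ z, W z * gaussTensor z (Function.update α i (α i + n)) y := by
  induction n with
  | zero => simpa using h
  | succ n ih =>
    intro y
    rw [Function.iterate_succ_apply',
      hW.pderiv_eq (contDiff_pderiv_iter i n hf) ih i y]
    simp [add_assoc]

lemma GaussDecay.mderiv_eq {d : ℕ} {W : E d × E d → ℂ} (hW : GaussDecay W)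
    {f : E d → ℂ} (hf : ContDiff ℝ ∞ f)
    (h : ∀ y, f y = ∫ z, W z * gaussTensor z 0 y) (α : Fin d → ℕ) (y : E d) :
    mderiv α f y = ∫ z, W z * gaussTensor z α y := by
  have key : ∀ l : List (Fin d), l.Nodup → ∀ y,
      l.foldr (fun i g => (pderiv i)^[α i] g) f y =
        ∫ z, W z * gaussTensor z (fun i => if i ∈ l then α i else 0) y := by
    intro l hl
    induction l with
    | nil =>
      simp only [List.not_mem_nil, if_false]
      exact h
    | cons i l ih =>
      rw [List.nodup_cons] at hl
      intro y
      rw [List.foldr_cons, hW.pderiv_iter_eq (contDiff_foldr α l hf) (ih hl.2) i (α i) y]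
      congr 2
      funext z
      congr 2
      funext j
      by_cases hj : j = i
      · subst hj; simp [hl.1]
      · simp [hj]
  rw [mderiv, key _ (List.nodup_finRange d)]
  simp

/-! ### Pairing of a distribution with a test function -/

lemma gaussDecay_stftFun_flipSnd {d : ℕ} (ψ : GelfandShilov (1 / 2) d) :
    GaussDecay fun z => stftFun (gaussian d) (ψ : E d → ℂ) (flipSnd z) := by
  obtain ⟨C, hC, ε, hε, h⟩ := exists_norm_stftFun_le ψ
  refine ⟨(continuous_stftFun_gelfandShilov ψ).comp continuous_flipSnd, C, hC, ε, hε, fun z => ?_⟩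
  simpa [sqNorm_flipSnd] using h (flipSnd z)

lemma integrable_stftFun_mul_stft {d : ℕ} (f : GSDistribution (1 / 2) d)
    (ψ : GelfandShilov (1 / 2) d) :
    Integrable fun z => stftFun (gaussian d) (ψ : E d → ℂ) (flipSnd z) * stft f z := by
  obtain ⟨hc, C, hC, ε, hε, h⟩ := gaussDecay_stftFun_flipSnd ψ
  obtain ⟨C', hC', h'⟩ := exists_norm_stft_le f (δ := ε / 2) (by positivity)
  refine ((integrable_exp_neg_mul_sqNorm (d := d) (b := ε / 2) (by positivity)).const_mul
    (C * C')).mono' (hc.mul (continuous_stft f)).aestronglyMeasurable (ae_of_all _ fun z => ?_)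
  rw [norm_mul]
  calc _ ≤ (C * Real.exp (-ε * sqNorm z)) * (C' * Real.exp (ε / 2 * sqNorm z)) := by
        gcongr
        · exact h z
        · exact h' z
    _ = C * C' * (Real.exp (-ε * sqNorm z) * Real.exp (ε / 2 * sqNorm z)) := by ring
    _ = _ := by rw [← Real.exp_add]; ring_nf

/-- The action of a distribution in terms of short-time Fourier transforms. -/
theorem apply_eq_integral_stft {d : ℕ} (f : GSDistribution (1 / 2) d)
    (ψ : GelfandShilov (1 / 2) d) :
    (f : GelfandShilov (1 / 2) d →ₗ[ℂ] ℂ) ψ =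
      ∫ z, stftFun (gaussian d) (ψ : E d → ℂ) (flipSnd z) * stft f z := by
  have hW := gaussDecay_stftFun_flipSnd ψ
  obtain ⟨hc, C, hC, ε, hε, h⟩ := hW
  -- The growth rate of the atoms is chosen after the decay rate `ε` of `ψ`, at most half of it, so
  -- that the Bochner integral below converges.
  obtain ⟨H, hH, v, T, hv, hvn, hvk, hT, hs⟩ := exists_stft_eq_comp f
    (δ := min (ε / 2) (1 / 4)) (by positivity) (min_le_right _ _)
  set W : E d × E d → ℂ := fun z => stftFun (gaussian d) (ψ : E d → ℂ) (flipSnd z) with hWdef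
  have hA := atomConst_pos d
  have hint : Integrable fun z => W z • v z := by
    refine ((integrable_exp_neg_mul_sqNorm (d := d) (b := ε / 2) (by positivity)).const_mul
      (C * atomConst d)).mono' (hc.smul hv).aestronglyMeasurable (ae_of_all _ fun z => ?_)
    rw [norm_smul]
    have := sqNorm_nonneg z
    calc _ ≤ (C * Real.exp (-ε * sqNorm z)) *
          (atomConst d * Real.exp (min (ε / 2) (1 / 4) * sqNorm z)) := by
          gcongr
          · exact h z
          · exact hvn z
      _ ≤ (C * Real.exp (-ε * sqNorm z)) * (atomConst d * Real.exp (ε / 2 * sqNorm z)) := by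
          gcongr
          exact min_le_left _ _
      _ = C * atomConst d * (Real.exp (-ε * sqNorm z) * Real.exp (ε / 2 * sqNorm z)) := by ring
      _ = _ := by rw [← Real.exp_add]; ring_nf
  have hW' : GaussDecay fun z => W z * atomConst d := by
    refine ⟨hc.mul continuous_const, C * atomConst d, by positivity, ε, hε, fun z => ?_⟩
    rw [norm_mul, Complex.norm_real, Real.norm_of_nonneg hA.le, mul_right_comm]
    gcongr
    exact h z
  have hder := hW'.mderiv_eq ψ.2.1 (fun y => by
    rw [← integral_stftFun_mul_gaussTensor ψ y]
    simp only [hWdef, mul_assoc])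
  -- Each coordinate of the Bochner integral is a scalar integral, given by the inversion formula
  -- for a derivative of `ψ`. Hence the integral is the family of `ψ` itself, and `T` sends it to `f
  -- ψ`.
  have hk : ∀ k, (∫ z, W z • v z) k = gsCoeff H (fun α => mderiv α (ψ : E d → ℂ)) k := by
    intro k
    have h1 := (lp.evalCLM ℂ (fun _ : GSIndex d => ℂ) ∞ k).integral_comp_comm hint
    change ∫ z, W z • v z k = (∫ z, W z • v z) k at h1
    rw [← h1]
    simp only [gsCoeff, hder]
    rw [← integral_const_mul, ← integral_const_mul]
    refine integral_congr_ae (ae_of_all _ fun z => ?_)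
    simp only [hvk, gsCoeff, Pi.smul_apply, smul_eq_mul]
    ring
  rw [← hT ψ _ hk, ← T.integral_comp_comm hint]
  refine integral_congr_ae (ae_of_all _ fun z => ?_)
  simp only [map_smul, smul_eq_mul, hs, hWdef]

/-! ### Estimates from the reproducing formula -/

/-- A bound for the reproducing kernel of the short-time Fourier transform. -/
def reproKernel {d : ℕ} (z : E d × E d) : ℝ≥0∞ :=
  ENNReal.ofReal (Real.exp (-(1 / 4) * sqNorm z))

/-- The constant in front of the reproducing kernel. -/
def reproConst (d : ℕ) : ℝ≥0 :=
  (atomConst d ^ 2 * ‖((Real.pi : ℂ) / 1) ^ ((d : ℂ) / 2)‖).toNNReal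

lemma continuous_reproKernel {d : ℕ} : Continuous (reproKernel : E d × E d → ℝ≥0∞) := by
  unfold reproKernel
  have h1 : Continuous fun z : E d × E d => Real.exp (-(1 / 4) * sqNorm z) :=
    Real.continuous_exp.comp (continuous_const.mul continuous_sqNorm)
  exact ENNReal.continuous_ofReal.comp h1

lemma lintegral_reproKernel_lt_top (d : ℕ) : ∫⁻ z : E d × E d, reproKernel z < ⊤ := by
  have := (integrable_exp_neg_mul_sqNorm (d := d) (b := 1 / 4) (by norm_num)).lintegral_lt_top
  simpa [reproKernel] using this

lemma reproKernel_le_one {d : ℕ} (z : E d × E d) : reproKernel z ≤ 1 := by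
  unfold reproKernel
  rw [ENNReal.ofReal_le_one]
  apply Real.exp_le_one_iff.mpr
  nlinarith [sqNorm_nonneg z]

instance {d : ℕ} : (volume : Measure (E d × E d)).IsAddHaarMeasure :=
  inferInstanceAs ((volume : Measure (E d)).prod volume).IsAddHaarMeasure

lemma lintegral_reproKernel_sub_right (d : ℕ) (z : E d × E d) :
    ∫⁻ w : E d × E d, reproKernel (w - z) = ∫⁻ z : E d × E d, reproKernel z :=
  lintegral_sub_right_eq_self reproKernel z

lemma reproKernel_sub_comm {d : ℕ} (w z : E d × E d) :
    reproKernel (w - z) = reproKernel (z - w) := by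
  simp only [reproKernel, sqNorm, Prod.fst_sub, Prod.snd_sub, norm_sub_rev w.1 z.1,
    norm_sub_rev w.2 z.2]

lemma lintegral_reproKernel_sub (d : ℕ) (w : E d × E d) :
    ∫⁻ z : E d × E d, reproKernel (w - z) = ∫⁻ z : E d × E d, reproKernel z := by
  simp_rw [reproKernel_sub_comm w]
  exact lintegral_reproKernel_sub_right d w

/-- A product of two Gaussians is `exp(-|w.1 - z.1|²/4)` times a Gaussian centred at the midpoint.
Translating by the midpoint leaves a unimodular phase and the Fourier transform of a Gaussian in the
frequency difference. -/
lemma norm_stftFun_atom (d : ℕ) (w z : E d × E d) :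
    ‖stftFun (gaussian d) (atom (gaussian d) w.1 w.2) (flipSnd z)‖ =
      reproConst d * Real.exp (-(1 / 4) * sqNorm (w - z)) := by
  have hA := atomConst_pos d
  set m : E d := (1 / 2 : ℝ) • (w.1 + z.1) with hm
  set η : E d := z.2 - w.2 with hη
  have hexp : ∀ y : E d, -‖(y + m) - w.1‖ ^ 2 / 2 + -‖(y + m) - z.1‖ ^ 2 / 2 =
      -‖y‖ ^ 2 - ‖w.1 - z.1‖ ^ 2 / 4 := by
    intro y
    have h1 : (y + m) - w.1 = y - (1 / 2 : ℝ) • (w.1 - z.1) := by rw [hm]; module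
    have h2 : (y + m) - z.1 = y + (1 / 2 : ℝ) • (w.1 - z.1) := by rw [hm]; module
    rw [h1, h2, norm_sub_sq_real, norm_add_sq_real, norm_smul]
    norm_num
    ring
  have h1 : stftFun (gaussian d) (atom (gaussian d) w.1 w.2) (flipSnd z) =
      ((atomConst d ^ 2 * Real.exp (-‖w.1 - z.1‖ ^ 2 / 4) : ℝ) : ℂ) *
        (Complex.exp (Complex.I * (inner ℝ m η : ℝ)) *
        ∫ y : E d, Complex.exp (-1 * (‖y‖ : ℂ) ^ 2 + Complex.I * (inner ℝ η y : ℝ))) := by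
    rw [stftFun_gaussian_eq, ← integral_const_mul, ← integral_const_mul, ← integral_const_mul,
      ← integral_add_right_eq_self _ m]
    refine integral_congr_ae (ae_of_all _ fun y => ?_)
    simp only [atom_gaussian_eq, Pi.smul_apply, smul_eq_mul, flipSnd, gaussTensor_zero_eq]
    have h2 : ((Real.exp (-‖(y + m) - w.1‖ ^ 2 / 2) : ℝ) : ℂ) *
        ((Real.exp (-‖(y + m) - z.1‖ ^ 2 / 2) : ℝ) : ℂ) =
        ((Real.exp (-‖w.1 - z.1‖ ^ 2 / 4) : ℝ) : ℂ) * Complex.exp (-1 * (‖y‖ : ℂ) ^ 2) := by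
      rw [← Complex.ofReal_mul, ← Real.exp_add, hexp, sub_eq_add_neg, add_comm, Real.exp_add]
      push_cast
      ring_nf
    have h3 : Complex.exp (-Complex.I * (inner ℝ (y + m) w.2 : ℝ)) *
        Complex.exp (-Complex.I * (inner ℝ (y + m) (-z.2) : ℝ)) =
        Complex.exp (Complex.I * (inner ℝ m η : ℝ)) *
          Complex.exp (Complex.I * (inner ℝ η y : ℝ)) := by
      rw [← Complex.exp_add, ← Complex.exp_add]
      congr 1
      rw [real_inner_comm y η, hη]
      simp only [inner_add_left, inner_neg_right, inner_sub_right]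
      push_cast
      ring
    rw [Complex.exp_add]
    push_cast at h2 ⊢
    linear_combination ((atomConst d : ℂ) ^ 2 * Complex.exp (-Complex.I * (inner ℝ (y + m) w.2 : ℝ)) *
        Complex.exp (-Complex.I * (inner ℝ (y + m) (-z.2) : ℝ))) * h2 +
      ((atomConst d : ℂ) ^ 2 * Complex.exp (-‖w.1 - z.1‖ ^ 2 / 4) *
        Complex.exp (-1 * (‖y‖ : ℂ) ^ 2)) * h3
  have h2 := GaussianFourier.integral_cexp_neg_mul_sq_norm_add (V := E d) (b := 1) (by simp)
    Complex.I η
  rw [h1, h2, norm_mul, norm_mul, norm_mul, Complex.norm_real, reproConst,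
    Real.coe_toNNReal _ (by positivity), finrank_euclideanSpace_fin, Real.norm_of_nonneg
    (by positivity)]
  have h3 : ‖Complex.exp (Complex.I * (inner ℝ m η : ℝ))‖ = 1 := by
    rw [mul_comm]; exact Complex.norm_exp_ofReal_mul_I _
  have h4 : Complex.exp (Complex.I ^ 2 * (‖η‖ : ℂ) ^ 2 / (4 * 1)) =
      ((Real.exp (-‖η‖ ^ 2 / 4) : ℝ) : ℂ) := by
    rw [Complex.I_sq]; push_cast; ring_nf
  rw [h3, h4, Complex.norm_real, Real.norm_of_nonneg (Real.exp_pos _).le]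
  have h5 : Real.exp (-(1 / 4) * sqNorm (w - z)) =
      Real.exp (-‖w.1 - z.1‖ ^ 2 / 4) * Real.exp (-‖η‖ ^ 2 / 4) := by
    rw [← Real.exp_add]
    simp only [sqNorm, Prod.fst_sub, Prod.snd_sub]
    rw [hη, norm_sub_rev z.2 w.2]
    ring_nf
  rw [h5]
  ring

lemma enorm_stftFun_atom (d : ℕ) (w z : E d × E d) :
    ‖stftFun (gaussian d) (atom (gaussian d) w.1 w.2) (flipSnd z)‖ₑ =
      reproConst d * reproKernel (w - z) := by
  rw [← ofReal_norm, norm_stftFun_atom, ENNReal.ofReal_mul NNReal.zero_le_coe,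
    ENNReal.ofReal_coe_nnreal, reproKernel]

/-- The reproducing formula. -/
lemma stft_eq_integral {d : ℕ} (f : GSDistribution (1 / 2) d) (w : E d × E d) :
    stft f w = ∫ z, stftFun (gaussian d) (atom (gaussian d) w.1 w.2) (flipSnd z) * stft f z :=
  apply_eq_integral_stft f (gsAtom w)

lemma enorm_stft_le {d : ℕ} (f : GSDistribution (1 / 2) d) (w : E d × E d) :
    ‖stft f w‖ₑ ≤ reproConst d * ∫⁻ z, reproKernel (w - z) * ‖stft f z‖ₑ := by
  rw [stft_eq_integral f w, ← lintegral_const_mul' _ _ ENNReal.coe_ne_top]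
  refine (enorm_integral_le_lintegral_enorm _).trans_eq (lintegral_congr fun z => ?_)
  rw [enorm_mul, enorm_stftFun_atom, mul_assoc]

/-- Jensen's inequality for a weight. -/
lemma lintegral_mul_rpow_le {X : Type*} [MeasurableSpace X] {μ : Measure X} {k G : X → ℝ≥0∞}
    (hk : AEMeasurable k μ) (hG : AEMeasurable G μ) {p : ℝ} (hp : 1 ≤ p) :
    (∫⁻ x, k x * G x ∂μ) ^ p ≤ (∫⁻ x, k x ∂μ) ^ (p - 1) * ∫⁻ x, k x * G x ^ p ∂μ := by
  rcases hp.eq_or_lt with rfl | hp1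
  · simp
  have hp0 : 0 < p := by linarith
  have hpq := Real.HolderConjugate.conjExponent hp1
  set q := p.conjExponent with hq
  have hq0 : 0 < q := hpq.symm.pos
  -- Hölder after splitting the weight as `k = k^{1/p} · k^{1/q}`.
  have h := ENNReal.lintegral_mul_le_Lp_mul_Lq μ hpq (f := fun x => k x ^ (1 / p) * G x)
    (g := fun x => k x ^ (1 / q)) ((hk.pow_const _).mul hG) (hk.pow_const _)
  have h1 : ∀ x, ((fun x => k x ^ (1 / p) * G x) * fun x => k x ^ (1 / q)) x = k x * G x := by
    intro x
    simp only [Pi.mul_apply]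
    rw [mul_right_comm, ← ENNReal.rpow_add_of_nonneg _ _ (by positivity) (by positivity),
      one_div, one_div, hpq.inv_add_inv_eq_one, ENNReal.rpow_one]
  have h2 : ∀ x, (k x ^ (1 / p) * G x) ^ p = k x * G x ^ p := by
    intro x
    rw [ENNReal.mul_rpow_of_nonneg _ _ hp0.le, ← ENNReal.rpow_mul, one_div_mul_cancel hp0.ne',
      ENNReal.rpow_one]
  have h3 : ∀ x, (k x ^ (1 / q)) ^ q = k x := by
    intro x
    rw [← ENNReal.rpow_mul, one_div_mul_cancel hq0.ne', ENNReal.rpow_one]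
  simp only [h1, h2, h3] at h
  calc _ ≤ ((∫⁻ x, k x * G x ^ p ∂μ) ^ (1 / p) * (∫⁻ x, k x ∂μ) ^ (1 / q)) ^ p := by
        gcongr
    _ = _ := by
      rw [ENNReal.mul_rpow_of_nonneg _ _ hp0.le, ← ENNReal.rpow_mul, ← ENNReal.rpow_mul,
        one_div_mul_cancel hp0.ne', ENNReal.rpow_one, mul_comm]
      congr 2
      rw [hq, Real.conjExponent]
      field_simp

/-- With `u = w - w₀` and `v = w - z`, four times the difference of the two sides is `|pu + (1-p)v|²
+ p|v|²`, one phase-space component at a time. It says that the reproducing kernel can carry the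
weight needed for exponents below one. -/
lemma mul_sqNorm_le {d : ℕ} {p : ℝ} (hp : 0 ≤ p) (hp1 : p ≤ 1) (w₀ w z : E d × E d) :
    (1 - p) * (p / 4) * sqNorm (z - w₀) ≤
      (p / 4) * sqNorm (w - w₀) + 1 / 4 * sqNorm (w - z) := by
  have key : ∀ a b c : E d, (1 - p) * p * ‖c - a‖ ^ 2 ≤ p * ‖b - a‖ ^ 2 + ‖b - c‖ ^ 2 := by
    intro a b c
    have h1 : c - a = (b - a) - (b - c) := by abel
    have h2 : 0 ≤ ‖p • (b - a) + (1 - p) • (b - c)‖ ^ 2 := by positivity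
    rw [norm_add_sq_real, norm_smul, norm_smul, real_inner_smul_left, real_inner_smul_right,
      Real.norm_of_nonneg hp, Real.norm_of_nonneg (by linarith)] at h2
    rw [h1, norm_sub_sq_real]
    nlinarith [mul_nonneg hp (sq_nonneg ‖b - c‖)]
  have h1 := key w₀.1 w.1 z.1
  have h2 := key w₀.2 w.2 z.2
  simp only [sqNorm, Prod.fst_sub, Prod.snd_sub]
  linarith

/-- Jensen fails for `p < 1`, so the estimate improves itself. With `N` the supremum of `|F|`
against a Gaussian centred at `w₀`, write `|F| = |F|^p |F|^{1-p}` in the reproducing formula and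
bound the second factor by `N`. This gives `N ≤ N^{1-p} · c ∫ |F|^p`, and `N^{1-p}` is cancelled. -/
lemma enorm_stft_rpow_le_of_le_one {d : ℕ} {p : ℝ} (hp : 0 < p) (hp1 : p ≤ 1)
    (f : GSDistribution (1 / 2) d) (w₀ : E d × E d) :
    ‖stft f w₀‖ₑ ^ p ≤ reproConst d * ∫⁻ z, ‖stft f z‖ₑ ^ p := by
  set e : E d × E d → ℝ≥0∞ := fun z => ENNReal.ofReal (Real.exp (-(p / 4) * sqNorm (z - w₀)))
    with he
  set N : ℝ≥0∞ := ⨆ z, e z * ‖stft f z‖ₑ with hN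
  set I : ℝ≥0∞ := ∫⁻ z, ‖stft f z‖ₑ ^ p with hI
  have hN_top : N ≠ ⊤ := by
    -- Since `|z|² ≤ 2|z - w₀|² + 2|w₀|²`, growth at rate `p/8` is compensated by the weight of rate
    -- `p/4`. Finiteness of `N` is what permits the cancellation at the end.
    obtain ⟨C, hC, hb⟩ := exists_norm_stft_le f (δ := p / 8) (by positivity)
    refine ne_top_of_le_ne_top (ENNReal.ofReal_ne_top
      (r := C * Real.exp (p / 4 * sqNorm w₀))) (iSup_le fun z => ?_)
    rw [← ofReal_norm, he, ← ENNReal.ofReal_mul (Real.exp_pos _).le]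
    apply ENNReal.ofReal_le_ofReal
    calc _ ≤ Real.exp (-(p / 4) * sqNorm (z - w₀)) * (C * Real.exp (p / 8 * sqNorm z)) := by
          gcongr; exact hb z
      _ = C * (Real.exp (-(p / 4) * sqNorm (z - w₀)) * Real.exp (p / 8 * sqNorm z)) := by ring
      _ ≤ _ := by
        rw [← Real.exp_add]
        gcongr
        have key : ∀ a b : E d, ‖a‖ ^ 2 ≤ 2 * ‖a - b‖ ^ 2 + 2 * ‖b‖ ^ 2 := by
          intro a b
          have h1 : ‖a‖ ≤ ‖a - b‖ + ‖b‖ := by simpa using norm_add_le (a - b) b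
          nlinarith [norm_nonneg a, sq_nonneg (‖a - b‖ - ‖b‖)]
        have h1 := key z.1 w₀.1
        have h2 := key z.2 w₀.2
        simp only [sqNorm, Prod.fst_sub, Prod.snd_sub]
        nlinarith
  have hle : ∀ z, ‖stft f z‖ₑ ≤ N * ENNReal.ofReal (Real.exp (p / 4 * sqNorm (z - w₀))) := by
    intro z
    have h1 : e z * ‖stft f z‖ₑ ≤ N := le_iSup (fun z => e z * ‖stft f z‖ₑ) z
    calc ‖stft f z‖ₑ = (e z * ‖stft f z‖ₑ) *
          ENNReal.ofReal (Real.exp (p / 4 * sqNorm (z - w₀))) := by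
          rw [mul_right_comm, he, ← ENNReal.ofReal_mul (Real.exp_pos _).le, ← Real.exp_add]
          simp
      _ ≤ _ := by gcongr
  have hmain : N ≤ N ^ (1 - p) * (reproConst d * I) := by
    refine iSup_le fun w => ?_
    calc e w * ‖stft f w‖ₑ ≤ e w * (reproConst d * ∫⁻ z, reproKernel (w - z) * ‖stft f z‖ₑ) := by
          gcongr; exact enorm_stft_le f w
      _ = reproConst d * ∫⁻ z, e w * (reproKernel (w - z) * ‖stft f z‖ₑ) := by
          rw [lintegral_const_mul' _ _ (by simp [he]), mul_left_comm]
      _ ≤ reproConst d * ∫⁻ z, N ^ (1 - p) * ‖stft f z‖ₑ ^ p := by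
          refine mul_le_mul' le_rfl (lintegral_mono fun z => ?_)
          have h1 : ‖stft f z‖ₑ = ‖stft f z‖ₑ ^ p * ‖stft f z‖ₑ ^ (1 - p) := by
            rw [← ENNReal.rpow_add_of_nonneg _ _ hp.le (by linarith)]
            simp
          have h2 : ‖stft f z‖ₑ ^ (1 - p) ≤ N ^ (1 - p) *
              ENNReal.ofReal (Real.exp ((1 - p) * (p / 4) * sqNorm (z - w₀))) := by
            refine (ENNReal.rpow_le_rpow (hle z) (by linarith)).trans_eq ?_
            rw [ENNReal.mul_rpow_of_nonneg _ _ (by linarith),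
              ENNReal.ofReal_rpow_of_pos (Real.exp_pos _), ← Real.exp_mul]
            ring_nf
          have h3 : e w * reproKernel (w - z) *
              ENNReal.ofReal (Real.exp ((1 - p) * (p / 4) * sqNorm (z - w₀))) ≤ 1 := by
            rw [he, reproKernel, ← ENNReal.ofReal_mul (Real.exp_pos _).le, ← Real.exp_add,
              ← ENNReal.ofReal_mul (Real.exp_pos _).le, ← Real.exp_add, ENNReal.ofReal_le_one]
            apply Real.exp_le_one_iff.mpr
            linarith [mul_sqNorm_le hp.le hp1 w₀ w z]
          calc e w * (reproKernel (w - z) * ‖stft f z‖ₑ)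
              = e w * reproKernel (w - z) * (‖stft f z‖ₑ ^ p * ‖stft f z‖ₑ ^ (1 - p)) := by
                rw [← h1, mul_assoc]
            _ ≤ e w * reproKernel (w - z) * (‖stft f z‖ₑ ^ p * (N ^ (1 - p) *
                ENNReal.ofReal (Real.exp ((1 - p) * (p / 4) * sqNorm (z - w₀))))) := by gcongr
            _ = (e w * reproKernel (w - z) *
                ENNReal.ofReal (Real.exp ((1 - p) * (p / 4) * sqNorm (z - w₀)))) *
                  (N ^ (1 - p) * ‖stft f z‖ₑ ^ p) := by ring
            _ ≤ 1 * (N ^ (1 - p) * ‖stft f z‖ₑ ^ p) := by gcongr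
            _ = _ := one_mul _
      _ = _ := by
        rw [lintegral_const_mul' _ _ (ENNReal.rpow_ne_top_of_nonneg (by linarith) hN_top),
          mul_left_comm]
  have h0 : ‖stft f w₀‖ₑ ≤ N := by
    refine le_trans ?_ (le_iSup (fun z => e z * ‖stft f z‖ₑ) w₀)
    simp [he, sqNorm]
  rcases eq_or_ne N 0 with hN0 | hN0
  · rw [hN0, nonpos_iff_eq_zero] at h0
    rw [h0, ENNReal.zero_rpow_of_pos hp]
    exact zero_le
  refine (ENNReal.rpow_le_rpow h0 hp.le).trans ?_
  have h1 : N ^ p * N ^ (1 - p) ≤ (reproConst d * I) * N ^ (1 - p) := by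
    rw [← ENNReal.rpow_add_of_nonneg _ _ hp.le (by linarith), mul_comm]
    simpa using hmain
  have hr0 : N ^ (1 - p) ≠ 0 := by
    simp [ENNReal.rpow_eq_zero_iff, hN0, hN_top]
  exact (ENNReal.mul_le_mul_iff_left hr0
    (ENNReal.rpow_ne_top_of_nonneg (by linarith) hN_top)).mp h1

lemma enorm_stft_rpow_le_of_one_le {d : ℕ} {p : ℝ} (hp : 1 ≤ p)
    (f : GSDistribution (1 / 2) d) (w : E d × E d) :
    ‖stft f w‖ₑ ^ p ≤ reproConst d ^ p * (∫⁻ z : E d × E d, reproKernel z) ^ (p - 1) *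
      ∫⁻ z, ‖stft f z‖ₑ ^ p := by
  have hp0 : 0 ≤ p := by linarith
  have hk : Continuous fun z : E d × E d => reproKernel (w - z) :=
    continuous_reproKernel.comp (by fun_prop)
  calc ‖stft f w‖ₑ ^ p ≤ (reproConst d * ∫⁻ z, reproKernel (w - z) * ‖stft f z‖ₑ) ^ p := by
        gcongr; exact enorm_stft_le f w
    _ = reproConst d ^ p * (∫⁻ z, reproKernel (w - z) * ‖stft f z‖ₑ) ^ p :=
        ENNReal.mul_rpow_of_nonneg _ _ hp0
    _ ≤ reproConst d ^ p * ((∫⁻ z, reproKernel (w - z)) ^ (p - 1) *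
          ∫⁻ z, reproKernel (w - z) * ‖stft f z‖ₑ ^ p) := by
        gcongr
        exact lintegral_mul_rpow_le hk.measurable.aemeasurable
          (continuous_stft f).measurable.enorm.aemeasurable hp
    _ ≤ reproConst d ^ p * ((∫⁻ z : E d × E d, reproKernel z) ^ (p - 1) *
          ∫⁻ z, 1 * ‖stft f z‖ₑ ^ p) := by
        rw [lintegral_reproKernel_sub]
        gcongr
        exact reproKernel_le_one _
    _ = _ := by simp only [one_mul, mul_assoc]

lemma eLpNorm_ofReal_eq {X : Type*} [MeasurableSpace X] {μ : Measure X} (F : X → ℂ) {p : ℝ}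
    (hp : 0 < p) : eLpNorm F (ENNReal.ofReal p) μ = (∫⁻ x, ‖F x‖ₑ ^ p ∂μ) ^ (1 / p) := by
  rw [eLpNorm_eq_lintegral_rpow_enorm_toReal (by simpa using hp) ENNReal.ofReal_ne_top,
    ENNReal.toReal_ofReal hp.le]

/-- The embedding `M^p ⊆ M^∞`. -/
lemma exists_enorm_stft_le (d : ℕ) {p : ℝ} (hp : 0 < p) :
    ∃ C : ℝ≥0, ∀ (f : GSDistribution (1 / 2) d) (w : E d × E d),
      ‖stft f w‖ₑ ≤ C * modNorm (ENNReal.ofReal p) f := by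
  have key : ∃ C : ℝ≥0∞, C ≠ ⊤ ∧ ∀ (f : GSDistribution (1 / 2) d) (w : E d × E d),
      ‖stft f w‖ₑ ^ p ≤ C * ∫⁻ z, ‖stft f z‖ₑ ^ p := by
    rcases le_total p 1 with h | h
    · exact ⟨reproConst d, ENNReal.coe_ne_top, enorm_stft_rpow_le_of_le_one hp h⟩
    · exact ⟨_, ENNReal.mul_ne_top (ENNReal.rpow_ne_top_of_nonneg hp.le ENNReal.coe_ne_top)
        (ENNReal.rpow_ne_top_of_nonneg (by linarith) (lintegral_reproKernel_lt_top d).ne),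
        enorm_stft_rpow_le_of_one_le h⟩
  obtain ⟨C, hC, h⟩ := key
  refine ⟨(C ^ (1 / p)).toNNReal, fun f w => ?_⟩
  rw [ENNReal.coe_toNNReal (ENNReal.rpow_ne_top_of_nonneg (by positivity) hC), modNorm,
    eLpNorm_ofReal_eq _ hp, ← ENNReal.mul_rpow_of_nonneg _ _ (by positivity)]
  calc ‖stft f w‖ₑ = (‖stft f w‖ₑ ^ p) ^ (1 / p) := by
        rw [← ENNReal.rpow_mul, mul_one_div_cancel hp.ne', ENNReal.rpow_one]
    _ ≤ _ := by gcongr; exact h f w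

/-! ### Inclusions between modulation spaces and the Orlicz modulation space -/

/-- On `(0, 1]` one has `|log t| t^{2-p} ≤ 1/(2-p)`. -/
lemma young_le_rpow {Φ : ℝ≥0∞ → ℝ≥0∞} {t₀ : ℝ}
    (hΦ₀ : ∀ t : ℝ, 0 ≤ t → t ≤ t₀ →
      Φ (ENNReal.ofReal t) = ENNReal.ofReal (-t ^ 2 * Real.log t))
    (ht₀ : 0 < t₀) {p : ℝ} (hp2 : p < 2) {t : ℝ≥0∞}
    (ht : t ≤ ENNReal.ofReal (min t₀ 1)) :
    Φ t ≤ ENNReal.ofReal (1 / (2 - p)) * t ^ p := by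
  lift t to ℝ≥0 using ne_top_of_le_ne_top ENNReal.ofReal_ne_top ht
  rcases eq_or_ne t 0 with rfl | ht0
  · have := hΦ₀ 0 le_rfl ht₀.le
    simp only [ENNReal.ofReal_zero] at this
    simp [this]
  have htp : (0 : ℝ) < t := by positivity
  rw [← ENNReal.ofReal_coe_nnreal, ENNReal.ofReal_le_ofReal_iff'] at ht
  have ht' : (t : ℝ) ≤ min t₀ 1 := ht.resolve_right (by linarith)
  rw [← ENNReal.ofReal_coe_nnreal, hΦ₀ t htp.le (ht'.trans (min_le_left _ _)),
    ENNReal.ofReal_rpow_of_pos htp, ← ENNReal.ofReal_mul (by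
      have : 0 < 2 - p := by linarith
      positivity)]
  apply ENNReal.ofReal_le_ofReal
  have h1 := (Real.abs_log_mul_self_rpow_lt t (2 - p) htp (ht'.trans (min_le_right _ _))
    (by linarith)).le
  have h2 : -(t : ℝ) ^ 2 * Real.log t = -(Real.log t * (t : ℝ) ^ (2 - p)) * (t : ℝ) ^ p := by
    have : (t : ℝ) ^ 2 = (t : ℝ) ^ (2 - p) * (t : ℝ) ^ p := by
      rw [← Real.rpow_add htp]; norm_num
    rw [this]; ring
  rw [h2]
  gcongr
  exact (neg_le_abs _).trans h1

/-- The inclusion `M^p ⊆ M^Φ`. -/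
lemma exists_orliczModNorm_le (d : ℕ) {Φ : ℝ≥0∞ → ℝ≥0∞} {t₀ : ℝ} (ht₀ : 0 < t₀)
    (hΦ₀ : ∀ t : ℝ, 0 ≤ t → t ≤ t₀ →
      Φ (ENNReal.ofReal t) = ENNReal.ofReal (-t ^ 2 * Real.log t))
    {p : ℝ} (hp : 0 < p) (hp2 : p < 2) :
    ∃ C : ℝ≥0, ∀ f ∈ modSpace (ENNReal.ofReal p) d,
      orliczModNorm Φ f ≤ C * modNorm (ENNReal.ofReal p) f := by
  obtain ⟨B, hB⟩ := exists_enorm_stft_le d hp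
  set t₁ : ℝ≥0 := (min t₀ 1).toNNReal with ht₁
  have ht₁p : 0 < t₁ := by rw [ht₁, Real.toNNReal_pos]; positivity
  set D : ℝ≥0 := (1 / (2 - p)).toNNReal with hD
  -- The first summand keeps `|F| / (A N)` below `t₁`, where `Φ` is explicit; the second makes the
  -- integral at most one; the third ensures `A ≠ 0`.
  set A : ℝ≥0 := B / t₁ + D ^ (1 / p) + 1 with hA
  have hA1 : B ≤ t₁ * A := by
    calc B = t₁ * (B / t₁) := by field_simp
      _ ≤ t₁ * A := by gcongr; rw [hA, add_assoc]; exact le_self_add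
  have hA2 : D ≤ A ^ p := by
    calc D = (D ^ (1 / p)) ^ p := by rw [← NNReal.rpow_mul, one_div_mul_cancel hp.ne', NNReal.rpow_one]
      _ ≤ A ^ p := by
        gcongr
        rw [hA, add_right_comm]
        exact le_add_self
  have hA0 : A ≠ 0 := by rw [hA]; positivity
  refine ⟨A, fun f hf => ?_⟩
  set N := modNorm (ENNReal.ofReal p) f with hN
  have hNt : N ≠ ⊤ := (show N < ⊤ from hf).ne
  rcases eq_or_ne N 0 with hN0 | hN0
  · have h0 : ∀ z, ‖stft f z‖ₑ = 0 := fun z => by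
      simpa [← hN, hN0] using hB f z
    rw [hN0, mul_zero]
    -- If `N = 0` then `F` vanishes everywhere, and every `r > 0` is admissible in the infimum.
    refine le_of_forall_gt_imp_ge_of_dense fun r hr => ?_
    rcases eq_or_ne r ⊤ with rfl | hrt
    · exact le_top
    refine sInf_le ⟨hr, hrt.lt_top, ?_⟩
    have hz : Φ 0 = 0 := by simpa using hΦ₀ 0 le_rfl ht₀.le
    simp [h0, hz]
  have hr0 : (A : ℝ≥0∞) * N ≠ 0 := mul_ne_zero (by exact_mod_cast hA0) hN0
  have hrt : (A : ℝ≥0∞) * N ≠ ⊤ := ENNReal.mul_ne_top ENNReal.coe_ne_top hNt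
  refine sInf_le ⟨pos_iff_ne_zero.mpr hr0, hrt.lt_top, ?_⟩
  have hpt : ∀ z, Φ (‖stft f z‖ₑ / (A * N)) ≤ D * (‖stft f z‖ₑ / (A * N)) ^ p := by
    intro z
    refine young_le_rpow hΦ₀ ht₀ hp2 ?_
    refine ENNReal.div_le_of_le_mul ((hB f z).trans ?_)
    calc (B : ℝ≥0∞) * N ≤ (t₁ * A : ℝ≥0) * N := by gcongr
      _ = t₁ * (A * N) := by push_cast; rw [mul_assoc]
  have hNp : ∫⁻ z, ‖stft f z‖ₑ ^ p = N ^ p := by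
    rw [hN, modNorm, eLpNorm_ofReal_eq _ hp, ← ENNReal.rpow_mul, one_div_mul_cancel hp.ne',
      ENNReal.rpow_one]
  calc ∫⁻ z, Φ (‖stft f z‖ₑ / (A * N)) ≤ ∫⁻ z, D * (‖stft f z‖ₑ / (A * N)) ^ p :=
        lintegral_mono hpt
    _ = ∫⁻ z, (D * ((A * N) ^ p)⁻¹) * ‖stft f z‖ₑ ^ p := by
        refine lintegral_congr fun z => ?_
        rw [ENNReal.div_rpow_of_nonneg _ _ hp.le, div_eq_mul_inv]
        ring
    _ = D * ((A * N) ^ p)⁻¹ * N ^ p := by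
        rw [lintegral_const_mul _ ((continuous_stft f).measurable.enorm.pow_const _), hNp]
    _ ≤ (A : ℝ≥0∞) ^ p * ((A * N) ^ p)⁻¹ * N ^ p := by
        gcongr
        rw [← ENNReal.coe_rpow_of_nonneg _ hp.le]
        exact_mod_cast hA2
    _ = (A * N) ^ p * ((A * N) ^ p)⁻¹ := by
        rw [ENNReal.mul_rpow_of_nonneg _ _ hp.le]; ring
    _ = 1 := ENNReal.mul_inv_cancel (by simp [ENNReal.rpow_eq_zero_iff, hr0, hrt])
        (ENNReal.rpow_ne_top_of_nonneg hp.le hrt)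

lemma sq_le_young {Φ : ℝ≥0∞ → ℝ≥0∞} {t₀ : ℝ}
    (hΦ₀ : ∀ t : ℝ, 0 ≤ t → t ≤ t₀ →
      Φ (ENNReal.ofReal t) = ENNReal.ofReal (-t ^ 2 * Real.log t))
    {t : ℝ≥0∞} (ht : t ≤ ENNReal.ofReal (min t₀ (Real.exp (-1)))) :
    t ^ 2 ≤ Φ t := by
  lift t to ℝ≥0 using ne_top_of_le_ne_top ENNReal.ofReal_ne_top ht
  rcases eq_or_ne t 0 with rfl | ht0
  · simp
  have htp : (0 : ℝ) < t := by positivity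
  rw [← ENNReal.ofReal_coe_nnreal, ENNReal.ofReal_le_ofReal_iff'] at ht
  have ht' : (t : ℝ) ≤ min t₀ (Real.exp (-1)) := ht.resolve_right (by linarith)
  rw [← ENNReal.ofReal_coe_nnreal, hΦ₀ t htp.le (ht'.trans (min_le_left _ _)),
    ← ENNReal.ofReal_pow htp.le]
  apply ENNReal.ofReal_le_ofReal
  have h1 : Real.log t ≤ -1 := by
    rw [Real.log_le_iff_le_exp htp]
    exact ht'.trans (min_le_right _ _)
  nlinarith [sq_nonneg (t : ℝ)]

/-- Convexity between `0` and `t` gives `Φ t₁ ≤ (t₁/t) Φ t`. Combined with `t₁² ≤ Φ t₁`, it bounds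
`Φ` below by a linear function beyond `t₁`. -/
lemma IsYoung.le_mul {Φ : ℝ≥0∞ → ℝ≥0∞} (hΦ : IsYoung Φ) {t₁ : ℝ≥0} (ht₁ : 0 < t₁)
    (h : (t₁ : ℝ≥0∞) ^ 2 ≤ Φ t₁) {t : ℝ≥0∞} (ht : t₁ ≤ t) :
    t ≤ (t₁⁻¹ : ℝ≥0) * Φ t := by
  rcases eq_or_ne t ⊤ with rfl | htt
  · rw [hΦ.map_top, ENNReal.mul_top (by simpa using ht₁.ne')]
  lift t to ℝ≥0 using htt
  have ht' : t₁ ≤ t := by exact_mod_cast ht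
  have htp : 0 < t := ht₁.trans_le ht'
  have hs : t₁ / t + (1 - t₁ / t) = 1 :=
    add_tsub_cancel_of_le (by rw [div_le_one htp]; exact ht')
  have h1 := hΦ.convex (t₁ / t) (1 - t₁ / t) hs t 0
  have h2 : ((t₁ / t : ℝ≥0) : ℝ≥0∞) * t + ((1 - t₁ / t : ℝ≥0) : ℝ≥0∞) * 0 = t₁ := by
    rw [mul_zero, add_zero, ← ENNReal.coe_mul, div_mul_cancel₀ _ htp.ne']
  rw [h2, hΦ.map_zero, mul_zero, add_zero] at h1
  have h3 := h.trans h1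
  calc (t : ℝ≥0∞) = ((t / t₁ * t₁⁻¹ : ℝ≥0) : ℝ≥0∞) * (t₁ : ℝ≥0∞) ^ 2 := by
        rw [← ENNReal.coe_pow, ← ENNReal.coe_mul]
        congr 1
        field_simp
    _ ≤ ((t / t₁ * t₁⁻¹ : ℝ≥0) : ℝ≥0∞) * (((t₁ / t : ℝ≥0) : ℝ≥0∞) * Φ t) := by gcongr
    _ = _ := by
        rw [← mul_assoc, ← ENNReal.coe_mul]
        congr 2
        field_simp

lemma modNorm_two_eq {d : ℕ} (f : GSDistribution (1 / 2) d) :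
    modNorm 2 f = (∫⁻ z, ‖stft f z‖ₑ ^ 2) ^ (1 / 2 : ℝ) := by
  have := eLpNorm_ofReal_eq (μ := volume) (stft f) (p := 2) two_pos
  rw [ENNReal.ofReal_ofNat] at this
  rw [modNorm, this]
  simp

/-- The inclusion `M^Φ ⊆ M²`. -/
lemma exists_modNorm_two_le (d : ℕ) {Φ : ℝ≥0∞ → ℝ≥0∞} (hΦ : IsYoung Φ) {t₀ : ℝ} (ht₀ : 0 < t₀)
    (hΦ₀ : ∀ t : ℝ, 0 ≤ t → t ≤ t₀ →
      Φ (ENNReal.ofReal t) = ENNReal.ofReal (-t ^ 2 * Real.log t)) :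
    ∃ C : ℝ≥0, ∀ f : GSDistribution (1 / 2) d, modNorm 2 f ≤ C * orliczModNorm Φ f := by
  set t₁ : ℝ≥0 := (min t₀ (Real.exp (-1))).toNNReal with ht₁
  have ht₁p : 0 < t₁ := by rw [ht₁, Real.toNNReal_pos]; positivity
  have hsmall : ∀ t : ℝ≥0∞, t ≤ t₁ → t ^ 2 ≤ Φ t := fun t ht => sq_le_young hΦ₀ ht
  have hlarge : ∀ t : ℝ≥0∞, t₁ ≤ t → t ≤ (t₁⁻¹ : ℝ≥0) * Φ t := fun t ht =>
    hΦ.le_mul ht₁p (hsmall _ le_rfl) ht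
  set K : ℝ≥0 := (∫⁻ z : E d × E d, reproKernel z).toNNReal with hK
  have hKc : ∫⁻ z : E d × E d, reproKernel z = K :=
    (ENNReal.coe_toNNReal (lintegral_reproKernel_lt_top d).ne).symm
  set M : ℝ≥0 := reproConst d * (t₁ * K + t₁⁻¹) with hM
  refine ⟨(1 + M * t₁⁻¹) ^ (1 / 2 : ℝ) , fun f => ?_⟩
  have hC0 : (1 + M * t₁⁻¹) ^ (1 / 2 : ℝ) ≠ 0 := by positivity
  -- With the constant moved to the left, the right side is a bare infimum, and a single admissible
  -- `r` can be treated.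
  rw [mul_comm, ← ENNReal.div_le_iff_le_mul (Or.inl (by exact_mod_cast hC0)) (Or.inl ENNReal.coe_ne_top)]
  refine le_sInf fun r ⟨hr0, hrt, hr⟩ => ?_
  rw [ENNReal.div_le_iff_le_mul (Or.inl (by exact_mod_cast hC0)) (Or.inl ENNReal.coe_ne_top),
    mul_comm]
  set G : E d × E d → ℝ≥0∞ := fun z => ‖stft f z‖ₑ / r with hG
  -- A linear lower bound on `Φ` does not control squares of large values, so `G` is bounded first.
  -- In the reproducing formula, values below `t₁` contribute at most `t₁ K`, and larger ones at
  -- most `t₁⁻¹ ∫ Φ(G) ≤ t₁⁻¹`.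
  have hGle : ∀ w, G w ≤ M := by
    intro w
    have hkc : Continuous fun z : E d × E d => reproKernel (w - z) :=
      continuous_reproKernel.comp (by fun_prop)
    have hGt : ∀ z, G z ≤ t₁ + (t₁⁻¹ : ℝ≥0) * Φ (G z) := by
      intro z
      rcases le_total (G z) t₁ with h | h
      · exact h.trans le_self_add
      · exact (hlarge _ h).trans le_add_self
    calc G w ≤ (reproConst d * ∫⁻ z, reproKernel (w - z) * ‖stft f z‖ₑ) / r := by
          simp only [hG]; gcongr; exact enorm_stft_le f w
      _ = reproConst d * ∫⁻ z, reproKernel (w - z) * G z := by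
          simp only [hG, div_eq_mul_inv, ← mul_assoc]
          rw [lintegral_mul_const' _ _ (ENNReal.inv_ne_top.mpr hr0.ne'), mul_assoc]
      _ ≤ reproConst d * ∫⁻ z, (t₁ * reproKernel (w - z) + (t₁⁻¹ : ℝ≥0) * Φ (G z)) := by
          refine mul_le_mul' le_rfl (lintegral_mono fun z => ?_)
          calc reproKernel (w - z) * G z
              ≤ reproKernel (w - z) * (t₁ + (t₁⁻¹ : ℝ≥0) * Φ (G z)) := by gcongr; exact hGt z
            _ = t₁ * reproKernel (w - z) +
                reproKernel (w - z) * ((t₁⁻¹ : ℝ≥0) * Φ (G z)) := by ring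
            _ ≤ t₁ * reproKernel (w - z) + 1 * ((t₁⁻¹ : ℝ≥0) * Φ (G z)) := by
                gcongr; exact reproKernel_le_one _
            _ = _ := by rw [one_mul]
      _ = reproConst d * (t₁ * K + (t₁⁻¹ : ℝ≥0) * ∫⁻ z, Φ (G z)) := by
          rw [lintegral_add_left (hkc.measurable.const_mul _),
            lintegral_const_mul' _ _ ENNReal.coe_ne_top, lintegral_reproKernel_sub, hKc,
            lintegral_const_mul' _ _ ENNReal.coe_ne_top]
      _ ≤ reproConst d * (t₁ * K + (t₁⁻¹ : ℝ≥0) * 1) := by gcongr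
      _ = M := by rw [hM]; push_cast; rw [mul_one]
  have hsq : ∀ z, G z ^ 2 ≤ (1 + M * t₁⁻¹ : ℝ≥0) * Φ (G z) := by
    intro z
    rcases le_total (G z) t₁ with h | h
    · refine (hsmall _ h).trans (le_mul_of_one_le_left' ?_)
      exact_mod_cast le_self_add
    · calc G z ^ 2 = G z * G z := sq _
        _ ≤ M * ((t₁⁻¹ : ℝ≥0) * Φ (G z)) := mul_le_mul' (hGle z) (hlarge _ h)
        _ = (M * t₁⁻¹ : ℝ≥0) * Φ (G z) := by push_cast; rw [mul_assoc]
        _ ≤ _ := by gcongr; exact le_add_self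
  have hint : ∫⁻ z, ‖stft f z‖ₑ ^ 2 ≤ (1 + M * t₁⁻¹ : ℝ≥0) * r ^ 2 := by
    calc ∫⁻ z, ‖stft f z‖ₑ ^ 2 = ∫⁻ z, G z ^ 2 * r ^ 2 := by
          refine lintegral_congr fun z => ?_
          rw [← mul_pow, hG, ENNReal.div_mul_cancel hr0.ne' hrt.ne]
      _ = (∫⁻ z, G z ^ 2) * r ^ 2 := lintegral_mul_const' _ _ (ENNReal.pow_ne_top hrt.ne)
      _ ≤ (∫⁻ z, (1 + M * t₁⁻¹ : ℝ≥0) * Φ (G z)) * r ^ 2 := by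
          gcongr with z; exact hsq z
      _ ≤ (1 + M * t₁⁻¹ : ℝ≥0) * 1 * r ^ 2 := by
          rw [lintegral_const_mul' _ _ ENNReal.coe_ne_top]
          gcongr
      _ = _ := by rw [mul_one]
  rw [modNorm_two_eq]
  calc _ ≤ ((1 + M * t₁⁻¹ : ℝ≥0) * r ^ 2) ^ (1 / 2 : ℝ) := by gcongr
    _ = _ := by
      rw [ENNReal.mul_rpow_of_nonneg _ _ (by norm_num),
        ENNReal.coe_rpow_of_nonneg _ (by norm_num), ← ENNReal.rpow_natCast, ← ENNReal.rpow_mul]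
      norm_num

/-! ### Young's inequality and synthesis of distributions -/

/-- Young's inequality `L¹ * L^p ⊆ L^p`: Jensen with weight `U` in the inner integral, then Tonelli
and translation invariance. -/
lemma lintegral_lintegral_mul_add_rpow_le {d : ℕ} {U G : E d × E d → ℝ≥0∞} (hU : Measurable U)
    (hG : Measurable G) {p : ℝ} (hp : 1 ≤ p) :
    ∫⁻ w, (∫⁻ z, U z * G (w + z)) ^ p ≤ (∫⁻ z, U z) ^ p * ∫⁻ z, G z ^ p := by
  have hp0 : 0 ≤ p := by linarith
  have hG2 : Measurable fun q : (E d × E d) × (E d × E d) => U q.2 * G (q.1 + q.2) ^ p :=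
    (hU.comp measurable_snd).mul ((hG.comp (measurable_fst.add measurable_snd)).pow_const _)
  calc ∫⁻ w, (∫⁻ z, U z * G (w + z)) ^ p
      ≤ ∫⁻ w, (∫⁻ z, U z) ^ (p - 1) * ∫⁻ z, U z * G (w + z) ^ p :=
        lintegral_mono fun w => lintegral_mul_rpow_le hU.aemeasurable
          (hG.comp (measurable_const_add w)).aemeasurable hp
    _ = (∫⁻ z, U z) ^ (p - 1) * ∫⁻ w, ∫⁻ z, U z * G (w + z) ^ p :=
        lintegral_const_mul _ hG2.lintegral_prod_right'
    _ = (∫⁻ z, U z) ^ (p - 1) * ∫⁻ z, ∫⁻ w, U z * G (w + z) ^ p := by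
        rw [lintegral_lintegral_swap hG2.aemeasurable]
    _ = (∫⁻ z, U z) ^ (p - 1) * ∫⁻ z, U z * ∫⁻ w, G w ^ p := by
        congr 1
        refine lintegral_congr fun z => ?_
        have h1 : Measurable fun w => G (w + z) ^ p :=
          (hG.comp (measurable_add_const z)).pow_const _
        rw [lintegral_const_mul _ h1,
          lintegral_add_right_eq_self (fun w => G w ^ p) z]
    _ = (∫⁻ z, U z) ^ (p - 1) * ((∫⁻ z, U z) ^ (1 : ℝ) * ∫⁻ z, G z ^ p) := by
        rw [lintegral_mul_const _ hU, ENNReal.rpow_one]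
    _ = _ := by
        rw [← mul_assoc, ← ENNReal.rpow_add_of_nonneg _ _ (by linarith) zero_le_one,
          sub_add_cancel]

lemma lintegral_reproKernel_mul_rpow_le {d : ℕ} {G : E d × E d → ℝ≥0∞}
    (hG : Measurable G) {p : ℝ} (hp : 1 ≤ p) :
    ∫⁻ w, (∫⁻ z, reproKernel (w - z) * G z) ^ p ≤
      (∫⁻ z : E d × E d, reproKernel z) ^ p * ∫⁻ z, G z ^ p := by
  refine le_trans (le_of_eq (lintegral_congr fun w => ?_))
    (lintegral_lintegral_mul_add_rpow_le continuous_reproKernel.measurable hG hp)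
  rw [← lintegral_add_left_eq_self _ w]
  congr 2
  funext z
  rw [reproKernel_sub_comm, add_sub_cancel_left]

lemma stftFun_gaussian_add {d : ℕ} (ψ χ : GelfandShilov (1 / 2) d) (z : E d × E d) :
    stftFun (gaussian d) ((ψ + χ : GelfandShilov (1 / 2) d) : E d → ℂ) z =
      stftFun (gaussian d) (ψ : E d → ℂ) z + stftFun (gaussian d) (χ : E d → ℂ) z := by
  obtain ⟨_, _, B₁, _, h₁⟩ := exists_seminormLE ψ
  obtain ⟨_, _, B₂, _, h₂⟩ := exists_seminormLE χ
  simp only [stftFun_gaussian_eq]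
  rw [← mul_add, ← integral_add
    (integrable_mul_gaussTensor (continuous_gelfandShilov ψ) h₁.norm_le z)
    (integrable_mul_gaussTensor (continuous_gelfandShilov χ) h₂.norm_le z)]
  simp [add_mul]

lemma stftFun_smul {d : ℕ} (φ : E d → ℂ) (c : ℂ) (ψ : E d → ℂ) (z : E d × E d) :
    stftFun φ (c • ψ) z = c * stftFun φ ψ z := by
  simp only [stftFun, Pi.smul_apply, smul_eq_mul, mul_assoc]
  exact integral_const_mul _ _

lemma norm_stftFun_gaussian_le {d : ℕ} {B : ℝ} {ψ : E d → ℂ} (hB : ∀ y, ‖ψ y‖ ≤ B)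
    (z : E d × E d) : ‖stftFun (gaussian d) ψ z‖ ≤
      atomConst d * (B * ∫ y : E d, Real.exp (-‖y‖ ^ 2 / 2)) := by
  rw [stftFun_gaussian_eq, norm_mul, Complex.norm_real,
    Real.norm_of_nonneg (atomConst_pos d).le]
  have := atomConst_pos d
  gcongr
  exact norm_integral_mul_gaussTensor_le hB z

lemma integrable_stftFun_mul {d : ℕ} {h : E d × E d → ℂ} (hh : Integrable h)
    (ψ : GelfandShilov (1 / 2) d) :
    Integrable fun z => stftFun (gaussian d) (ψ : E d → ℂ) (flipSnd z) * h z := by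
  obtain ⟨_, _, B, _, hB⟩ := exists_seminormLE ψ
  exact hh.bdd_mul ((continuous_stftFun_gelfandShilov ψ).comp
    continuous_flipSnd).aestronglyMeasurable
    (ae_of_all _ fun z => norm_stftFun_gaussian_le hB.norm_le _)

/-- The distribution synthesised from an integrable function on phase space. -/
def synthesis {d : ℕ} (h : E d × E d → ℂ) (hh : Integrable h) : GSDistribution (1 / 2) d :=
  ⟨{ toFun := fun ψ => ∫ z, stftFun (gaussian d) (ψ : E d → ℂ) (flipSnd z) * h z
     map_add' := fun ψ χ => by
      rw [← integral_add (integrable_stftFun_mul hh ψ) (integrable_stftFun_mul hh χ)]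
      simp only [stftFun_gaussian_add, add_mul]
     map_smul' := fun c ψ => by
      rw [RingHom.id_apply, smul_eq_mul, ← integral_const_mul]
      simp only [Submodule.coe_smul, stftFun_smul, mul_assoc] },
   fun _ _ => ⟨atomConst d * (∫ y : E d, Real.exp (-‖y‖ ^ 2 / 2)) * ∫ z, ‖h z‖, by
      have := atomConst_pos d
      have : 0 ≤ ∫ y : E d, Real.exp (-‖y‖ ^ 2 / 2) := integral_nonneg fun _ => (Real.exp_pos _).le
      have : 0 ≤ ∫ z, ‖h z‖ := integral_nonneg fun _ => norm_nonneg _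
      positivity, fun ψ B _ hψ => by
      have h1 := norm_integral_le_of_norm_le
        (f := fun z => stftFun (gaussian d) (ψ : E d → ℂ) (flipSnd z) * h z)
        (hh.norm.const_mul (atomConst d * (B * ∫ y : E d, Real.exp (-‖y‖ ^ 2 / 2))))
        (ae_of_all _ fun z => by
          rw [norm_mul]
          gcongr
          exact norm_stftFun_gaussian_le hψ.norm_le _)
      rw [integral_const_mul] at h1
      refine h1.trans_eq ?_
      ring⟩⟩

lemma stft_synthesis {d : ℕ} (h : E d × E d → ℂ) (hh : Integrable h) (w : E d × E d) :
    stft (synthesis h hh) w =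
      ∫ z, stftFun (gaussian d) (atom (gaussian d) w.1 w.2) (flipSnd z) * h z := rfl

lemma eLpNorm_two_eq {X : Type*} [MeasurableSpace X] {μ : Measure X} (F : X → ℂ) :
    eLpNorm F 2 μ = (∫⁻ x, ‖F x‖ₑ ^ (2 : ℝ) ∂μ) ^ (1 / 2 : ℝ) := by
  rw [← eLpNorm_ofReal_eq F two_pos, ENNReal.ofReal_ofNat]

lemma modNorm_one_eq {d : ℕ} (f : GSDistribution (1 / 2) d) :
    modNorm 1 f = ∫⁻ z, ‖stft f z‖ₑ := eLpNorm_one_eq_lintegral_enorm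

/-- The transform of the synthesised distribution is the reproducing integral of `h`, dominated by a
Gaussian convolved with `|h|`. -/
lemma synthesis_mem_modSpace_one {d : ℕ} (h : E d × E d → ℂ) (hc : Continuous h)
    (hh : Integrable h) : synthesis h hh ∈ modSpace 1 d := by
  change modNorm 1 _ < ⊤
  rw [modNorm_one_eq]
  have h1 : ∀ w, ‖stft (synthesis h hh) w‖ₑ ≤
      reproConst d * (∫⁻ z, reproKernel (w - z) * ‖h z‖ₑ) ^ (1 : ℝ) := by
    intro w
    rw [stft_synthesis, ENNReal.rpow_one, ← lintegral_const_mul' _ _ ENNReal.coe_ne_top]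
    refine (enorm_integral_le_lintegral_enorm _).trans_eq (lintegral_congr fun z => ?_)
    rw [enorm_mul, enorm_stftFun_atom, mul_assoc]
  refine (lintegral_mono h1).trans_lt ?_
  rw [lintegral_const_mul' _ _ ENNReal.coe_ne_top]
  refine ENNReal.mul_lt_top ENNReal.coe_lt_top
    ((lintegral_reproKernel_mul_rpow_le hc.measurable.enorm le_rfl).trans_lt ?_)
  simp only [ENNReal.rpow_one]
  exact ENNReal.mul_lt_top (lintegral_reproKernel_lt_top d) hh.2

/-- By the reproducing formula, `f` behaves like the synthesis of its own transform. The transform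
of the difference is therefore the reproducing integral of `stft f - h`, to which Young's inequality
in `L²` applies. -/
lemma modNorm_two_sub_synthesis_le {d : ℕ} (f : GSDistribution (1 / 2) d)
    (h : E d × E d → ℂ) (hc : Continuous h) (hh : Integrable h) :
    modNorm 2 (f - synthesis h hh) ≤
      reproConst d * (∫⁻ z : E d × E d, reproKernel z) * eLpNorm (stft f - h) 2 := by
  have h1 : ∀ w, ‖stft (f - synthesis h hh) w‖ₑ ≤
      reproConst d * ∫⁻ z, reproKernel (w - z) * ‖(stft f - h) z‖ₑ := by
    intro w
    have h2 : stft (f - synthesis h hh) w =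
        ∫ z, stftFun (gaussian d) (atom (gaussian d) w.1 w.2) (flipSnd z) * (stft f - h) z := by
      have h3 : stft (f - synthesis h hh) w = stft f w - stft (synthesis h hh) w := rfl
      rw [h3, stft_eq_integral f w, stft_synthesis]
      refine (integral_sub (integrable_stftFun_mul_stft f (gsAtom w))
        (integrable_stftFun_mul hh (gsAtom w))).symm.trans ?_
      exact integral_congr_ae (ae_of_all _ fun z => (mul_sub _ _ _).symm)
    rw [h2, ← lintegral_const_mul' _ _ ENNReal.coe_ne_top]
    refine (enorm_integral_le_lintegral_enorm _).trans_eq (lintegral_congr fun z => ?_)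
    rw [enorm_mul, enorm_stftFun_atom, mul_assoc]
  have hm : Measurable fun z => ‖(stft f - h) z‖ₑ := ((continuous_stft f).sub hc).measurable.enorm
  rw [modNorm, eLpNorm_two_eq, eLpNorm_two_eq]
  calc _ ≤ (∫⁻ w, (reproConst d * ∫⁻ z, reproKernel (w - z) * ‖(stft f - h) z‖ₑ) ^ (2 : ℝ)) ^
        (1 / 2 : ℝ) := by
        gcongr with w
        exact h1 w
    _ = (reproConst d ^ (2 : ℝ) * ∫⁻ w, (∫⁻ z, reproKernel (w - z) * ‖(stft f - h) z‖ₑ) ^ (2 : ℝ)) ^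
        (1 / 2 : ℝ) := by
        congr 1
        rw [← lintegral_const_mul' _ _ (ENNReal.rpow_ne_top_of_nonneg (by norm_num)
          ENNReal.coe_ne_top)]
        exact lintegral_congr fun w => ENNReal.mul_rpow_of_nonneg _ _ (by norm_num)
    _ ≤ (reproConst d ^ (2 : ℝ) * ((∫⁻ z : E d × E d, reproKernel z) ^ (2 : ℝ) *
          ∫⁻ z, ‖(stft f - h) z‖ₑ ^ (2 : ℝ))) ^ (1 / 2 : ℝ) := by
        gcongr
        exact lintegral_reproKernel_mul_rpow_le hm (by norm_num)
    _ = _ := by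
        rw [ENNReal.mul_rpow_of_nonneg _ _ (by norm_num), ENNReal.mul_rpow_of_nonneg _ _
          (by norm_num), ← ENNReal.rpow_mul, ← ENNReal.rpow_mul, mul_assoc]
        norm_num

/-- `M¹` is dense in `M²`. -/
lemma exists_modSpace_one_modNorm_two_sub_lt {d : ℕ} {f : GSDistribution (1 / 2) d}
    (hf : f ∈ modSpace 2 d) {ε : ℝ≥0∞} (hε : 0 < ε) :
    ∃ g ∈ modSpace 1 d, modNorm 2 (f - g) < ε := by
  obtain ⟨A, hA⟩ : ∃ A : ℝ≥0∞, A = reproConst d * (∫⁻ z : E d × E d, reproKernel z) := ⟨_, rfl⟩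
  have hAt : A ≠ ⊤ := hA ▸ ENNReal.mul_ne_top ENNReal.coe_ne_top (lintegral_reproKernel_lt_top d).ne
  obtain ⟨e, he0, het, heε⟩ : ∃ e : ℝ≥0∞, e ≠ 0 ∧ e ≠ ⊤ ∧ e ≤ ε :=
    ⟨min ε 1, (lt_min hε one_pos).ne', ne_top_of_le_ne_top ENNReal.one_ne_top (min_le_right _ _),
      min_le_left _ _⟩
  have hmem : MemLp (stft f) 2 := ⟨(continuous_stft f).aestronglyMeasurable, hf⟩
  have hA1 : A + 1 ≠ ⊤ := ENNReal.add_ne_top.mpr ⟨hAt, ENNReal.one_ne_top⟩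
  -- Dividing by `A + 1` avoids a separate case `A = 0`; the half leaves room for the strict
  -- inequality, and `e` replaces a possibly infinite `ε`.
  obtain ⟨h, hsupp, hle, hc, -⟩ := hmem.exists_hasCompactSupport_eLpNorm_sub_le
    (by norm_num) (ε := e / 2 / (A + 1)) (ENNReal.div_pos (by simpa using he0) hA1).ne'
  have hi : Integrable h := hc.integrable_of_hasCompactSupport hsupp
  refine ⟨synthesis h hi, synthesis_mem_modSpace_one h hc hi, ?_⟩
  have h1 := modNorm_two_sub_synthesis_le f h hc hi
  rw [← hA] at h1
  have h2 : A * eLpNorm (stft f - h) 2 ≤ (A + 1) * (e / 2 / (A + 1)) :=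
    mul_le_mul' le_self_add hle
  rw [ENNReal.mul_div_cancel (by simp) hA1] at h2
  exact ((h1.trans h2).trans_lt (ENNReal.half_lt_self he0 het)).trans_le heε

/-! ### Continuity of the `L^p` norm in the exponent -/

/-- Dominated convergence: for `p₀ ≤ p ≤ 2`, `|G|^p` is at most `|G|^p₀` where `|G| ≤ 1` and at most
`|G|²` elsewhere. -/
lemma tendsto_eLpNorm_of_lt_two {X : Type*} [MeasurableSpace X] {μ : Measure X} {G : X → ℂ}
    (hG : AEStronglyMeasurable G μ) {p₀ : ℝ} (hp₀ : 1 ≤ p₀) (hp₀2 : p₀ < 2)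
    (h₀ : eLpNorm G (ENNReal.ofReal p₀) μ < ⊤) (h₂ : eLpNorm G 2 μ < ⊤) :
    Tendsto (fun p : ℝ => eLpNorm G (ENNReal.ofReal p) μ) (𝓝[<] 2) (𝓝 (eLpNorm G 2 μ)) := by
  have hp₀0 : 0 < p₀ := by linarith
  rw [eLpNorm_ofReal_eq G hp₀0, ENNReal.rpow_lt_top_iff_of_pos (by positivity)] at h₀
  rw [eLpNorm_two_eq] at h₂ ⊢
  rw [ENNReal.rpow_lt_top_iff_of_pos (by positivity)] at h₂
  have hle : ∀ p : ℝ, p₀ ≤ p → p ≤ 2 → ∀ x, ‖G x‖ₑ ^ p ≤ ‖G x‖ₑ ^ p₀ + ‖G x‖ₑ ^ (2 : ℝ) := by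
    intro p h1 h2 x
    rcases le_total ‖G x‖ₑ 1 with h | h
    · exact (ENNReal.rpow_le_rpow_of_exponent_ge h h1).trans le_self_add
    · exact (ENNReal.rpow_le_rpow_of_exponent_le h h2).trans le_add_self
  have hnear : ∀ᶠ p : ℝ in 𝓝[<] 2, p₀ ≤ p ∧ p ≤ 2 := by
    filter_upwards [Ioo_mem_nhdsLT hp₀2] with p hp
    exact ⟨hp.1.le, hp.2.le⟩
  have hlim : Tendsto (fun p : ℝ => ∫⁻ x, ‖G x‖ₑ ^ p ∂μ) (𝓝[<] 2)
      (𝓝 (∫⁻ x, ‖G x‖ₑ ^ (2 : ℝ) ∂μ)) := by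
    refine tendsto_lintegral_filter_of_dominated_convergence'
      (fun x => ‖G x‖ₑ ^ p₀ + ‖G x‖ₑ ^ (2 : ℝ)) (Eventually.of_forall fun p => hG.enorm.pow_const _)
      ?_ ?_ ?_
    · filter_upwards [hnear] with p hp
      exact ae_of_all _ (hle p hp.1 hp.2)
    · rw [lintegral_add_left' (hG.enorm.pow_const _)]
      exact (ENNReal.add_lt_top.mpr ⟨h₀, h₂⟩).ne
    · refine ae_of_all _ fun x => ?_
      have h1 : Tendsto (fun p : ℝ => ENNReal.ofReal (‖G x‖ ^ p)) (𝓝[<] 2)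
          (𝓝 (ENNReal.ofReal (‖G x‖ ^ (2 : ℝ)))) := by
        refine ENNReal.tendsto_ofReal ((Tendsto.mono_left ?_ nhdsWithin_le_nhds))
        exact (Real.continuousAt_rpow (‖G x‖, (2 : ℝ)) (Or.inr two_pos)).tendsto.comp
          (tendsto_const_nhds.prodMk_nhds tendsto_id)
      rw [← ofReal_norm, ENNReal.ofReal_rpow_of_nonneg (norm_nonneg _) (by norm_num)]
      refine h1.congr' ?_
      filter_upwards [hnear] with p hp
      rw [ENNReal.ofReal_rpow_of_nonneg (norm_nonneg _) (by linarith)]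
  have hfin : ∀ p : ℝ, p₀ ≤ p → p ≤ 2 → ∫⁻ x, ‖G x‖ₑ ^ p ∂μ ≠ ⊤ := by
    intro p h1 h2
    refine ((lintegral_mono (hle p h1 h2)).trans_lt ?_).ne
    rw [lintegral_add_left' (hG.enorm.pow_const _)]
    exact ENNReal.add_lt_top.mpr ⟨h₀, h₂⟩
  have hlim' := (ENNReal.tendsto_toReal h₂.ne).comp hlim
  have hinv : Tendsto (fun p : ℝ => 1 / p) (𝓝[<] 2) (𝓝 (1 / 2)) :=
    (tendsto_const_nhds.div tendsto_id two_ne_zero).mono_left nhdsWithin_le_nhds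
  -- Both base and exponent vary. Joint continuity of the real power holds at positive exponents
  -- even when the base is zero.
  have h3 := (Real.continuousAt_rpow ((∫⁻ x, ‖G x‖ₑ ^ (2 : ℝ) ∂μ).toReal, (1 / 2 : ℝ))
    (Or.inr (by norm_num))).tendsto.comp (hlim'.prodMk_nhds hinv)
  have h4 := ENNReal.tendsto_ofReal h3
  rw [← ENNReal.ofReal_rpow_of_nonneg ENNReal.toReal_nonneg (by norm_num),
    ENNReal.ofReal_toReal h₂.ne] at h4
  refine h4.congr' ?_
  filter_upwards [hnear] with p hp
  have hp0 : 0 < p := by linarith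
  simp only [Function.comp_apply]
  rw [eLpNorm_ofReal_eq G hp0, ← ENNReal.ofReal_rpow_of_nonneg ENNReal.toReal_nonneg
    (by positivity), ENNReal.ofReal_toReal (hfin p hp.1 hp.2)]

/-! ### Distributions in `M²` are functions in `L²` -/

lemma conj_gaussTensor_zero {d : ℕ} (z : E d × E d) (y : E d) :
    conj (gaussTensor z 0 y) = gaussTensor (flipSnd z) 0 y := by
  obtain ⟨x, ξ⟩ := z
  rw [flipSnd, gaussTensor_zero_eq, gaussTensor_zero_eq, map_mul, Complex.conj_ofReal,
    ← Complex.exp_conj]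
  simp [inner_neg_right]

lemma flipSnd_flipSnd {d : ℕ} (z : E d × E d) : flipSnd (flipSnd z) = z := by simp [flipSnd]

lemma conj_stftFun_gaussian {d : ℕ} (g : E d → ℂ) (z : E d × E d) :
    stftFun (gaussian d) (fun y => conj (g y)) z = conj (stftFun (gaussian d) g (flipSnd z)) := by
  rw [stftFun_gaussian_eq, stftFun_gaussian_eq, map_mul, Complex.conj_ofReal, ← integral_conj]
  simp only [map_mul, conj_gaussTensor_zero, flipSnd_flipSnd]

/-- The short-time Fourier transform is an isometry on `S_{1/2}`. -/
lemma lintegral_stftFun_sq_eq {d : ℕ} (ψ : GelfandShilov (1 / 2) d) :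
    ∫⁻ z, ‖stftFun (gaussian d) (ψ : E d → ℂ) (flipSnd z)‖ₑ ^ (2 : ℝ) =
      ∫⁻ y, ‖(ψ : E d → ℂ) y‖ₑ ^ (2 : ℝ) := by
  have hψi := integrable_gelfandShilov ψ
  have hi : Integrable fun y => conj ((ψ : E d → ℂ) y) :=
    hψi.mono (Complex.continuous_conj.comp (continuous_gelfandShilov ψ)).aestronglyMeasurable
      (ae_of_all _ fun y => by simp)
  set V : E d × E d → ℂ := fun z => stftFun (gaussian d) (ψ : E d → ℂ) (flipSnd z) with hV
  -- The isometry is the pairing formula for the distribution `conj ψ` tested on `ψ`: both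
  -- integrands become squared moduli.
  have hs : ∀ z, stft (distOfIntegrable _ hi) z = conj (V z) := fun z => by
    rw [stft_distOfIntegrable, conj_stftFun_gaussian]
  have e1 : ∀ y, conj ((ψ : E d → ℂ) y) * (ψ : E d → ℂ) y = ((‖(ψ : E d → ℂ) y‖ ^ 2 : ℝ) : ℂ) :=
    fun y => by rw [Complex.conj_mul']; push_cast; rfl
  have e2 : ∀ z, V z * stft (distOfIntegrable _ hi) z = ((‖V z‖ ^ 2 : ℝ) : ℂ) :=
    fun z => by rw [hs, Complex.mul_conj']; push_cast; rfl
  have i1 : Integrable fun y => ‖(ψ : E d → ℂ) y‖ ^ 2 := by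
    have := (integrable_mul_gelfandShilov hi ψ).norm
    refine this.congr (ae_of_all _ fun y => ?_)
    simp only [e1, Complex.norm_real]
    exact Real.norm_of_nonneg (by positivity)
  have i2 : Integrable fun z => ‖V z‖ ^ 2 := by
    have := (integrable_stftFun_mul_stft (distOfIntegrable _ hi) ψ).norm
    refine this.congr (ae_of_all _ fun z => ?_)
    change ‖V z * stft (distOfIntegrable _ hi) z‖ = _
    rw [e2, Complex.norm_real]
    exact Real.norm_of_nonneg (by positivity)
  have h1 := apply_eq_integral_stft (distOfIntegrable _ hi) ψ
  rw [distOfIntegrable_apply] at h1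
  change _ = ∫ z, V z * stft (distOfIntegrable _ hi) z at h1
  simp_rw [e1, e2] at h1
  rw [integral_complex_ofReal, integral_complex_ofReal, Complex.ofReal_inj] at h1
  have h2 := congrArg ENNReal.ofReal h1
  rw [ofReal_integral_eq_lintegral_ofReal i1 (ae_of_all _ fun _ => by positivity),
    ofReal_integral_eq_lintegral_ofReal i2 (ae_of_all _ fun _ => by positivity)] at h2
  have e3 : ∀ a : ℂ, ‖a‖ₑ ^ (2 : ℝ) = ENNReal.ofReal (‖a‖ ^ 2) := fun a => by
    rw [← ofReal_norm, ENNReal.ofReal_rpow_of_nonneg (norm_nonneg _) (by norm_num)]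
    norm_num
  simp_rw [e3]
  exact h2.symm

lemma memLp_gelfandShilov {d : ℕ} (ψ : GelfandShilov (1 / 2) d) :
    MemLp (ψ : E d → ℂ) 2 := by
  obtain ⟨_, _, B, _, hB⟩ := exists_seminormLE ψ
  have hc := continuous_gelfandShilov ψ
  rw [memLp_two_iff_integrable_sq_norm hc.aestronglyMeasurable]
  refine ((integrable_gelfandShilov ψ).norm.const_mul B).mono'
    (hc.norm.pow 2).aestronglyMeasurable (ae_of_all _ fun y => ?_)
  rw [Real.norm_of_nonneg (by positivity), sq]
  gcongr
  exact hB.norm_le y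

/-- Cauchy-Schwarz in the pairing formula, followed by the isometry on test functions. -/
lemma enorm_apply_le {d : ℕ} (f : GSDistribution (1 / 2) d) (ψ : GelfandShilov (1 / 2) d) :
    ‖(f : GelfandShilov (1 / 2) d →ₗ[ℂ] ℂ) ψ‖ₑ ≤ modNorm 2 f * eLpNorm (ψ : E d → ℂ) 2 := by
  rw [apply_eq_integral_stft, modNorm, eLpNorm_two_eq, eLpNorm_two_eq,
    ← lintegral_stftFun_sq_eq ψ, mul_comm]
  refine (enorm_integral_le_lintegral_enorm _).trans ?_
  simp only [enorm_mul]
  exact ENNReal.lintegral_mul_le_Lp_mul_Lq volume Real.HolderConjugate.two_two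
    ((continuous_stftFun_gelfandShilov ψ).comp continuous_flipSnd).measurable.enorm.aemeasurable
    (continuous_stft f).measurable.enorm.aemeasurable

/-- A distribution in `M²` is given by a function in `L²`. -/
theorem exists_isL2Function {d : ℕ} {f : GSDistribution (1 / 2) d} (hf : f ∈ modSpace 2 d) :
    ∃ g, IsL2Function f g := by
  set R : Lp ℂ 2 (volume : Measure (E d)) → GelfandShilov (1 / 2) d → Prop := fun v ψ =>
    v =ᵐ[volume] (ψ : E d → ℂ) with hR
  have radd : ∀ v w ψ χ, R v ψ → R w χ → R (v + w) (ψ + χ) := by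
    intro v w ψ χ hv hw
    filter_upwards [Lp.coeFn_add v w, hv, hw] with y h1 h2 h3
    rw [h1, Pi.add_apply, h2, h3]; rfl
  have rsmul : ∀ (c : ℂ) v ψ, R v ψ → R (c • v) (c • ψ) := by
    intro c v ψ hv
    filter_upwards [Lp.coeFn_smul c v, hv] with y h1 h2
    rw [h1, Pi.smul_apply, h2]; rfl
  have runi : ∀ v ψ χ, R v ψ → R v χ → ψ = χ := by
    intro v ψ χ h1 h2
    apply Subtype.ext
    exact ((continuous_gelfandShilov ψ).ae_eq_iff_eq volume (continuous_gelfandShilov χ)).mp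
      (h1.symm.trans h2)
  let p : Submodule ℂ (Lp ℂ 2 (volume : Measure (E d))) :=
    { carrier := {v | ∃ ψ, R v ψ}
      zero_mem' := ⟨0, Lp.coeFn_zero _ _ _⟩
      add_mem' := by
        rintro v w ⟨ψ, hψ⟩ ⟨χ, hχ⟩
        exact ⟨_, radd _ _ _ _ hψ hχ⟩
      smul_mem' := by
        rintro c v ⟨ψ, hψ⟩
        exact ⟨_, rsmul _ _ _ hψ⟩ }
  let T₀ : p →ₗ[ℂ] ℂ :=
    { toFun := fun v => (f : GelfandShilov (1 / 2) d →ₗ[ℂ] ℂ) v.2.choose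
      map_add' := by
        intro v w
        rw [← map_add]
        congr 1
        exact runi _ _ _ (v + w).2.choose_spec (radd _ _ _ _ v.2.choose_spec w.2.choose_spec)
      map_smul' := by
        intro c v
        rw [RingHom.id_apply, ← map_smul]
        congr 1
        exact runi _ _ _ (c • v).2.choose_spec (rsmul _ _ _ v.2.choose_spec) }
  have hN : modNorm 2 f ≠ ⊤ := (show modNorm 2 f < ⊤ from hf).ne
  have hT₀ : ∀ v, ‖T₀ v‖ ≤ (modNorm 2 f).toReal * ‖v‖ := by
    intro v
    have h1 := enorm_apply_le f v.2.choose
    rw [← eLpNorm_congr_ae v.2.choose_spec] at h1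
    have h2 := ENNReal.toReal_mono (ENNReal.mul_ne_top hN (Lp.eLpNorm_ne_top _)) h1
    rw [ENNReal.toReal_mul, toReal_enorm] at h2
    exact h2
  -- Hahn-Banach extends the functional to all of `L²`, so density of `S_{1/2}` in `L²` is not
  -- needed.
  obtain ⟨T, hT, -⟩ := exists_extension_norm_eq p
    (T₀.mkContinuous (modNorm 2 f).toReal hT₀)
  set g₀ := (InnerProductSpace.toDual ℂ (Lp ℂ 2 (volume : Measure (E d)))).symm T with hg₀
  -- The pairing is bilinear while the inner product is conjugate linear in its first entry, hence
  -- the conjugate of the Riesz representative.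
  refine ⟨fun y => conj (g₀ y), (Lp.memLp g₀).star, fun ψ => ?_⟩
  have hψ := memLp_gelfandShilov ψ
  have hp : hψ.toLp _ ∈ p := ⟨ψ, hψ.coeFn_toLp⟩
  have h1 : T (hψ.toLp _) = (f : GelfandShilov (1 / 2) d →ₗ[ℂ] ℂ) ψ := by
    rw [show T (hψ.toLp _) = T₀ ⟨_, hp⟩ from hT ⟨_, hp⟩]
    exact congrArg _ (runi _ _ _ (Exists.choose_spec hp) hψ.coeFn_toLp)
  have h2 : inner ℂ g₀ (hψ.toLp _) = T (hψ.toLp _) := InnerProductSpace.toDual_symm_apply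
  rw [← h1, ← h2, L2.inner_def]
  refine integral_congr_ae ?_
  filter_upwards [hψ.coeFn_toLp] with y hy
  rw [hy, RCLike.inner_apply, mul_comm]

/-! ### Windows in `M¹` -/

/-- A smooth compactly supported test function is the Fourier transform of a Schwartz function, so
the transform can be moved over to `k`. -/
lemma ae_eq_zero_of_fourier_eq_zero {d : ℕ} {k : E d → ℂ} (hk : Integrable k)
    (h : ∀ η, FourierTransform.fourier k η = 0) : ∀ᵐ y, k y = 0 := by
  refine ae_eq_zero_of_integral_contDiff_smul_eq_zero hk.locallyIntegrable fun g hg hgc => ?_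
  have hg₁ : HasCompactSupport (Complex.ofRealCLM ∘ g) := hgc.comp_left rfl
  have hg₂ : ContDiff ℝ ∞ (Complex.ofRealCLM ∘ g) := by fun_prop
  set s : SchwartzMap (E d) ℂ :=
    FourierTransformInv.fourierInv (hg₁.toSchwartzMap hg₂) with hs
  have h1 := VectorFourier.integral_fourierIntegral_smul_eq_flip (μ := volume) (ν := volume)
    (L := innerₗ (E d)) Real.continuous_fourierChar
    (by exact continuous_inner) s.integrable hk
  have h2 : ∀ x, VectorFourier.fourierIntegral Real.fourierChar volume (innerₗ (E d)) s x =
      ((g x : ℝ) : ℂ) := by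
    intro x
    have h3 : FourierTransform.fourier s = hg₁.toSchwartzMap hg₂ :=
      FourierTransform.fourier_fourierInv_eq _
    have h4 := congrArg (fun f : SchwartzMap (E d) ℂ => f x) h3
    simp only [SchwartzMap.fourier_coe] at h4
    exact h4
  have h3 : ∀ x, VectorFourier.fourierIntegral Real.fourierChar volume (innerₗ (E d)).flip k x =
      0 := by
    intro x
    rw [flip_innerₗ]
    exact h x
  simp_rw [h2, h3, smul_zero, integral_zero] at h1
  simpa using h1

lemma continuous_gaussTensor_zero {d : ℕ} {X : Type*} [TopologicalSpace X]
    {a : X → E d × E d} {b : X → E d} (ha : Continuous a) (hb : Continuous b) :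
    Continuous fun q => gaussTensor (a q) 0 (b q) := by
  have h : (fun q => gaussTensor (a q) 0 (b q)) = fun q =>
      ((Real.exp (-‖b q - (a q).1‖ ^ 2 / 2) : ℝ) : ℂ) *
        Complex.exp (-Complex.I * (inner ℝ (b q) (a q).2 : ℝ)) := by
    funext q
    exact gaussTensor_zero_eq (a q).1 (a q).2 (b q)
  rw [h]
  have h1 : Continuous fun q => Real.exp (-‖b q - (a q).1‖ ^ 2 / 2) := by
    fun_prop
  have h2 : Continuous fun q => (inner ℝ (b q) (a q).2 : ℝ) :=
    hb.inner (continuous_snd.comp ha)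
  exact (Complex.continuous_ofReal.comp h1).mul (Complex.continuous_exp.comp
    (continuous_const.mul (Complex.continuous_ofReal.comp h2)))

lemma norm_gaussTensor_zero_le_one {d : ℕ} (z : E d × E d) (y : E d) :
    ‖gaussTensor z 0 y‖ ≤ 1 := by
  rw [norm_gaussTensor_zero]
  apply Real.exp_le_one_iff.mpr
  nlinarith [sq_nonneg ‖y - z.1‖]

/-- The function `∫ U(z) conj(φ_z) dz` synthesised from a function on phase space. -/
def synthesisFun {d : ℕ} (U : E d × E d → ℂ) (y : E d) : ℂ :=
  ∫ z, U z * ((atomConst d : ℂ) * gaussTensor (flipSnd z) 0 y)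

lemma norm_synthesisFun_le {d : ℕ} {U : E d × E d → ℂ} (hU : Integrable U) (y : E d) :
    ‖synthesisFun U y‖ ≤ atomConst d * ∫ z, ‖U z‖ := by
  rw [← integral_const_mul]
  have hc := atomConst_pos d
  refine norm_integral_le_of_norm_le (hU.norm.const_mul _) (ae_of_all _ fun z => ?_)
  rw [norm_mul, norm_mul, Complex.norm_real, Real.norm_of_nonneg hc.le]
  calc _ ≤ ‖U z‖ * (atomConst d * 1) := by
        gcongr; exact norm_gaussTensor_zero_le_one _ _
    _ = _ := by ring

lemma aestronglyMeasurable_synthesisFun {d : ℕ} {U : E d × E d → ℂ} (hU : Continuous U) :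
    AEStronglyMeasurable (synthesisFun U) := by
  have h1 : Continuous fun q : E d × (E d × E d) =>
      U q.2 * ((atomConst d : ℂ) * gaussTensor (flipSnd q.2) 0 q.1) := by
    refine (hU.comp continuous_snd).mul (continuous_const.mul ?_)
    exact continuous_gaussTensor_zero (continuous_flipSnd.comp continuous_snd) continuous_fst
  exact (h1.stronglyMeasurable.integral_prod_right (ν := volume)).aestronglyMeasurable

lemma integral_synthesisFun_mul {d : ℕ} {U : E d × E d → ℂ} (hUc : Continuous U)
    (hU : Integrable U) (ψ : GelfandShilov (1 / 2) d) :
    ∫ y, synthesisFun U y * (ψ : E d → ℂ) y =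
      ∫ z, stftFun (gaussian d) (ψ : E d → ℂ) (flipSnd z) * U z := by
  have hc := atomConst_pos d
  have hψ := integrable_gelfandShilov ψ
  have hint : Integrable (Function.uncurry fun (y : E d) (z : E d × E d) =>
      U z * ((atomConst d : ℂ) * gaussTensor (flipSnd z) 0 y) * (ψ : E d → ℂ) y)
      (volume.prod volume) := by
    refine ((hψ.norm.mul_prod hU.norm).const_mul (atomConst d)).mono' ?_ (ae_of_all _ fun q => ?_)
    · refine Continuous.aestronglyMeasurable ?_
      refine ((hUc.comp continuous_snd).mul (continuous_const.mul ?_)).mul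
        ((continuous_gelfandShilov ψ).comp continuous_fst)
      exact continuous_gaussTensor_zero (continuous_flipSnd.comp continuous_snd) continuous_fst
    · simp only [Function.uncurry]
      rw [norm_mul, norm_mul, norm_mul, Complex.norm_real, Real.norm_of_nonneg hc.le]
      calc _ ≤ ‖U q.2‖ * (atomConst d * 1) * ‖(ψ : E d → ℂ) q.1‖ := by
            gcongr; exact norm_gaussTensor_zero_le_one _ _
        _ = _ := by ring
  simp only [synthesisFun, ← integral_mul_const]
  rw [integral_integral_swap hint]
  refine integral_congr_ae (ae_of_all _ fun z => ?_)
  simp only [stftFun_gaussian_eq]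
  rw [← integral_const_mul, ← integral_mul_const]
  refine integral_congr_ae (ae_of_all _ fun y => ?_)
  ring

/-- The unnormalised atom at `(x, ξ)` as an element of `S_{1/2}`. -/
def gsGaussTensor {d : ℕ} (z : E d × E d) : GelfandShilov (1 / 2) d :=
  ⟨gaussTensor z 0, tensor_gauss_mem z.1 z.2⟩

lemma integrable_stft_of_mem {d : ℕ} {u : GSDistribution (1 / 2) d}
    (hu : u ∈ modSpace 1 d) : Integrable (stft u) := by
  rw [← memLp_one_iff_integrable]
  exact ⟨(continuous_stft u).aestronglyMeasurable, hu⟩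

/-- An `L²` function in `M¹` is recovered from its short-time Fourier transform. -/
lemma ae_eq_synthesisFun {d : ℕ} {u : GSDistribution (1 / 2) d} (hu : u ∈ modSpace 1 d)
    {φ : E d → ℂ} (hφ : IsL2Function u φ) : φ =ᵐ[volume] synthesisFun (stft u) := by
  have hU := integrable_stft_of_mem hu
  have hm := aestronglyMeasurable_synthesisFun (continuous_stft u)
  have hi1 : ∀ ψ : GelfandShilov (1 / 2) d, Integrable fun y => φ y * (ψ : E d → ℂ) y :=
    fun ψ => hφ.1.integrable_mul (memLp_gelfandShilov ψ)
  have hi2 : ∀ ψ : GelfandShilov (1 / 2) d,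
      Integrable fun y => synthesisFun (stft u) y * (ψ : E d → ℂ) y :=
    fun ψ => (integrable_gelfandShilov ψ).bdd_mul hm (ae_of_all _ (norm_synthesisFun_le hU))
  -- The Gaussian makes the difference integrable without changing its zeros. The Fourier transform
  -- of `k` at `η` is the pairing with the atom at `(0, 2πη)`, where the two functions agree by the
  -- pairing formula.
  set k : E d → ℂ := fun y => (φ y - synthesisFun (stft u) y) * gaussTensor (0, 0) 0 y with hk
  have hki : Integrable k := by
    refine ((hi1 (gsGaussTensor (0, 0))).sub (hi2 (gsGaussTensor (0, 0)))).congr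
      (ae_of_all _ fun y => ?_)
    simp only [hk, gsGaussTensor, Pi.sub_apply]
    ring
  have hF : ∀ η, FourierTransform.fourier k η = 0 := by
    intro η
    set ψ : GelfandShilov (1 / 2) d := gsGaussTensor (0, (2 * Real.pi) • η) with hψ
    have h1 : FourierTransform.fourier k η =
        ∫ y, (φ y * (ψ : E d → ℂ) y - synthesisFun (stft u) y * (ψ : E d → ℂ) y) := by
      rw [Real.fourier_eq']
      refine integral_congr_ae (ae_of_all _ fun y => ?_)
      simp only [hk, hψ, gsGaussTensor, gaussTensor_zero_eq, smul_eq_mul, inner_smul_right,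
        inner_zero_right]
      push_cast
      rw [mul_zero, Complex.exp_zero]
      ring_nf
    rw [h1, integral_sub (hi1 ψ) (hi2 ψ), ← hφ.2 ψ,
      integral_synthesisFun_mul (continuous_stft u) hU, ← apply_eq_integral_stft, sub_self]
  filter_upwards [ae_eq_zero_of_fourier_eq_zero hki hF] with y hy
  have h0 : gaussTensor ((0, 0) : E d × E d) 0 y ≠ 0 := by
    rw [← norm_pos_iff, norm_gaussTensor_zero]
    exact Real.exp_pos _
  exact sub_eq_zero.mp ((mul_eq_zero.mp hy).resolve_right h0)

lemma eLpNorm_gaussTensor_zero {d : ℕ} (z : E d × E d) :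
    eLpNorm (gaussTensor z 0) 2 = eLpNorm (gaussTensor ((0, 0) : E d × E d) 0) 2 := by
  rw [eLpNorm_two_eq, eLpNorm_two_eq]
  congr 1
  have h : ∀ (z : E d × E d) y, ‖gaussTensor z 0 y‖ₑ =
      ENNReal.ofReal (Real.exp (-‖y - z.1‖ ^ 2 / 2)) := fun z y => by
    rw [← ofReal_norm, norm_gaussTensor_zero]
  simp_rw [h, sub_zero]
  exact lintegral_sub_right_eq_self
    (fun y : E d => ENNReal.ofReal (Real.exp (-‖y‖ ^ 2 / 2)) ^ (2 : ℝ)) z.1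

lemma conj_synthesisFun {d : ℕ} (U : E d × E d → ℂ) (y : E d) :
    conj (synthesisFun U y) =
      ∫ z, conj (U z) * ((atomConst d : ℂ) * gaussTensor z 0 y) := by
  rw [synthesisFun, ← integral_conj]
  refine integral_congr_ae (ae_of_all _ fun z => ?_)
  simp only [map_mul, conj_gaussTensor_zero, flipSnd_flipSnd, Complex.conj_ofReal]

/-- Covariance of the atoms under time-frequency shifts; through it the change of window becomes a
convolution up to unimodular phases. -/
lemma gaussTensor_shift {d : ℕ} (w z : E d × E d) (y : E d) :
    gaussTensor z 0 (y - w.1) * Complex.exp (-Complex.I * (inner ℝ y w.2 : ℝ)) =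
      Complex.exp (Complex.I * (inner ℝ w.1 z.2 : ℝ)) * gaussTensor (w + z) 0 y := by
  obtain ⟨x, ξ⟩ := w
  obtain ⟨x', ξ'⟩ := z
  rw [Prod.mk_add_mk, gaussTensor_zero_eq, gaussTensor_zero_eq, mul_assoc, ← Complex.exp_add,
    mul_left_comm, ← Complex.exp_add]
  congr 2
  · rw [sub_sub]
  · simp only [inner_sub_left, inner_add_right]
    push_cast
    ring

/-- Change of window. -/
lemma stftFun_eq_integral {d : ℕ} {u f : GSDistribution (1 / 2) d} (hu : u ∈ modSpace 1 d)
    {φ g : E d → ℂ} (hφ : IsL2Function u φ) (hg : IsL2Function f g) (w : E d × E d) :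
    stftFun φ g w = ∫ z, (((2 * Real.pi) ^ (-(d : ℝ) / 2) : ℝ) : ℂ) *
      (conj (stft u z) * Complex.exp (Complex.I * (inner ℝ w.1 z.2 : ℝ))) * stft f (w + z) := by
  have hU := integrable_stft_of_mem hu
  have hUc := continuous_stft u
  set κ : ℂ := (((2 * Real.pi) ^ (-(d : ℝ) / 2) : ℝ) : ℂ) with hκ
  set e : E d × E d → ℂ := fun z => Complex.exp (Complex.I * (inner ℝ w.1 z.2 : ℝ)) with he
  have hen : ∀ z, ‖e z‖ = 1 := fun z => by
    simp only [he]; rw [mul_comm]; exact Complex.norm_exp_ofReal_mul_I _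
  have hec : Continuous e := by
    have h2 : Continuous fun z : E d × E d => (inner ℝ w.1 z.2 : ℝ) :=
      continuous_const.inner continuous_snd
    exact Complex.continuous_exp.comp
      (continuous_const.mul (Complex.continuous_ofReal.comp h2))
  have hae : ∀ᵐ y, φ (y - w.1) = synthesisFun (stft u) (y - w.1) :=
    (measurePreserving_sub_right volume w.1).quasiMeasurePreserving.ae
      (ae_eq_synthesisFun hu hφ)
  have h1 : stftFun φ g w = ∫ y, ∫ z, κ * (conj (stft u z) * e z) *
      ((atomConst d : ℂ) * (g y * gaussTensor (w + z) 0 y)) := by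
    refine integral_congr_ae ?_
    filter_upwards [hae] with y hy
    rw [atom, hy, conj_synthesisFun, ← hκ, ← integral_const_mul, ← integral_mul_const,
      ← integral_const_mul]
    refine integral_congr_ae (ae_of_all _ fun z => ?_)
    have h2 := gaussTensor_shift w z y
    simp only [he]
    linear_combination (g y * κ * conj (stft u z) * (atomConst d : ℂ)) * h2
  have hint : Integrable (Function.uncurry fun (y : E d) (z : E d × E d) =>
      κ * (conj (stft u z) * e z) * ((atomConst d : ℂ) * (g y * gaussTensor (w + z) 0 y)))
      (volume.prod volume) := by
    have hT : Continuous fun q : E d × (E d × E d) => gaussTensor (w + q.2) 0 q.1 :=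
      continuous_gaussTensor_zero (continuous_const.add continuous_snd) continuous_fst
    have hmeas : AEStronglyMeasurable (fun q : E d × (E d × E d) =>
        κ * (conj (stft u q.2) * e q.2) *
          ((atomConst d : ℂ) * (g q.1 * gaussTensor (w + q.2) 0 q.1)))
        (volume.prod volume) := by
      have hc1 : Continuous fun q : E d × (E d × E d) => κ * (conj (stft u q.2) * e q.2) :=
        continuous_const.mul ((Complex.continuous_conj.comp (hUc.comp continuous_snd)).mul
          (hec.comp continuous_snd))
      exact hc1.aestronglyMeasurable.mul (aestronglyMeasurable_const.mul
        (hg.1.1.comp_fst.mul hT.aestronglyMeasurable))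
    refine ⟨hmeas, ?_⟩
    rw [hasFiniteIntegral_iff_enorm]
    refine (lintegral_prod_symm _ hmeas.enorm).trans_lt ?_
    dsimp only
    -- For Fubini: by Cauchy-Schwarz the integral in `y` is at most `|stft u z|` times a constant,
    -- because the `L²` norm of an atom does not depend on its position. The remaining factor is
    -- integrable since `u` is in `M¹`.
    have hbound : ∀ z : E d × E d, ∫⁻ y, ‖Function.uncurry (fun (y : E d) (z : E d × E d) =>
        κ * (conj (stft u z) * e z) * ((atomConst d : ℂ) * (g y * gaussTensor (w + z) 0 y)))
          (y, z)‖ₑ ≤ ‖stft u z‖ₑ * (‖κ‖ₑ * ‖(atomConst d : ℂ)‖ₑ *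
            (eLpNorm g 2 * eLpNorm (gaussTensor ((0, 0) : E d × E d) 0) 2)) := by
      intro z
      have hez : ‖e z‖ₑ = 1 := by rw [← ofReal_norm, hen, ENNReal.ofReal_one]
      have hst : ‖conj (stft u z)‖ₑ = ‖stft u z‖ₑ := by
        rw [← ofReal_norm, ← ofReal_norm, RCLike.norm_conj]
      simp only [Function.uncurry, enorm_mul, hez, hst, mul_one]
      rw [lintegral_const_mul' _ _ (by finiteness), lintegral_const_mul' _ _ (by finiteness),
        ← eLpNorm_gaussTensor_zero (w + z), eLpNorm_two_eq g, eLpNorm_two_eq (gaussTensor _ _)]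
      calc _ ≤ ‖κ‖ₑ * ‖stft u z‖ₑ * (‖(atomConst d : ℂ)‖ₑ *
            ((∫⁻ x, ‖g x‖ₑ ^ (2 : ℝ)) ^ (1 / 2 : ℝ) *
              (∫⁻ x, ‖gaussTensor (w + z) 0 x‖ₑ ^ (2 : ℝ)) ^ (1 / 2 : ℝ))) := by
            gcongr
            exact ENNReal.lintegral_mul_le_Lp_mul_Lq volume Real.HolderConjugate.two_two
              hg.1.1.enorm (contDiff_gaussTensor _ _).continuous.measurable.enorm.aemeasurable
        _ = _ := by ring
    refine (lintegral_mono hbound).trans_lt ?_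
    have h2 := (memLp_gelfandShilov (gsGaussTensor ((0, 0) : E d × E d))).2
    have h3 := hg.1.2
    have hfin : ‖κ‖ₑ * ‖(atomConst d : ℂ)‖ₑ *
        (eLpNorm g 2 * eLpNorm (gaussTensor ((0, 0) : E d × E d) 0) 2) < ⊤ :=
      ENNReal.mul_lt_top (ENNReal.mul_lt_top enorm_lt_top enorm_lt_top)
        (ENNReal.mul_lt_top h3 h2)
    rw [lintegral_mul_const' _ _ hfin.ne]
    exact ENNReal.mul_lt_top hU.2 hfin
  rw [h1, integral_integral_swap hint]
  refine integral_congr_ae (ae_of_all _ fun z => ?_)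
  simp only
  rw [integral_const_mul, integral_const_mul, ← stftFun_gaussian_eq]
  congr 1
  rw [stft_eq, hg.2]
  rfl

lemma aestronglyMeasurable_stftFun {d : ℕ} {u f : GSDistribution (1 / 2) d}
    (hu : u ∈ modSpace 1 d) {φ g : E d → ℂ} (hφ : IsL2Function u φ) (hg : IsL2Function f g) :
    AEStronglyMeasurable (stftFun φ g) := by
  rw [funext (stftFun_eq_integral hu hφ hg)]
  have h1 : Continuous fun q : (E d × E d) × (E d × E d) => (inner ℝ q.1.1 q.2.2 : ℝ) :=
    (continuous_fst.comp continuous_fst).inner (continuous_snd.comp continuous_snd)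
  have h2 : Continuous fun q : (E d × E d) × (E d × E d) =>
      (((2 * Real.pi) ^ (-(d : ℝ) / 2) : ℝ) : ℂ) * (conj (stft u q.2) *
        Complex.exp (Complex.I * (inner ℝ q.1.1 q.2.2 : ℝ))) * stft f (q.1 + q.2) := by
    refine (continuous_const.mul ((Complex.continuous_conj.comp
      ((continuous_stft u).comp continuous_snd)).mul (Complex.continuous_exp.comp
      (continuous_const.mul (Complex.continuous_ofReal.comp h1))))).mul ?_
    exact (continuous_stft f).comp (continuous_fst.add continuous_snd)
  exact (h2.stronglyMeasurable.integral_prod_right (ν := volume)).aestronglyMeasurable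

/-- The change of window bounds `|V_φ g|` by a correlation of `|stft u|` in `L¹` with `|stft f|` in
`L^p`, and Young's inequality applies. -/
lemma eLpNorm_stftFun_lt_top {d : ℕ} {u f : GSDistribution (1 / 2) d}
    (hu : u ∈ modSpace 1 d) {φ g : E d → ℂ} (hφ : IsL2Function u φ) (hg : IsL2Function f g)
    {p : ℝ} (hp : 1 ≤ p) (hf : f ∈ modSpace (ENNReal.ofReal p) d) :
    eLpNorm (stftFun φ g) (ENNReal.ofReal p) < ⊤ := by
  have hp0 : 0 < p := by linarith
  have hU := integrable_stft_of_mem hu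
  have hf' : eLpNorm (stft f) (ENNReal.ofReal p) < ⊤ := hf
  rw [eLpNorm_ofReal_eq _ hp0, ENNReal.rpow_lt_top_iff_of_pos (by positivity)] at hf' ⊢
  set κ : ℂ := (((2 * Real.pi) ^ (-(d : ℝ) / 2) : ℝ) : ℂ) with hκ
  have h1 : ∀ w, ‖stftFun φ g w‖ₑ ≤ ‖κ‖ₑ * ∫⁻ z, ‖stft u z‖ₑ * ‖stft f (w + z)‖ₑ := by
    intro w
    rw [stftFun_eq_integral hu hφ hg w, ← lintegral_const_mul' _ _ (by finiteness)]
    refine (enorm_integral_le_lintegral_enorm _).trans_eq (lintegral_congr fun z => ?_)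
    have he : ‖Complex.exp (Complex.I * (inner ℝ w.1 z.2 : ℝ))‖ₑ = 1 := by
      rw [← ofReal_norm, mul_comm, Complex.norm_exp_ofReal_mul_I, ENNReal.ofReal_one]
    have hst : ‖conj (stft u z)‖ₑ = ‖stft u z‖ₑ := by
      rw [← ofReal_norm, ← ofReal_norm, RCLike.norm_conj]
    rw [enorm_mul, enorm_mul, enorm_mul, he, hst, mul_one, mul_assoc]
  calc ∫⁻ w, ‖stftFun φ g w‖ₑ ^ p
      ≤ ∫⁻ w, ‖κ‖ₑ ^ p * (∫⁻ z, ‖stft u z‖ₑ * ‖stft f (w + z)‖ₑ) ^ p := by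
        refine lintegral_mono fun w => ?_
        rw [← ENNReal.mul_rpow_of_nonneg _ _ hp0.le]
        exact ENNReal.rpow_le_rpow (h1 w) hp0.le
    _ = ‖κ‖ₑ ^ p * ∫⁻ w, (∫⁻ z, ‖stft u z‖ₑ * ‖stft f (w + z)‖ₑ) ^ p :=
        lintegral_const_mul' _ _ (ENNReal.rpow_ne_top_of_nonneg hp0.le enorm_ne_top)
    _ ≤ ‖κ‖ₑ ^ p * ((∫⁻ z, ‖stft u z‖ₑ) ^ p * ∫⁻ z, ‖stft f z‖ₑ ^ p) := by
        gcongr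
        exact lintegral_lintegral_mul_add_rpow_le (continuous_stft u).measurable.enorm
          (continuous_stft f).measurable.enorm hp
    _ < ⊤ := ENNReal.mul_lt_top (ENNReal.rpow_lt_top_of_nonneg hp0.le enorm_ne_top)
        (ENNReal.mul_lt_top (ENNReal.rpow_lt_top_of_nonneg hp0.le hU.2.ne) hf')

end OrliczMod

end

/-! ### Inclusions, density and the limit of the norms -/

theorem mainTheorem5 (d : ℕ) (Φ : ℝ≥0∞ → ℝ≥0∞) (hΦ : OrliczMod.IsYoung Φ)
    (t₀ : ℝ) (ht₀ : 0 < t₀)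
    (hΦ₀ : ∀ t : ℝ, 0 ≤ t → t ≤ t₀ →
      Φ (ENNReal.ofReal t) = ENNReal.ofReal (-t ^ 2 * Real.log t)) :
    -- `M^p ⊆ M^Φ` with continuous inclusion, for `0 < p < 2`
    (∀ p : ℝ, 0 < p → p < 2 →
      OrliczMod.modSpace (ENNReal.ofReal p) d ⊆ OrliczMod.orliczModSpace Φ d ∧
      ∃ C : ℝ≥0, ∀ f ∈ OrliczMod.modSpace (ENNReal.ofReal p) d,
        OrliczMod.orliczModNorm Φ f ≤ C * OrliczMod.modNorm (ENNReal.ofReal p) f) ∧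
    -- `M^Φ ⊆ M²` with continuous inclusion
    (OrliczMod.orliczModSpace Φ d ⊆ OrliczMod.modSpace 2 d ∧
      ∃ C : ℝ≥0, ∀ f ∈ OrliczMod.orliczModSpace Φ d,
        OrliczMod.modNorm 2 f ≤ C * OrliczMod.orliczModNorm Φ f) ∧
    -- `M^Φ` is dense in `M²`
    (∀ f ∈ OrliczMod.modSpace 2 d, ∀ ε : ℝ≥0∞, 0 < ε →
      ∃ g ∈ OrliczMod.orliczModSpace Φ d, OrliczMod.modNorm 2 (f - g) < ε) ∧
    -- convergence of the norms as `p → 2-`, for the Gaussian window, and for every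
    -- window in `M¹ \ {0}`
    (∀ p₀ : ℝ, 1 ≤ p₀ → p₀ < 2 → ∀ f ∈ OrliczMod.modSpace (ENNReal.ofReal p₀) d,
      Tendsto (fun p : ℝ => OrliczMod.modNorm (ENNReal.ofReal p) f) (𝓝[<] 2)
        (𝓝 (OrliczMod.modNorm 2 f)) ∧
      ∃ g : OrliczMod.E d → ℂ, OrliczMod.IsL2Function f g ∧
        ∀ u ∈ OrliczMod.modSpace 1 d, u ≠ 0 →
          ∀ φ : OrliczMod.E d → ℂ, OrliczMod.IsL2Function u φ →
            Tendsto (fun p : ℝ => eLpNorm (OrliczMod.stftFun φ g) (ENNReal.ofReal p) volume)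
              (𝓝[<] 2) (𝓝 (eLpNorm (OrliczMod.stftFun φ g) 2 volume))) := by
  have h1 : ∀ p : ℝ, 0 < p → p < 2 →
      OrliczMod.modSpace (ENNReal.ofReal p) d ⊆ OrliczMod.orliczModSpace Φ d ∧
      ∃ C : ℝ≥0, ∀ f ∈ OrliczMod.modSpace (ENNReal.ofReal p) d,
        OrliczMod.orliczModNorm Φ f ≤ C * OrliczMod.modNorm (ENNReal.ofReal p) f := by
    intro p hp hp2
    obtain ⟨C, hC⟩ := OrliczMod.exists_orliczModNorm_le d ht₀ hΦ₀ hp hp2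
    exact ⟨fun f hf => (hC f hf).trans_lt (ENNReal.mul_lt_top ENNReal.coe_lt_top hf), C, hC⟩
  have h2 : OrliczMod.orliczModSpace Φ d ⊆ OrliczMod.modSpace 2 d ∧
      ∃ C : ℝ≥0, ∀ f ∈ OrliczMod.orliczModSpace Φ d,
        OrliczMod.modNorm 2 f ≤ C * OrliczMod.orliczModNorm Φ f := by
    obtain ⟨C, hC⟩ := OrliczMod.exists_modNorm_two_le d hΦ ht₀ hΦ₀
    exact ⟨fun f hf => (hC f).trans_lt (ENNReal.mul_lt_top ENNReal.coe_lt_top hf),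
      C, fun f _ => hC f⟩
  refine ⟨h1, h2, fun f hf ε hε => ?_, fun p₀ hp₀ hp₀2 f hf => ?_⟩
  · obtain ⟨g, hg, hlt⟩ := OrliczMod.exists_modSpace_one_modNorm_two_sub_lt hf hε
    -- The approximants lie in `M¹`, which is contained in `M^Φ` by the first inclusion at `p = 1`.
    refine ⟨g, (h1 1 one_pos one_lt_two).1 ?_, hlt⟩
    rwa [ENNReal.ofReal_one]
  · have hf2 : f ∈ OrliczMod.modSpace 2 d := h2.1 ((h1 p₀ (by linarith) hp₀2).1 hf)
    refine ⟨OrliczMod.tendsto_eLpNorm_of_lt_two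
      (OrliczMod.continuous_stft f).aestronglyMeasurable hp₀ hp₀2 hf hf2, ?_⟩
    obtain ⟨g, hg⟩ := OrliczMod.exists_isL2Function hf2
    refine ⟨g, hg, fun u hu _ φ hφ => ?_⟩
    refine OrliczMod.tendsto_eLpNorm_of_lt_two
      (OrliczMod.aestronglyMeasurable_stftFun hu hφ hg) hp₀ hp₀2
      (OrliczMod.eLpNorm_stftFun_lt_top hu hφ hg hp₀ hf) ?_
    have h3 := OrliczMod.eLpNorm_stftFun_lt_top hu hφ hg (p := 2) one_le_two
      (by rwa [ENNReal.ofReal_ofNat])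
    rwa [ENNReal.ofReal_ofNat] at h3
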